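/- For $N\ge 1$ and $r>0$ let $\sigma^N_r$ be the uniform probability measure on the sphere $\mathbb S^{N-1}(r)\subset\mathbb R^N$ of radius $r$, and let $\sigma^N=\sigma^N_{\sqrt N}$ (Kac's sphere is $\mathbb S^{N-1}(\sqrt N)$). Let $\gamma(v)=(2\pi)^{-1/2}e^{-v^2/2}$, $f^{\otimes k}(v_1,\dots,v_k)=\prod_{i=1}^k f(v_i)$ and $\mathcal Z_N(f,r)=\int_{\mathbb S^{N-1}(r)} f^{\otimes N}\,d\sigma^N_r$. A family of symmetric probability densities $F_N$ (with respect to $\sigma^N$) on Kac's spheres, given for all sufficiently large $N$, is called $f$-chaotic if for every $k\in\mathbb N$ the $k$-th marginal $\Pi_k(F_N)$ of $F_N\,d\sigma^N$ (the law of the first $k$ coordinates) converges to $f^{\otimes k}(v)\,dv$ as $N\to\infty$, weakly against bounded continuous functions on $\mathbb R^k$. It is called $f$-entropically chaotic if it is $f$-chaotic and $$\lim_{N\to\infty}\frac{H_N(F_N)}{N}=H(f|\gamma),\qquad H_N(F_N)=\int_{\mathbb S^{N-1}(\sqrt N)}F_N\log F_N\,d\sigma^N,\quad H(f|\gamma)=\int_{\mathbb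 R} f(v)\log\frac{f(v)}{\gamma(v)}\,dv,$$ where $H(f|\gamma)$ and, for all large $N$, $H_N(F_N)$ are absolutely convergent integrals. **Theorem.** Let $f$ be a probability density on $\mathbb R$ such that $f\in L^p(\mathbb R)$ for some $p>1$ and $\int_{\mathbb R} x^2 f(x)\,dx=1$. Let $$\nu_f(x)=\int_{-\sqrt x}^{\sqrt x}y^4 f(y)\,dy$$ and assume that $\nu_f(x)\sim C_S\,x^{2-\alpha}$ as $x\to\infty$, for some $C_S>0$ and $1<\alpha<2$. Then $0<\mathcal Z_N(f,\sqrt N)<\infty$ for all sufficiently large $N$, and the family $$F_N=\frac{f^{\otimes N}}{\mathcal Z_N(f,\sqrt N)}$$ is $f$-chaotic. Moreover, it is $f$-entropically chaotic. -/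

import Mathlib

open MeasureTheory Filter Topology
open scoped BoundedContinuousFunction ENNReal Asymptotics

namespace KacChaos

noncomputable section

/-- A probability density on the real line. (The last clause also forces integrability.) -/
structure IsProbDensity (f : ℝ → ℝ) : Prop where
  measurable : Measurable f
  nonneg : ∀ x, 0 ≤ f x
  integral_eq_one : ∫ x, f x = 1

/-- The tensor power `f^{⊗N}(v₁,…,v_N) = f(v₁)⋯f(v_N)`. -/
def tensorPower (f : ℝ → ℝ) (N : ℕ) (v : Fin N → ℝ) : ℝ := ∏ i, f (v i)

/-- The surface measure of the Euclidean unit sphere of `ℝ^N`. -/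
def unitSphereMeasure (N : ℕ) :
    Measure (Metric.sphere (0 : EuclideanSpace ℝ (Fin N)) 1) :=
  (volume : Measure (EuclideanSpace ℝ (Fin N))).toSphere

/-- The uniform probability measure `σ^N_r` on the sphere `{v ∈ ℝ^N : ∑ vᵢ² = r²}`, as a measure on
`ℝ^N` carried by that sphere: the image of the normalised surface measure of the Euclidean unit
sphere under `x ↦ r x`. -/
def sphereUniform (N : ℕ) (r : ℝ) : Measure (Fin N → ℝ) :=
  (unitSphereMeasure N Set.univ)⁻¹ •
    (unitSphereMeasure N).map
      (fun (x : Metric.sphere (0 : EuclideanSpace ℝ (Fin N)) 1) (i : Fin N) =>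
        r * (x : EuclideanSpace ℝ (Fin N)) i)

/-- The uniform probability measure `σ^N` on Kac's sphere, the sphere of radius `√N` in `ℝ^N`. -/
def kacMeasure (N : ℕ) : Measure (Fin N → ℝ) := sphereUniform N (Real.sqrt N)

/-- The normalisation function `Z_N(f,r) = ∫ f^{⊗N} dσ^N_r`. -/
def normalisation (N : ℕ) (f : ℝ → ℝ) (r : ℝ) : ℝ :=
  ∫ v, tensorPower f N v ∂(sphereUniform N r)

/-- The conditioned tensor power `F_N = f^{⊗N} / Z_N(f,√N)`. -/
def conditionedTensor (f : ℝ → ℝ) (N : ℕ) (v : Fin N → ℝ) : ℝ :=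
  tensorPower f N v / normalisation N f (Real.sqrt N)

/-- `F` is a symmetric probability density on Kac's sphere with respect to `σ^N`.
(The clause on the integral also forces integrability.) -/
structure IsSymmetricDensity (N : ℕ) (F : (Fin N → ℝ) → ℝ) : Prop where
  nonneg : ∀ᵐ v ∂(kacMeasure N), 0 ≤ F v
  integral_eq_one : ∫ v, F v ∂(kacMeasure N) = 1
  symmetric : ∀ τ : Equiv.Perm (Fin N), ∀ᵐ v ∂(kacMeasure N), F (v ∘ τ) = F v

/-- The projection on the first `k` coordinates (missing coordinates, for `N < k`, are `0`). -/
def firstCoords (k N : ℕ) (v : Fin N → ℝ) (i : Fin k) : ℝ :=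
  if h : (i : ℕ) < N then v ⟨i, h⟩ else 0

/-- The `k`-th marginal `Π_k(F)` of the measure `F dσ^N`. -/
def marginal (k N : ℕ) (F : (Fin N → ℝ) → ℝ) : Measure (Fin k → ℝ) :=
  ((kacMeasure N).withDensity (fun v => ENNReal.ofReal (F v))).map (firstCoords k N)

/-- The measure `f^{⊗k}(v) dv` on `ℝ^k`. -/
def tensorMeasure (f : ℝ → ℝ) (k : ℕ) : Measure (Fin k → ℝ) :=
  (volume : Measure (Fin k → ℝ)).withDensity (fun v => ENNReal.ofReal (tensorPower f k v))

/-- The family `(F_N)` of symmetric probability densities on Kac's spheres, defined for all large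
enough `N`, is `f`-chaotic: for every `k`, the marginals `Π_k(F_N)` converge to `f^{⊗k}`, weakly
against bounded continuous functions. -/
structure IsChaotic (F : (N : ℕ) → (Fin N → ℝ) → ℝ) (f : ℝ → ℝ) : Prop where
  density : ∀ᶠ N : ℕ in atTop, IsSymmetricDensity N (F N)
  tendsto_marginal : ∀ (k : ℕ) (φ : (Fin k → ℝ) →ᵇ ℝ),
    Tendsto (fun N : ℕ => ∫ w, φ w ∂(marginal k N (F N))) atTop
      (𝓝 (∫ w, φ w ∂(tensorMeasure f k)))

/-- The entropy `H_N(F) = ∫ F log F dσ^N` on Kac's sphere. -/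
def kacEntropy (N : ℕ) (F : (Fin N → ℝ) → ℝ) : ℝ :=
  ∫ v, F v * Real.log (F v) ∂(kacMeasure N)

/-- The relative entropy `H(f|γ) = ∫ f log (f/γ)` with respect to the standard Gaussian `γ`. -/
def gaussianRelEntropy (f : ℝ → ℝ) : ℝ :=
  ∫ v, f v * Real.log (f v / ProbabilityTheory.gaussianPDFReal 0 1 v)

/-- The family `(F_N)` is `f`-entropically chaotic: it is `f`-chaotic, and `H_N(F_N)/N → H(f|γ)`,
all these entropies (for large `N`) being convergent integrals. -/
structure IsEntropicallyChaotic (F : (N : ℕ) → (Fin N → ℝ) → ℝ) (f : ℝ → ℝ) : Prop where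
  chaotic : IsChaotic F f
  integrable_kac : ∀ᶠ N : ℕ in atTop,
    Integrable (fun v => F N v * Real.log (F N v)) (kacMeasure N)
  integrable_gaussian :
    Integrable (fun v => f v * Real.log (f v / ProbabilityTheory.gaussianPDFReal 0 1 v))
  tendsto_entropy :
    Tendsto (fun N : ℕ => kacEntropy N (F N) / N) atTop (𝓝 (gaussianRelEntropy f))

/-- The truncated fourth moment `ν_f(x) = ∫_{-√x}^{√x} y⁴ f(y) dy`. -/
def truncatedFourthMoment (f : ℝ → ℝ) (x : ℝ) : ℝ :=
  ∫ y in (-Real.sqrt x)..(Real.sqrt x), y ^ 4 * f y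

end

end KacChaos

/-! Let `V₁, V₂, …` be independent with density `f`, and let `h_N` be the density of `V₁² + ⋯ +
V_N²` (`sumSqDensity`). Then `F_N dσ^N` is the law of `(V₁,…,V_N)` conditioned on `∑ Vᵢ² = N`, and
`Z_N(f,√N) = h_N(N) / κ_N` with an explicit geometric constant `κ_N` (`kacFactor`). Integrating out
coordinates, the `k`-th marginal has density `f^{⊗k}(w) h_{N-k}(N - |w|²) / h_N(N)`. Everything thus
reduces to a local limit theorem (`exists_local_limit`): `N^{1/α} h_N(N + t)` tends to one `g > 0`
for every fixed `t`, and `N^{1/α} h_N` is bounded uniformly for large `N`. The ratio above is then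
bounded and tends to `1`, so dominated convergence gives chaos.

For the entropy, `H_N(F_N) = N ∫ f log f · h_{N-1}(N - x²) / h_N(N) dx - log h_N(N) + log κ_N`.
After division by `N` the first term tends to `∫ f log f`, the second vanishes because `h_N(N)`
decays polynomially, and Stirling gives `log κ_N / N → log(2π)/2 + 1/2 = -∫ f log γ`.

The local limit theorem is Fourier inversion for `φ(ξ) = E e^{iξV²}` (`sqCharFun`). Near `0`, an
integration by parts against `ν_f` gives `φ(ξ) e^{-iξ} = 1 - c ξ^α + o(ξ^α)` with `Re c > 0`
(`exists_tendsto_sqCharFun`). Away from `0`, `|φ|` is bounded by some `ρ < 1`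
(`exists_norm_sqCharFun_le`), and a high power of `φ` is integrable because `f ∈ L^p`
(`exists_integrable_sqCharFun_pow`). Rescaling `ξ = η N^{-1/α}` yields `g = π⁻¹ Re ∫₀^∞ exp(-c s^α)
ds`, which is positive since `|arg c| < π/2` and `α > 1`.

A sphere is a null set, so `h_N` has to be known at every point and not only almost everywhere. It
is therefore defined by surface integrals, satisfies an exact convolution recursion
(`sumSqDensity_succ`), and one more convolution turns the almost everywhere inversion formula into
an identity at each point (`exists_sumSqDensity_eq`). -/

namespace KacChaos

noncomputable section

/-! ### Integration over spheres -/

/-- The integral of `F` against the measure `δ(|v|² - u) dv` on `ℝ^N`. -/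
def sphereSlice (N : ℕ) (F : (Fin N → ℝ) → ℝ≥0∞) (u : ℝ) : ℝ≥0∞ :=
  if 0 < u then ENNReal.ofReal (u ^ (((N : ℝ) - 2) / 2) / 2) *
    ∫⁻ ω, F (fun i => Real.sqrt u * (ω : EuclideanSpace ℝ (Fin N)) i) ∂unitSphereMeasure N
  else 0

instance (N : ℕ) : IsFiniteMeasure (unitSphereMeasure N) := by
  unfold unitSphereMeasure; infer_instance

lemma sphereSlice_of_nonpos {N : ℕ} (F : (Fin N → ℝ) → ℝ≥0∞) {u : ℝ} (hu : u ≤ 0) :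
    sphereSlice N F u = 0 := if_neg hu.not_gt

lemma sum_sq_unitSphere {N : ℕ} (ω : Metric.sphere (0 : EuclideanSpace ℝ (Fin N)) 1) :
    ∑ i, (ω : EuclideanSpace ℝ (Fin N)) i ^ 2 = 1 := by
  have h : ‖(ω : EuclideanSpace ℝ (Fin N))‖ = 1 := by simp
  rw [← EuclideanSpace.real_norm_sq_eq, h, one_pow]

lemma sphereSlice_congr {N : ℕ} {F G : (Fin N → ℝ) → ℝ≥0∞} {u : ℝ}
    (h : ∀ v, ∑ i, v i ^ 2 = u → F v = G v) : sphereSlice N F u = sphereSlice N G u := by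
  unfold sphereSlice
  split_ifs with hu
  · congr 1
    refine lintegral_congr fun ω => h _ ?_
    simp_rw [mul_pow, ← Finset.mul_sum, sum_sq_unitSphere, Real.sq_sqrt hu.le, mul_one]
  · rfl

lemma sphereSlice_const_mul {N : ℕ} (c : ℝ≥0∞) (hc : c ≠ ∞) (F : (Fin N → ℝ) → ℝ≥0∞) (u : ℝ) :
    sphereSlice N (fun v => c * F v) u = c * sphereSlice N F u := by
  unfold sphereSlice
  split_ifs
  · rw [lintegral_const_mul' _ _ hc]; ring
  · simp

lemma sphereSlice_smul {N : ℕ} (F : (Fin N → ℝ) → ℝ≥0∞) {t : ℝ} (ht : 0 < t) (u : ℝ) :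
    sphereSlice N F (t * u) = ENNReal.ofReal (t ^ (((N : ℝ) - 2) / 2)) *
      sphereSlice N (fun v => F (fun i => Real.sqrt t * v i)) u := by
  unfold sphereSlice
  by_cases hu : 0 < u
  · rw [if_pos hu, if_pos (mul_pos ht hu), ← mul_assoc, ← ENNReal.ofReal_mul (by positivity),
      Real.mul_rpow ht.le hu.le, mul_div_assoc, Real.sqrt_mul ht.le]
    simp_rw [mul_assoc]
  · rw [if_neg hu, if_neg (by nlinarith), mul_zero]

lemma measurable_sphereSlice_comp {N : ℕ} {β : Type*} [MeasurableSpace β]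
    {F : β → (Fin N → ℝ) → ℝ≥0∞} (hF : Measurable (fun p : β × (Fin N → ℝ) => F p.1 p.2))
    {g : β → ℝ} (hg : Measurable g) :
    Measurable (fun b => sphereSlice N (F b) (g b)) := by
  unfold sphereSlice
  refine Measurable.ite (hg measurableSet_Ioi) ?_ measurable_const
  refine Measurable.mul (by fun_prop) ?_
  refine Measurable.lintegral_prod_right'
    (f := fun p : β × Metric.sphere (0 : EuclideanSpace ℝ (Fin N)) 1 =>
      F p.1 (fun i => Real.sqrt (g p.1) * (p.2 : EuclideanSpace ℝ (Fin N)) i)) ?_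
  refine hF.comp (measurable_fst.prodMk (measurable_pi_lambda _ fun i => ?_))
  fun_prop

lemma measurable_sphereSlice {N : ℕ} {F : (Fin N → ℝ) → ℝ≥0∞} (hF : Measurable F) :
    Measurable (sphereSlice N F) :=
  measurable_sphereSlice_comp (F := fun _ : ℝ => F) (hF.comp measurable_snd) measurable_id

lemma lintegral_eq_lintegral_sphere {N : ℕ} (hN : N ≠ 0) {F : (Fin N → ℝ) → ℝ≥0∞}
    (hF : Measurable F) :
    ∫⁻ v, F v = ∫⁻ r in Set.Ioi (0 : ℝ), ENNReal.ofReal (r ^ (N - 1)) *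
      ∫⁻ ω, F (fun i => r * (ω : EuclideanSpace ℝ (Fin N)) i) ∂unitSphereMeasure N := by
  have : Nonempty (Fin N) := Fin.pos_iff_nonempty.1 (Nat.pos_of_ne_zero hN)
  set G : EuclideanSpace ℝ (Fin N) → ℝ≥0∞ := fun v => F (fun i => v i) with hG
  have hGm : Measurable G := hF.comp (by fun_prop)
  have h1 : ∫⁻ v, F v = ∫⁻ x, G x :=
    ((PiLp.volume_preserving_ofLp (Fin N)).lintegral_comp hF).symm
  have h2 : ∫⁻ x, G x = ∫⁻ x : ({0}ᶜ : Set (EuclideanSpace ℝ (Fin N))), G x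
      ∂((volume : Measure (EuclideanSpace ℝ (Fin N))).comap (↑)) := by
    rw [lintegral_subtype_comap (measurableSet_singleton _).compl, restrict_compl_singleton]
  have h3 := (volume : Measure (EuclideanSpace ℝ (Fin N))).measurePreserving_homeomorphUnitSphereProd
    |>.lintegral_comp_emb (Homeomorph.measurableEmbedding _)
      (fun p => G (p.2.1 • (p.1 : EuclideanSpace ℝ (Fin N))))
  rw [h1, h2]
  refine Eq.trans (lintegral_congr fun x => ?_) (h3.trans ?_)
  · congr 1
    have := congrArg Subtype.val ((homeomorphUnitSphereProd _).symm_apply_apply x)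
    rw [homeomorphUnitSphereProd_symm_apply_coe] at this
    exact this.symm
  · rw [lintegral_prod_symm', Measure.volumeIoiPow, finrank_euclideanSpace_fin,
      lintegral_withDensity_eq_lintegral_mul _ (by fun_prop)]
    · rw [← lintegral_subtype_comap measurableSet_Ioi]
      rfl
    · refine Measurable.lintegral_prod_left'
        (f := fun p : Metric.sphere (0 : EuclideanSpace ℝ (Fin N)) 1 × Set.Ioi (0 : ℝ) =>
          G (p.2.1 • (p.1 : EuclideanSpace ℝ (Fin N)))) ?_
      exact hGm.comp (by fun_prop)
    · exact hGm.comp (by fun_prop)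

/-- Polar coordinates and `u = r²`: `r^{N-1} dr = u^{(N-2)/2} / 2 du`, which is the weight built
into `sphereSlice`. -/
lemma lintegral_eq_lintegral_sphereSlice {N : ℕ} (hN : N ≠ 0) {F : (Fin N → ℝ) → ℝ≥0∞}
    (hF : Measurable F) : ∫⁻ v, F v = ∫⁻ u, sphereSlice N F u := by
  have himg : Set.image (fun r : ℝ => r ^ 2) (Set.Ioi 0) = Set.Ioi 0 := by
    ext u
    constructor
    · rintro ⟨r, hr, rfl⟩; exact pow_pos (Set.mem_Ioi.1 hr) 2
    · intro hu; exact ⟨Real.sqrt u, Real.sqrt_pos.2 hu, Real.sq_sqrt (le_of_lt hu)⟩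
  have h := lintegral_image_eq_lintegral_abs_deriv_mul (s := Set.Ioi (0 : ℝ))
    (f := fun r => r ^ 2) (f' := fun r => 2 * r) measurableSet_Ioi
    (fun r _ => by simpa using (hasDerivAt_pow 2 r).hasDerivWithinAt)
    (fun a ha b hb hab => (pow_left_inj₀ (le_of_lt ha) (le_of_lt hb) two_ne_zero).1 hab)
    (sphereSlice N F)
  rw [himg] at h
  have hs : Function.support (sphereSlice N F) ⊆ Set.Ioi 0 := by
    intro u hu
    by_contra h'
    exact hu (sphereSlice_of_nonpos F (not_lt.1 h'))
  rw [lintegral_eq_lintegral_sphere hN hF, ← setLIntegral_eq_of_support_subset hs, h]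
  · refine setLIntegral_congr_fun measurableSet_Ioi fun r (hr : 0 < r) => ?_
    simp only [sphereSlice, if_pos (pow_pos hr 2), Real.sqrt_sq hr.le]
    rw [← mul_assoc, ← ENNReal.ofReal_mul (abs_nonneg _)]
    congr 2
    rw [abs_of_pos (by positivity), ← Real.rpow_natCast, ← Real.rpow_natCast, ← Real.rpow_mul hr.le,
      Nat.cast_sub (Nat.one_le_iff_ne_zero.2 hN)]
    rw [show ((N : ℝ) - (1 : ℕ)) = 1 + (((2 : ℕ) : ℝ) * ((N - 2) / 2)) by push_cast; ring,
      Real.rpow_add hr, Real.rpow_one]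
    ring

lemma lintegral_comp_mul_left_real {a : ℝ} (ha : 0 < a) (g : ℝ → ℝ≥0∞) :
    ∫⁻ x, g x = ENNReal.ofReal a * ∫⁻ x, g (a * x) := by
  conv_lhs => rw [← Real.smul_map_volume_mul_left ha.ne', abs_of_pos ha]
  rw [lintegral_smul_measure, smul_eq_mul]
  congr 1
  exact (Homeomorph.mulLeft₀ a ha.ne').measurableEmbedding.lintegral_map _

/-- A functional that, like `sphereSlice`, only sees the sphere `|v|² = u` and is homogeneous in `u`,
is recovered from its integral over all `u`. -/
lemma lintegral_radial_extension {n : ℕ} (T : ((Fin n → ℝ) → ℝ≥0∞) → ℝ → ℝ≥0∞) (e : ℝ)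
    (hcongr : ∀ F G u, (∀ v : Fin n → ℝ, ∑ i, v i ^ 2 = u → F v = G v) → T F u = T G u)
    (hscale : ∀ F (t : ℝ), 0 < t → ∀ u, T F (t * u) =
      ENNReal.ofReal (t ^ e) * T (fun v => F (fun i => Real.sqrt t * v i)) u)
    (hzero : ∀ u, T (fun _ => 0) u = 0)
    (F : (Fin n → ℝ) → ℝ≥0∞) {u : ℝ} (hu : 0 < u) :
    ∫⁻ t, T (fun v => (Set.Ioo (1 : ℝ) 2).indicator (fun s =>
      F (fun i => Real.sqrt (u / s) * v i)) (∑ i, v i ^ 2)) t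
      = (∫⁻ t in Set.Ioo (1 : ℝ) 2, ENNReal.ofReal ((t / u) ^ e)) * T F u := by
  rw [← lintegral_mul_const _ (by fun_prop), ← lintegral_indicator measurableSet_Ioo]
  refine lintegral_congr fun t => ?_
  by_cases ht : t ∈ Set.Ioo (1 : ℝ) 2
  · have ht0 : 0 < t := by linarith [ht.1]
    rw [Set.indicator_of_mem ht]
    conv_lhs => rw [show t = (t / u) * u by field_simp]
    rw [hscale _ _ (by positivity)]
    congr 1
    refine hcongr _ _ _ fun v hv => ?_
    have hq : ∑ i, (Real.sqrt (t / u) * v i) ^ 2 = t := by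
      simp_rw [mul_pow, ← Finset.mul_sum, hv, Real.sq_sqrt (div_pos ht0 hu).le]
      field_simp
    rw [hq, Set.indicator_of_mem ht]
    congr 1
    ext i
    rw [← mul_assoc, ← Real.sqrt_mul (by positivity)]
    rw [show u / t * (t / u) = 1 by field_simp, Real.sqrt_one, one_mul]
  · rw [Set.indicator_of_notMem ht]
    rw [hcongr _ (fun _ => 0) t (fun v hv => by rw [hv, Set.indicator_of_notMem ht]), hzero]

lemma measurable_insertNth {n : ℕ} (i : Fin (n + 1)) :
    Measurable (fun p : ℝ × (Fin n → ℝ) => (i.insertNth p.1 p.2 : Fin (n + 1) → ℝ)) :=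
  (MeasurableEquiv.piFinSuccAbove (fun _ : Fin (n + 1) => ℝ) i).symm.measurable

lemma lintegral_insertNth {n : ℕ} (i : Fin (n + 1)) {F : (Fin (n + 1) → ℝ) → ℝ≥0∞}
    (hF : Measurable F) : ∫⁻ v, F v = ∫⁻ x, ∫⁻ y, F (i.insertNth x y) := by
  rw [← ((volume_preserving_piFinSuccAbove (fun _ : Fin (n + 1) => ℝ) i).symm _).lintegral_comp hF,
    Measure.volume_eq_prod, lintegral_prod _ (by
      exact (hF.comp (measurable_insertNth i)).aemeasurable)]
  rfl

lemma sum_sq_insertNth {n : ℕ} (i : Fin (n + 1)) (x : ℝ) (y : Fin n → ℝ) :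
    ∑ j, (i.insertNth x y : Fin (n + 1) → ℝ) j ^ 2 = x ^ 2 + ∑ j, y j ^ 2 := by
  rw [Fin.sum_univ_succAbove _ i]
  simp

lemma mul_insertNth {n : ℕ} (i : Fin (n + 1)) (c x : ℝ) (y : Fin n → ℝ) :
    (fun j => c * (i.insertNth x y : Fin (n + 1) → ℝ) j) =
      i.insertNth (c * x) (fun j => c * y j) := by
  ext j
  refine Fin.succAboveCases i ?_ (fun j => ?_) j <;> simp

/-- Fubini's theorem on spheres: integrating out the coordinate `i`. -/
theorem sphereSlice_succ {n : ℕ} (hn : n ≠ 0) (i : Fin (n + 1)) {F : (Fin (n + 1) → ℝ) → ℝ≥0∞}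
    (hF : Measurable F) (u : ℝ) :
    sphereSlice (n + 1) F u =
      ∫⁻ x, sphereSlice n (fun y => F (i.insertNth x y)) (u - x ^ 2) := by
  rcases le_or_gt u 0 with hu | hu
  · rw [sphereSlice_of_nonpos _ hu]
    symm
    simp_rw [fun x : ℝ => sphereSlice_of_nonpos (fun y => F (i.insertNth x y))
      (show u - x ^ 2 ≤ 0 by nlinarith [sq_nonneg x]), lintegral_zero]
  -- Fubini alone would give the identity for almost every `u`. To reach the given `u`, `F` is
  -- extended off the sphere `|v|² = u` to be constant along rays and cut off to the shell `1 < |v|²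
  -- < 2`. Both sides are homogeneous in `u` with the same exponent, so integrating over the shell
  -- loses nothing.
  set Φ : (Fin (n + 1) → ℝ) → ℝ≥0∞ := fun v => (Set.Ioo (1 : ℝ) 2).indicator (fun s =>
      F (fun i => Real.sqrt (u / s) * v i)) (∑ i, v i ^ 2) with hΦ
  have hΦm : Measurable Φ := by
    have : Φ = ({v : Fin (n + 1) → ℝ | ∑ i, v i ^ 2 ∈ Set.Ioo (1 : ℝ) 2}).indicator
        (fun v => F (fun i => Real.sqrt (u / ∑ i, v i ^ 2) * v i)) := by
      ext v; simp [hΦ, Set.indicator]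
    rw [this]
    refine Measurable.indicator (hF.comp (by fun_prop)) ?_
    exact (by fun_prop : Measurable fun v : Fin (n + 1) → ℝ => ∑ i, v i ^ 2) measurableSet_Ioo
  have h1 := lintegral_radial_extension (sphereSlice (n + 1)) ((((n + 1 : ℕ) : ℝ) - 2) / 2)
    (fun F G u h => sphereSlice_congr h) (fun F t ht u => sphereSlice_smul F ht u)
    (fun u => by simp [sphereSlice]) F hu
  have h2 := lintegral_radial_extension
    (fun F u => ∫⁻ x, sphereSlice n (fun y => F (i.insertNth x y)) (u - x ^ 2))
    ((((n + 1 : ℕ) : ℝ) - 2) / 2)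
    (fun F G u h => lintegral_congr fun x => sphereSlice_congr fun y hy => h _ (by
      rw [sum_sq_insertNth, hy]; ring))
    (fun F t ht u => by
      rw [lintegral_comp_mul_left_real (Real.sqrt_pos.2 ht), ← lintegral_const_mul' _ _ (by simp),
        ← lintegral_const_mul' _ _ (by simp)]
      refine lintegral_congr fun x => ?_
      rw [mul_pow, Real.sq_sqrt ht.le, ← mul_sub, sphereSlice_smul _ ht, ← mul_assoc,
        ← ENNReal.ofReal_mul (Real.sqrt_nonneg _)]
      congr 2
      · rw [Real.sqrt_eq_rpow, ← Real.rpow_add ht]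
        congr 1; push_cast; ring
      · ext y
        exact congrArg F (mul_insertNth i _ x y).symm)
    (fun u => by simp [sphereSlice]) F hu
  have h3 : ∫⁻ t, sphereSlice (n + 1) Φ t =
      ∫⁻ t, ∫⁻ x, sphereSlice n (fun y => Φ (i.insertNth x y)) (t - x ^ 2) := by
    rw [← lintegral_eq_lintegral_sphereSlice (Nat.succ_ne_zero n) hΦm, lintegral_insertNth i hΦm]
    refine Eq.trans ?_ (lintegral_lintegral_swap ?_)
    · refine lintegral_congr fun x => ?_
      rw [lintegral_sub_right_eq_self (sphereSlice n (fun y => Φ (i.insertNth x y))),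
        lintegral_eq_lintegral_sphereSlice hn]
      exact hΦm.comp ((measurable_insertNth i).comp measurable_prodMk_left)
    · refine (measurable_sphereSlice_comp (β := ℝ × ℝ)
        (F := fun p y => Φ (i.insertNth p.1 y)) ?_ (g := fun p => p.2 - p.1 ^ 2) ?_).aemeasurable
      · exact hΦm.comp ((measurable_insertNth i).comp
          ((measurable_fst.comp measurable_fst).prodMk measurable_snd))
      · fun_prop
  have h4 := (h1.symm.trans h3).trans h2
  -- The common factor `∫₁² (t/u)^e dt` is positive and finite because the shell is bounded and
  -- stays away from `0`; hence it cancels.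
  refine (ENNReal.mul_right_inj ?_ ?_).1 h4
  · rw [← pos_iff_ne_zero, setLIntegral_pos_iff (by fun_prop)]
    have : Set.Ioo (1 : ℝ) 2 ⊆ (Function.support fun t : ℝ =>
        ENNReal.ofReal ((t / u) ^ ((((n + 1 : ℕ) : ℝ) - 2) / 2))) ∩ Set.Ioo (1 : ℝ) 2 := by
      refine Set.subset_inter (fun t ht => ?_) le_rfl
      have : 0 < t / u := div_pos (by linarith [ht.1]) hu
      simpa using Real.rpow_pos_of_pos this _
    refine lt_of_lt_of_le ?_ (measure_mono this)
    simp
  · refine IntegrableOn.setLIntegral_lt_top (s := Set.Ioo (1 : ℝ) 2) ?_ |>.ne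
    refine (ContinuousOn.integrableOn_Icc (a := 1) (b := 2) ?_).mono_set Set.Ioo_subset_Icc_self
    intro t ht
    refine ContinuousAt.continuousWithinAt ?_
    have : t / u ≠ 0 := (div_pos (by linarith [ht.1]) hu).ne'
    exact (continuousAt_id.div_const u).rpow_const (Or.inl this)

/-! ### The density of the sum of squares -/

lemma tensorPower_nonneg {f : ℝ → ℝ} (hf : IsProbDensity f) (N : ℕ) (v : Fin N → ℝ) :
    0 ≤ tensorPower f N v := Finset.prod_nonneg fun _ _ => hf.nonneg _

lemma measurable_tensorPower {f : ℝ → ℝ} (hf : IsProbDensity f) (N : ℕ) :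
    Measurable (tensorPower f N) :=
  Finset.measurable_fun_prod _ fun i _ => hf.measurable.comp (measurable_pi_apply i)

lemma tensorPower_insertNth (f : ℝ → ℝ) {n : ℕ} (i : Fin (n + 1)) (x : ℝ) (y : Fin n → ℝ) :
    tensorPower f (n + 1) (i.insertNth x y) = f x * tensorPower f n y := by
  unfold tensorPower
  rw [Fin.prod_univ_succAbove _ i]
  simp

/-- The density at `u` of `V₁² + ⋯ + V_N²`, where the `Vᵢ` are independent with density `f`. -/
def sumSqDensity (f : ℝ → ℝ) (N : ℕ) (u : ℝ) : ℝ≥0∞ :=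
  sphereSlice N (fun v => ENNReal.ofReal (tensorPower f N v)) u

lemma measurable_sumSqDensity {f : ℝ → ℝ} (hf : IsProbDensity f) (N : ℕ) :
    Measurable (sumSqDensity f N) :=
  measurable_sphereSlice (measurable_tensorPower hf N).ennreal_ofReal

lemma sphereSlice_coord {f : ℝ → ℝ} (hf : IsProbDensity f) {n : ℕ} (hn : n ≠ 0) (i : Fin (n + 1))
    {g : ℝ → ℝ} (hg : Measurable g) (u : ℝ) :
    sphereSlice (n + 1)
      (fun v => ENNReal.ofReal (g (v i)) * ENNReal.ofReal (tensorPower f (n + 1) v)) u =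
      ∫⁻ x, ENNReal.ofReal (g x) * ENNReal.ofReal (f x) * sumSqDensity f n (u - x ^ 2) := by
  rw [sphereSlice_succ hn i]
  · refine lintegral_congr fun x => ?_
    rw [sumSqDensity, ← sphereSlice_const_mul _ (by finiteness)]
    congr 1
    ext y
    rw [tensorPower_insertNth, ENNReal.ofReal_mul (hf.nonneg x), Fin.insertNth_apply_same, mul_assoc]
  · have := measurable_tensorPower hf (n + 1)
    fun_prop

lemma sumSqDensity_succ {f : ℝ → ℝ} (hf : IsProbDensity f) {n : ℕ} (hn : n ≠ 0) (u : ℝ) :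
    sumSqDensity f (n + 1) u =
      ∫⁻ x, ENNReal.ofReal (f x) * sumSqDensity f n (u - x ^ 2) := by
  have := sphereSlice_coord hf hn 0 (g := fun _ => 1) measurable_const u
  simpa [sumSqDensity] using this

lemma firstCoords_insertNth (k N : ℕ) (x : ℝ) (y : Fin N → ℝ) :
    firstCoords (k + 1) (N + 1) ((0 : Fin (N + 1)).insertNth x y) =
      (0 : Fin (k + 1)).insertNth x (firstCoords k N y) := by
  ext j
  refine Fin.cases ?_ (fun j => ?_) j
  · simp [firstCoords]
  · simp only [firstCoords, Fin.val_succ, Fin.insertNth_zero, add_lt_add_iff_right]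
    split_ifs with h
    · have : (Fin.cons x (fun j => y j) : Fin (N + 1) → ℝ) (Fin.succ ⟨j, h⟩) = y ⟨j, h⟩ :=
        Fin.cons_succ _ _ _
      simpa [h] using this
    · simp [h]

lemma measurable_firstCoords (k N : ℕ) : Measurable (firstCoords k N) := by
  refine measurable_pi_lambda _ fun i => ?_
  unfold firstCoords
  split_ifs <;> fun_prop

/-- Integrating out all but the first `k` coordinates. -/
theorem sphereSlice_firstCoords {f : ℝ → ℝ} (hf : IsProbDensity f) {m : ℕ} (hm : m ≠ 0) (k : ℕ)
    {Φ : (Fin k → ℝ) → ℝ} (hΦ : Measurable Φ) (u : ℝ) :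
    sphereSlice (m + k) (fun v => ENNReal.ofReal (Φ (firstCoords k (m + k) v)) *
      ENNReal.ofReal (tensorPower f (m + k) v)) u =
      ∫⁻ w, ENNReal.ofReal (Φ w) * ENNReal.ofReal (tensorPower f k w) *
        sumSqDensity f m (u - ∑ i, w i ^ 2) := by
  induction k generalizing u with
  | zero =>
    have h0 : ∀ v, firstCoords 0 (m + 0) v = default := fun v => Subsingleton.elim _ _
    simp only [h0]
    rw [sphereSlice_const_mul _ (by finiteness), lintegral_unique]
    have h1 : (volume : Measure (Fin 0 → ℝ)) Set.univ = 1 := by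
      rw [volume_pi, Measure.pi_of_empty, Measure.dirac_apply_of_mem (Set.mem_univ _)]
    rw [h1, mul_one]
    simp only [tensorPower, sumSqDensity, Finset.univ_eq_empty, Finset.prod_empty, Finset.sum_empty,
      ENNReal.ofReal_one, mul_one, sub_zero]
    congr 3
    exact Subsingleton.elim _ _
  | succ k ih =>
    have hm1 := measurable_tensorPower hf (m + k + 1)
    have hm2 := measurable_firstCoords (k + 1) (m + k + 1)
    have hm3 := measurable_tensorPower hf (k + 1)
    have hm4 := measurable_sumSqDensity hf m
    have hins := fun x : ℝ => (measurable_insertNth (0 : Fin (k + 1))).comp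
      (measurable_prodMk_left (x := x))
    rw [← add_assoc, sphereSlice_succ (by omega) 0 (by fun_prop),
      lintegral_insertNth 0 (by fun_prop)]
    refine lintegral_congr fun x => ?_
    have := ih (Φ := fun w => Φ ((0 : Fin (k + 1)).insertNth x w)) (hΦ.comp (hins x)) (u - x ^ 2)
    simp only [tensorPower_insertNth, firstCoords_insertNth, ENNReal.ofReal_mul (hf.nonneg x),
      sum_sq_insertNth, ← sub_sub] at this ⊢
    calc _ = sphereSlice (m + k) (fun y => ENNReal.ofReal (f x) *
          (ENNReal.ofReal (Φ ((0 : Fin (k + 1)).insertNth x (firstCoords k (m + k) y))) *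
          ENNReal.ofReal (tensorPower f (m + k) y))) (u - x ^ 2) := by
          congr 1; ext y; ring
      _ = _ := by
          rw [sphereSlice_const_mul _ (by finiteness), this, ← lintegral_const_mul' _ _ (by finiteness)]
          refine lintegral_congr fun w => ?_
          ring

/-- The law of `V₁² + ⋯ + V_N²` has density `sumSqDensity f N`. -/
theorem map_sum_sq_tensorMeasure {f : ℝ → ℝ} (hf : IsProbDensity f) {N : ℕ} (hN : N ≠ 0) :
    (tensorMeasure f N).map (fun v => ∑ i, v i ^ 2) = volume.withDensity (sumSqDensity f N) := by
  have hq : Measurable fun v : Fin N → ℝ => ∑ i, v i ^ 2 := by fun_prop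
  ext s hs
  rw [Measure.map_apply hq hs, tensorMeasure, withDensity_apply _ (hq hs), withDensity_apply _ hs,
    ← lintegral_indicator (hq hs), ← lintegral_indicator hs, lintegral_eq_lintegral_sphereSlice hN]
  · refine lintegral_congr fun u => ?_
    by_cases hu : u ∈ s
    · rw [Set.indicator_of_mem hu]
      exact sphereSlice_congr fun v hv => Set.indicator_of_mem (by simpa [hv] using hu) _
    · rw [Set.indicator_of_notMem hu, sphereSlice_congr (G := fun _ => 0)]
      · simp [sphereSlice]
      · exact fun v hv => Set.indicator_of_notMem (by simpa [hv] using hu) _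
  · exact (measurable_tensorPower hf N).ennreal_ofReal.indicator (hq hs)

/-- `sphereSlice` in terms of the uniform measure on the sphere. -/
lemma sphereSlice_eq_lintegral_sphereUniform {N : ℕ} (hN : N ≠ 0) {F : (Fin N → ℝ) → ℝ≥0∞}
    (hF : Measurable F) {u : ℝ} (hu : 0 < u) :
    sphereSlice N F u = ENNReal.ofReal (u ^ (((N : ℝ) - 2) / 2) / 2) *
      unitSphereMeasure N Set.univ * ∫⁻ v, F v ∂(sphereUniform N (Real.sqrt u)) := by
  have : Nonempty (Fin N) := Fin.pos_iff_nonempty.1 (Nat.pos_of_ne_zero hN)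
  have h0 : unitSphereMeasure N Set.univ ≠ 0 := by
    rw [unitSphereMeasure, Ne, Measure.measure_univ_eq_zero]
    exact Measure.toSphere_ne_zero _
  rw [sphereSlice, if_pos hu, sphereUniform, lintegral_smul_measure, lintegral_map hF (by fun_prop),
    mul_assoc, smul_eq_mul, ← mul_assoc (unitSphereMeasure N Set.univ),
    ENNReal.mul_inv_cancel h0 (measure_ne_top _ _), one_mul]

/-! ### The characteristic function of the square and the kernel of its expansion -/

open Complex in
/-- The characteristic function of `V²`, where `V` has density `f`. -/
def sqCharFun (f : ℝ → ℝ) (ξ : ℝ) : ℂ := ∫ x : ℝ, cexp (ξ * x ^ 2 * I) * f x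

open Complex in
/-- The kernel `(e^{it} - 1 - it) / t²`. -/
def expKernel (t : ℝ) : ℂ := (cexp (t * I) - 1 - t * I) / t ^ 2

open Complex in
/-- The derivative of `expKernel`. -/
def expKernelDeriv (t : ℝ) : ℂ := I * (cexp (t * I) - 1) / t ^ 2 - 2 * (cexp (t * I) - 1 - t * I) / t ^ 3

section kernel
open Complex

lemma hasDerivAt_expKernel {t : ℝ} (ht : 0 < t) :
    HasDerivAt expKernel (expKernelDeriv t) t := by
  have ht' : (t : ℂ) ≠ 0 := by exact_mod_cast ht.ne'
  have h1 : HasDerivAt (fun z : ℂ => (cexp (z * I) - 1 - z * I) / z ^ 2)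
      (((cexp (t * I) * I - I) * (t : ℂ) ^ 2 - (cexp (t * I) - 1 - t * I) * (2 * t)) /
        ((t : ℂ) ^ 2) ^ 2) (t : ℂ) := by
    refine HasDerivAt.div ?_ ?_ (by positivity)
    · refine HasDerivAt.sub (HasDerivAt.sub_const _ ?_) ?_
      · simpa using ((hasDerivAt_id (t : ℂ)).mul_const I).cexp
      · simpa using (hasDerivAt_id (t : ℂ)).mul_const I
    · simpa using hasDerivAt_pow 2 (t : ℂ)
  have h2 : expKernelDeriv t = ((cexp (t * I) * I - I) * (t : ℂ) ^ 2 -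
      (cexp (t * I) - 1 - t * I) * (2 * t)) / ((t : ℂ) ^ 2) ^ 2 := by
    unfold expKernelDeriv
    field_simp
  rw [h2]
  exact h1.comp_ofReal

lemma norm_exp_mul_I_sub_one_le (t : ℝ) : ‖cexp (t * I) - 1‖ ≤ 2 := by
  calc _ ≤ ‖cexp (t * I)‖ + ‖(1 : ℂ)‖ := norm_sub_le _ _
    _ = 2 := by rw [norm_exp_ofReal_mul_I]; norm_num

lemma norm_expKernelDeriv_le_of_le_one {t : ℝ} (ht : 0 < t) (ht1 : t ≤ 1) :
    ‖expKernelDeriv t‖ ≤ 8 * t⁻¹ := by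
  have hn : ‖(t : ℂ) * I‖ = t := by simp [abs_of_pos ht]
  have h1 : ‖cexp (t * I) - 1‖ ≤ 2 * t := by
    simpa [abs_of_pos ht] using norm_exp_sub_one_le (x := (t : ℂ) * I) (by rwa [hn])
  have h2 : ‖cexp (t * I) - 1 - t * I‖ ≤ t ^ 2 := by
    simpa [abs_of_pos ht] using norm_exp_sub_one_sub_id_le (x := (t : ℂ) * I) (by rwa [hn])
  calc _ ≤ ‖I * (cexp (t * I) - 1) / t ^ 2‖ + ‖2 * (cexp (t * I) - 1 - t * I) / t ^ 3‖ :=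
        norm_sub_le _ _
    _ = ‖cexp (t * I) - 1‖ / t ^ 2 + 2 * ‖cexp (t * I) - 1 - t * I‖ / t ^ 3 := by
        simp [abs_of_pos ht]
    _ ≤ 2 * t / t ^ 2 + 2 * t ^ 2 / t ^ 3 := by gcongr
    _ = 4 * t⁻¹ := by field_simp; norm_num
    _ ≤ _ := by gcongr; norm_num

lemma norm_exp_sub_id_le (t : ℝ) (ht : 0 ≤ t) : ‖cexp (t * I) - 1 - t * I‖ ≤ 2 + t := by
  calc _ ≤ ‖cexp (t * I) - 1‖ + ‖(t : ℂ) * I‖ := norm_sub_le _ _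
    _ ≤ 2 + t := by
      gcongr
      · exact norm_exp_mul_I_sub_one_le t
      · simp [abs_of_nonneg ht]

lemma norm_expKernelDeriv_le_of_one_le {t : ℝ} (ht1 : 1 ≤ t) :
    ‖expKernelDeriv t‖ ≤ 8 * (t ^ 2)⁻¹ := by
  have ht : 0 < t := by linarith
  calc _ ≤ ‖I * (cexp (t * I) - 1) / t ^ 2‖ + ‖2 * (cexp (t * I) - 1 - t * I) / t ^ 3‖ :=
        norm_sub_le _ _
    _ = ‖cexp (t * I) - 1‖ / t ^ 2 + 2 * ‖cexp (t * I) - 1 - t * I‖ / t ^ 3 := by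
        simp [abs_of_pos ht]
    _ ≤ 2 / t ^ 2 + 2 * (2 + t) / t ^ 3 := by
        gcongr
        · exact norm_exp_mul_I_sub_one_le t
        · exact norm_exp_sub_id_le t ht.le
    _ ≤ 2 / t ^ 2 + 2 * (2 * t + t) / t ^ 3 := by gcongr; linarith
    _ = _ := by field_simp; norm_num

lemma tendsto_expKernel : Tendsto expKernel atTop (𝓝 0) := by
  have h : Tendsto (fun t : ℝ => 3 * t⁻¹) atTop (𝓝 0) := by
    simpa using tendsto_inv_atTop_zero.const_mul (3 : ℝ)
  refine squeeze_zero_norm' ?_ h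
  filter_upwards [eventually_ge_atTop 1] with t ht
  have ht0 : 0 < t := by linarith
  rw [expKernel, norm_div]
  calc _ ≤ (2 * t + t) / t ^ 2 := by
        gcongr
        · exact (norm_exp_sub_id_le t ht0.le).trans (by linarith)
        · simp
    _ = _ := by field_simp; norm_num

lemma measurable_expKernelDeriv : Measurable expKernelDeriv := by
  unfold expKernelDeriv
  fun_prop

/-- The bound `8/t` near `0` leaves `t^{1-α}`, integrable there since `α < 2`; the bound `8/t²` at
infinity leaves `t^{-α}`, integrable there since `α > 1`. This gives the dominating function for the
expansion. -/
lemma integrableOn_norm_expKernelDeriv_mul_rpow {α : ℝ} (h1 : 1 < α) (h2 : α < 2) :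
    IntegrableOn (fun t : ℝ => ‖expKernelDeriv t‖ * t ^ (2 - α)) (Set.Ioi 0) := by
  have hm : AEStronglyMeasurable (fun t : ℝ => ‖expKernelDeriv t‖ * t ^ (2 - α)) volume := by
    have := measurable_expKernelDeriv
    exact Measurable.aestronglyMeasurable (by fun_prop)
  rw [← Set.Ioc_union_Ioi_eq_Ioi (zero_le_one (α := ℝ))]
  refine IntegrableOn.union ?_ ?_
  · have hi : IntegrableOn (fun t : ℝ => 8 * t ^ (1 - α)) (Set.Ioc 0 1) := by
      refine Integrable.const_mul ?_ _
      exact (intervalIntegrable_iff_integrableOn_Ioc_of_le zero_le_one).1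
        (intervalIntegral.intervalIntegrable_rpow' (by linarith))
    refine Integrable.mono' hi hm.restrict ?_
    filter_upwards [ae_restrict_mem measurableSet_Ioc] with t ht
    rw [norm_mul, norm_norm, Real.norm_of_nonneg (Real.rpow_nonneg ht.1.le _)]
    calc _ ≤ 8 * t⁻¹ * t ^ (2 - α) := by
          gcongr
          · exact Real.rpow_nonneg ht.1.le _
          · exact norm_expKernelDeriv_le_of_le_one ht.1 ht.2
      _ = _ := by
          rw [mul_assoc, ← Real.rpow_neg_one, ← Real.rpow_add ht.1]
          congr 2; ring
  · have hi : IntegrableOn (fun t : ℝ => 8 * t ^ (-α)) (Set.Ioi 1) :=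
      (integrableOn_Ioi_rpow_of_lt (by linarith) one_pos).const_mul _
    refine Integrable.mono' hi hm.restrict ?_
    filter_upwards [ae_restrict_mem measurableSet_Ioi] with t ht
    have ht0 : 0 < t := lt_trans one_pos ht
    rw [norm_mul, norm_norm, Real.norm_of_nonneg (Real.rpow_nonneg ht0.le _)]
    calc _ ≤ 8 * (t ^ 2)⁻¹ * t ^ (2 - α) := by
          gcongr
          exact norm_expKernelDeriv_le_of_one_le (le_of_lt ht)
      _ = _ := by
          rw [mul_assoc, ← Real.rpow_natCast, ← Real.rpow_neg ht0.le, ← Real.rpow_add ht0]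
          congr 2; push_cast; ring

lemma integrableOn_expKernelDeriv {a : ℝ} (ha : 0 < a) :
    IntegrableOn expKernelDeriv (Set.Ioi a) := by
  -- Any exponent in `(1, 2)` would do: the extra factor `t^{1/2}` is at least `a^{1/2}` on `(a,
  -- ∞)`.
  have h := (integrableOn_norm_expKernelDeriv_mul_rpow (α := 3 / 2) (by norm_num) (by norm_num)).mono_set
    (Set.Ioi_subset_Ioi ha.le)
  refine Integrable.mono' (h.const_mul (a ^ (2 - 3 / 2 : ℝ))⁻¹)
    measurable_expKernelDeriv.aestronglyMeasurable ?_
  filter_upwards [ae_restrict_mem measurableSet_Ioi] with t (ht : a < t)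
  rw [inv_mul_eq_div, le_div_iff₀ (Real.rpow_pos_of_pos ha _)]
  gcongr

lemma expKernel_eq_neg_integral {a : ℝ} (ha : 0 < a) :
    expKernel a = -∫ t in Set.Ioi a, expKernelDeriv t := by
  have := integral_Ioi_of_hasDerivAt_of_tendsto' (a := a) (f := expKernel)
    (fun t ht => hasDerivAt_expKernel (lt_of_lt_of_le ha ht))
    (integrableOn_expKernelDeriv ha) tendsto_expKernel
  rw [this]; ring

end kernel

/-! ### Moments and the truncated fourth moment -/

lemma IsProbDensity.integrable {f : ℝ → ℝ} (hf : IsProbDensity f) : Integrable f := by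
  by_contra h
  have := hf.integral_eq_one
  rw [integral_undef h] at this
  exact zero_ne_one this

lemma integrable_sq_mul {f : ℝ → ℝ} (hmoment : ∫ x : ℝ, x ^ 2 * f x = 1) :
    Integrable fun x => x ^ 2 * f x := by
  by_contra h
  rw [integral_undef h] at hmoment
  exact zero_ne_one hmoment

/-- In this form the cut-off is a condition on `x²`, as needed for Fubini. The endpoints are null,
and for `t ≤ 0` both sides vanish because `√t = 0`. -/
lemma truncatedFourthMoment_eq (f : ℝ → ℝ) (t : ℝ) :
    truncatedFourthMoment f t = ∫ x in {x : ℝ | x ^ 2 < t}, x ^ 4 * f x := by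
  rw [truncatedFourthMoment, intervalIntegral.integral_of_le (by linarith [Real.sqrt_nonneg t]),
    integral_Ioc_eq_integral_Ioo]
  congr 2
  ext x
  simp only [Set.mem_Ioo, Set.mem_ofPred_eq]
  rw [← Real.sqrt_lt_sqrt_iff (sq_nonneg x), Real.sqrt_sq_eq_abs, abs_lt]

lemma integrableOn_fourth_moment {f : ℝ → ℝ} (hf : IsProbDensity f)
    (hmoment : ∫ x : ℝ, x ^ 2 * f x = 1) (t : ℝ) :
    IntegrableOn (fun x => x ^ 4 * f x) {x : ℝ | x ^ 2 < t} := by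
  have hs : MeasurableSet {x : ℝ | x ^ 2 < t} := measurableSet_lt (by fun_prop) measurable_const
  have hm := hf.measurable
  refine Integrable.mono' (((integrable_sq_mul hmoment).const_mul t).integrableOn)
    (Measurable.aestronglyMeasurable (by fun_prop)) ?_
  filter_upwards [ae_restrict_mem hs] with x (hx : x ^ 2 < t)
  rw [Real.norm_of_nonneg (mul_nonneg (by positivity) (hf.nonneg x))]
  nlinarith [mul_nonneg (sq_nonneg x) (hf.nonneg x)]

lemma truncatedFourthMoment_le {f : ℝ → ℝ} (hf : IsProbDensity f)
    (hmoment : ∫ x : ℝ, x ^ 2 * f x = 1) {t : ℝ} (ht : 0 ≤ t) :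
    truncatedFourthMoment f t ≤ t := by
  have hs : MeasurableSet {x : ℝ | x ^ 2 < t} := measurableSet_lt (by fun_prop) measurable_const
  have hi := (integrable_sq_mul hmoment).const_mul t
  rw [truncatedFourthMoment_eq]
  calc _ ≤ ∫ x in {x : ℝ | x ^ 2 < t}, t * (x ^ 2 * f x) := by
        refine setIntegral_mono_on (integrableOn_fourth_moment hf hmoment t) hi.integrableOn hs ?_
        intro x (hx : x ^ 2 < t)
        nlinarith [mul_nonneg (sq_nonneg x) (hf.nonneg x)]
    _ ≤ ∫ x, t * (x ^ 2 * f x) := by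
        refine setIntegral_le_integral hi (Eventually.of_forall fun x => ?_)
        have := hf.nonneg x
        positivity
    _ = t := by rw [integral_const_mul, hmoment, mul_one]

lemma truncatedFourthMoment_nonneg {f : ℝ → ℝ} (hf : IsProbDensity f) (t : ℝ) :
    0 ≤ truncatedFourthMoment f t := by
  rw [truncatedFourthMoment_eq]
  exact integral_nonneg fun x => mul_nonneg (by positivity) (hf.nonneg x)

/-- Dominated convergence needs the asymptotic bound for all `t > 0`. Beyond `T` the equivalence
gives `2C`; below `T`, the second moment gives `ν_f(t) ≤ t = t^{α-1} t^{2-α} ≤ T^{α-1} t^{2-α}`. -/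
lemma exists_truncatedFourthMoment_le_rpow {f : ℝ → ℝ} (hf : IsProbDensity f)
    (hmoment : ∫ x : ℝ, x ^ 2 * f x = 1) {C α : ℝ} (hC : 0 < C) (hα₁ : 1 < α)
    (hν : Asymptotics.IsEquivalent atTop (truncatedFourthMoment f) (fun x : ℝ => C * x ^ (2 - α))) :
    ∃ D, 0 < D ∧ ∀ t, 0 < t → truncatedFourthMoment f t ≤ D * t ^ (2 - α) := by
  obtain ⟨φ, hφ, hφ'⟩ := hν.exists_eq_mul
  obtain ⟨t₀, ht₀⟩ := eventually_atTop.1 ((hφ.eventually (gt_mem_nhds one_lt_two)).and hφ')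
  set T := max t₀ 1
  have hT : 0 < T := lt_of_lt_of_le one_pos (le_max_right _ _)
  refine ⟨2 * C + T ^ (α - 1), by positivity, fun t ht => ?_⟩
  have hp : 0 < t ^ (2 - α) := Real.rpow_pos_of_pos ht _
  have hT' : 0 < T ^ (α - 1) := Real.rpow_pos_of_pos hT _
  rcases le_or_gt T t with h | h
  · obtain ⟨h1, h2⟩ := ht₀ t ((le_max_left _ _).trans h)
    rw [h2, Pi.mul_apply]
    have : φ t * (C * t ^ (2 - α)) ≤ 2 * (C * t ^ (2 - α)) := by gcongr
    nlinarith
  · have h1 : t ≤ T ^ (α - 1) * t ^ (2 - α) := by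
      calc t = t ^ (α - 1) * t ^ (2 - α) := by
            rw [← Real.rpow_add ht]; ring_nf; simp
        _ ≤ _ := by gcongr
    have := truncatedFourthMoment_le hf hmoment ht.le
    nlinarith [mul_pos hC hp]

/-! ### Expansion of the characteristic function at the origin -/

section expansion
open Complex

/-- With `K = expKernel`, the integrand is `ξ² x⁴ f(x) K(ξx²)` for `x ≠ 0`, and `K(a) = -∫_a^∞ K'`.
After Fubini the constraint `ξx² < s` truncates the `x`-integral, which becomes `ν_f(s/ξ)`. -/
lemma integral_exp_sub_eq {f : ℝ → ℝ} (hf : IsProbDensity f)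
    (hmoment : ∫ x : ℝ, x ^ 2 * f x = 1) {D α : ℝ} (hα₁ : 1 < α) (hα₂ : α < 2)
    (hD : ∀ t, 0 < t → truncatedFourthMoment f t ≤ D * t ^ (2 - α)) {ξ : ℝ} (hξ : 0 < ξ) :
    ∫ x : ℝ, (cexp (ξ * x ^ 2 * I) - 1 - ξ * x ^ 2 * I) * f x =
      -ξ ^ 2 * ∫ s in Set.Ioi (0 : ℝ), expKernelDeriv s * truncatedFourthMoment f (s / ξ) := by
  have hfm := hf.measurable
  have hkm := measurable_expKernelDeriv
  set A : Set (ℝ × ℝ) := {p | ξ * p.1 ^ 2 < p.2} with hA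
  have hAm : MeasurableSet A := measurableSet_lt (by fun_prop) (by fun_prop)
  set G : ℝ × ℝ → ℂ := A.indicator
    (fun p => expKernelDeriv p.2 * ((p.1 ^ 4 * f p.1 : ℝ) : ℂ)) with hG
  have hGm : Measurable G := Measurable.indicator (by fun_prop) hAm
  have hset : ∀ s : ℝ, {x : ℝ | ξ * x ^ 2 < s} = {x : ℝ | x ^ 2 < s / ξ} := fun s => by
    ext x; simp only [Set.mem_ofPred_eq]; rw [lt_div_iff₀ hξ, mul_comm]
  have hsm : ∀ s : ℝ, MeasurableSet {x : ℝ | x ^ 2 < s} := fun s =>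
    measurableSet_lt (by fun_prop) measurable_const
  have hG1 : ∀ s : ℝ, (fun x => G (x, s)) = {x : ℝ | x ^ 2 < s / ξ}.indicator
      (fun x => expKernelDeriv s * ((x ^ 4 * f x : ℝ) : ℂ)) := fun s => by
    ext x
    rw [← hset]
    rfl
  have hGi : Integrable G (volume.prod (volume.restrict (Set.Ioi 0))) := by
    rw [integrable_prod_iff' hGm.aestronglyMeasurable]
    constructor
    · refine Eventually.of_forall fun s => ?_
      rw [hG1, integrable_indicator_iff (hsm _)]
      exact ((integrableOn_fourth_moment hf hmoment _).ofReal).const_mul _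
    · have : ∀ s : ℝ, ∫ x, ‖G (x, s)‖ = ‖expKernelDeriv s‖ * truncatedFourthMoment f (s / ξ) := by
        intro s
        have h1 : (fun x => ‖G (x, s)‖) = {x : ℝ | x ^ 2 < s / ξ}.indicator
            (fun x => ‖expKernelDeriv s‖ * (x ^ 4 * f x)) := by
          ext x
          rw [show G (x, s) = _ from congrFun (hG1 s) x, norm_indicator_eq_indicator_norm]
          congr 1
          ext y
          rw [norm_mul, norm_real, Real.norm_of_nonneg (mul_nonneg (by positivity) (hf.nonneg y))]
        rw [h1, integral_indicator (hsm _), integral_const_mul, truncatedFourthMoment_eq]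
      simp_rw [this]
      have hb := ((integrableOn_norm_expKernelDeriv_mul_rpow hα₁ hα₂).const_mul
        (D * ξ ^ (-(2 - α))))
      refine Integrable.mono' hb ?_ ?_
      · have := hGm.norm.stronglyMeasurable.integral_prod_left' (μ := volume)
        simp_rw [‹∀ s : ℝ, ∫ x, ‖G (x, s)‖ = _›] at this
        exact this.aestronglyMeasurable
      · filter_upwards [ae_restrict_mem measurableSet_Ioi] with s (hs : 0 < s)
        rw [Real.norm_of_nonneg (mul_nonneg (norm_nonneg _) (truncatedFourthMoment_nonneg hf _))]
        calc _ ≤ ‖expKernelDeriv s‖ * (D * (s / ξ) ^ (2 - α)) := by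
              gcongr; exact hD _ (by positivity)
          _ = _ := by
              rw [Real.div_rpow hs.le hξ.le, Real.rpow_neg hξ.le]; field_simp
  have hswap := integral_integral_swap (f := fun x s => G (x, s)) hGi
  have hl : ∀ᵐ x : ℝ, (cexp (ξ * x ^ 2 * I) - 1 - ξ * x ^ 2 * I) * f x =
      -ξ ^ 2 * ∫ s in Set.Ioi (0 : ℝ), G (x, s) := by
    have h0 : ∀ᵐ x : ℝ, x ≠ 0 := by simp [ae_iff]
    filter_upwards [h0] with x hx
    have hx2 : 0 < ξ * x ^ 2 := by positivity
    have h1 : (fun s => G (x, s)) = (Set.Ioi (ξ * x ^ 2)).indicator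
        (fun s => expKernelDeriv s * ((x ^ 4 * f x : ℝ) : ℂ)) := rfl
    have hk := expKernel_eq_neg_integral hx2
    rw [h1, setIntegral_indicator measurableSet_Ioi, integral_mul_const,
      Set.inter_eq_right.2 (Set.Ioi_subset_Ioi hx2.le), ← neg_eq_iff_eq_neg.2 hk, expKernel]
    have hx' : (x : ℂ) ≠ 0 := by exact_mod_cast hx
    have hξ' : (ξ : ℂ) ≠ 0 := by exact_mod_cast hξ.ne'
    push_cast
    field_simp
  rw [integral_congr_ae hl, integral_const_mul, hswap]
  congr 1
  refine setIntegral_congr_fun measurableSet_Ioi fun s _ => ?_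
  rw [hG1, integral_indicator (hsm _), integral_const_mul, truncatedFourthMoment_eq,
    integral_complex_ofReal]

lemma norm_exp_sq_mul (f : ℝ → ℝ) (ξ x : ℝ) : ‖cexp (ξ * x ^ 2 * I) * f x‖ = |f x| := by
  have := norm_exp_ofReal_mul_I (ξ * x ^ 2)
  push_cast at this
  rw [norm_mul, this, norm_real, one_mul, Real.norm_eq_abs]

lemma integrable_exp_sq_mul {f : ℝ → ℝ} (hf : IsProbDensity f) (ξ : ℝ) :
    Integrable fun x : ℝ => cexp (ξ * x ^ 2 * I) * f x := by
  refine hf.integrable.mono ?_ (Eventually.of_forall fun x => (norm_exp_sq_mul f ξ x).le)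
  have := hf.measurable
  exact Measurable.aestronglyMeasurable (by fun_prop)

lemma integrable_exp_remainder {f : ℝ → ℝ} (hf : IsProbDensity f)
    (hmoment : ∫ x : ℝ, x ^ 2 * f x = 1) (ξ : ℝ) :
    Integrable fun x : ℝ => (cexp (ξ * x ^ 2 * I) - 1 - ξ * x ^ 2 * I) * f x := by
  have h := ((integrable_exp_sq_mul hf ξ).sub hf.integrable.ofReal).sub
    ((integrable_sq_mul hmoment).ofReal.const_mul ((ξ : ℂ) * I))
  refine h.congr (Eventually.of_forall fun x => ?_)
  simp only [Pi.sub_apply, coe_algebraMap]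
  push_cast
  ring

lemma sqCharFun_eq {f : ℝ → ℝ} (hf : IsProbDensity f)
    (hmoment : ∫ x : ℝ, x ^ 2 * f x = 1) (ξ : ℝ) :
    sqCharFun f ξ = 1 + ξ * I +
      ∫ x : ℝ, (cexp (ξ * x ^ 2 * I) - 1 - ξ * x ^ 2 * I) * f x := by
  have h1 : ∫ x : ℝ, (f x : ℂ) = 1 := by
    rw [integral_complex_ofReal, hf.integral_eq_one, ofReal_one]
  have h2 : ∫ x : ℝ, (ξ * I : ℂ) * ((x ^ 2 * f x : ℝ) : ℂ) = ξ * I := by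
    rw [integral_const_mul, integral_complex_ofReal, hmoment, ofReal_one, mul_one]
  have h3 := integral_add (integrable_exp_remainder hf hmoment ξ)
    (hf.integrable.ofReal (𝕜 := ℂ) |>.add ((integrable_sq_mul hmoment).ofReal.const_mul ((ξ : ℂ) * I)))
  rw [integral_add' hf.integrable.ofReal ((integrable_sq_mul hmoment).ofReal.const_mul _)] at h3
  simp only [coe_algebraMap] at h3
  rw [h1, h2] at h3
  rw [add_comm _ (∫ x : ℝ, _), ← h3]
  refine integral_congr_ae (Eventually.of_forall fun x => ?_)
  simp only [Pi.add_apply]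
  push_cast
  ring

/-- By `integral_exp_sub_eq` the quotient is `-∫ K'(s) ξ^{2-α} ν_f(s/ξ) ds`. The inner factor tends
to `C s^{2-α}` and is at most `D s^{2-α}`. -/
lemma tendsto_remainder {f : ℝ → ℝ} (hf : IsProbDensity f)
    (hmoment : ∫ x : ℝ, x ^ 2 * f x = 1) {C α : ℝ} (hC : 0 < C) (hα₁ : 1 < α) (hα₂ : α < 2)
    (hν : Asymptotics.IsEquivalent atTop (truncatedFourthMoment f) (fun x : ℝ => C * x ^ (2 - α))) :
    Tendsto (fun ξ : ℝ => (∫ x : ℝ, (cexp (ξ * x ^ 2 * I) - 1 - ξ * x ^ 2 * I) * f x) / ((ξ ^ α : ℝ) : ℂ))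
      (𝓝[>] 0) (𝓝 (-∫ s in Set.Ioi (0 : ℝ), expKernelDeriv s * ((C * s ^ (2 - α) : ℝ) : ℂ))) := by
  obtain ⟨D, hD0, hD⟩ := exists_truncatedFourthMoment_le_rpow hf hmoment hC hα₁ hν
  have hνm : Measurable (truncatedFourthMoment f) := by
    have hfm := hf.measurable
    have hm : Measurable ({p : ℝ × ℝ | p.1 ^ 2 < p.2}.indicator (fun p => p.1 ^ 4 * f p.1)) :=
      Measurable.indicator (by fun_prop) (measurableSet_lt (by fun_prop) (by fun_prop))
    have := (hm.stronglyMeasurable.integral_prod_left' (μ := volume)).measurable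
    convert this using 1
    ext t
    rw [truncatedFourthMoment_eq,
      ← integral_indicator (measurableSet_lt (by fun_prop) measurable_const)]
    rfl
  have hkey : Tendsto (fun ξ : ℝ => ∫ s in Set.Ioi (0 : ℝ), expKernelDeriv s *
      ((ξ ^ (2 - α) * truncatedFourthMoment f (s / ξ) : ℝ) : ℂ)) (𝓝[>] 0)
      (𝓝 (∫ s in Set.Ioi (0 : ℝ), expKernelDeriv s * ((C * s ^ (2 - α) : ℝ) : ℂ))) := by
    refine tendsto_integral_filter_of_dominated_convergence
      (fun s => D * (‖expKernelDeriv s‖ * s ^ (2 - α))) ?_ ?_ ?_ ?_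
    · refine Eventually.of_forall fun ξ => ?_
      have := measurable_expKernelDeriv
      exact Measurable.aestronglyMeasurable (by fun_prop)
    · filter_upwards [self_mem_nhdsWithin] with ξ (hξ : 0 < ξ)
      filter_upwards [ae_restrict_mem measurableSet_Ioi] with s (hs : 0 < s)
      have hp := Real.rpow_pos_of_pos hξ (2 - α)
      rw [norm_mul, norm_real, Real.norm_of_nonneg
        (mul_nonneg hp.le (truncatedFourthMoment_nonneg hf _))]
      calc _ ≤ ‖expKernelDeriv s‖ * (ξ ^ (2 - α) * (D * (s / ξ) ^ (2 - α))) := by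
            gcongr; exact hD _ (by positivity)
        _ = _ := by
            rw [Real.div_rpow hs.le hξ.le]; field_simp
    · exact (integrableOn_norm_expKernelDeriv_mul_rpow hα₁ hα₂).const_mul _
    · filter_upwards [ae_restrict_mem measurableSet_Ioi] with s (hs : 0 < s)
      refine Tendsto.const_mul _ ((continuous_ofReal.tendsto _).comp ?_)
      obtain ⟨φ, hφ, hφ'⟩ := hν.exists_eq_mul
      have hdiv : Tendsto (fun ξ : ℝ => s / ξ) (𝓝[>] 0) atTop := by
        simpa [div_eq_mul_inv] using tendsto_inv_nhdsGT_zero.const_mul_atTop hs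
      have h1 : Tendsto (fun ξ : ℝ => φ (s / ξ) * (C * s ^ (2 - α))) (𝓝[>] 0)
          (𝓝 (C * s ^ (2 - α))) := by
        simpa using (hφ.comp hdiv).mul_const (C * s ^ (2 - α))
      refine h1.congr' ?_
      filter_upwards [self_mem_nhdsWithin, hdiv.eventually hφ'] with ξ (hξ : 0 < ξ) h
      have hp := Real.rpow_pos_of_pos hξ (2 - α)
      rw [h, Pi.mul_apply, Real.div_rpow hs.le hξ.le]
      field_simp
  refine hkey.neg.congr' ?_
  filter_upwards [self_mem_nhdsWithin] with ξ (hξ : 0 < ξ)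
  rw [integral_exp_sub_eq hf hmoment hα₁ hα₂ hD hξ]
  have hp := Real.rpow_pos_of_pos hξ α
  have h2 : ξ ^ (2 - α) = ξ ^ 2 / ξ ^ α := by
    rw [Real.rpow_sub hξ]; norm_num
  have h3 : ∀ s, expKernelDeriv s * ((ξ ^ (2 - α) * truncatedFourthMoment f (s / ξ) : ℝ) : ℂ) =
      ((ξ ^ 2 / ξ ^ α : ℝ) : ℂ) * (expKernelDeriv s * truncatedFourthMoment f (s / ξ)) := by
    intro s; rw [h2]; push_cast; ring
  simp_rw [h3]
  rw [integral_const_mul]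
  push_cast
  ring

/-- The expansion `E e^{iξ(V² - 1)} = 1 - c ξ^α + o(ξ^α)` as `ξ → 0+`, with `Re c > 0`. -/
theorem exists_tendsto_sqCharFun {f : ℝ → ℝ} (hf : IsProbDensity f)
    (hmoment : ∫ x : ℝ, x ^ 2 * f x = 1) {C α : ℝ} (hC : 0 < C) (hα₁ : 1 < α) (hα₂ : α < 2)
    (hν : Asymptotics.IsEquivalent atTop (truncatedFourthMoment f) (fun x : ℝ => C * x ^ (2 - α))) :
    ∃ c : ℂ, 0 < c.re ∧ Tendsto (fun ξ : ℝ => (sqCharFun f ξ * cexp (-(ξ * I)) - 1) / ((ξ ^ α : ℝ) : ℂ))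
      (𝓝[>] 0) (𝓝 (-c)) := by
  set c : ℂ := ∫ s in Set.Ioi (0 : ℝ), expKernelDeriv s * ((C * s ^ (2 - α) : ℝ) : ℂ) with hc
  have hR := tendsto_remainder hf hmoment hC hα₁ hα₂ hν
  refine ⟨c, ?_, ?_⟩
  -- Positivity of `Re c` is read off the limit instead of the integral: `1 - cos y ≥ (2/π²) y²` for
  -- `|y| ≤ π`, restricted to `x² < 1/ξ`, bounds minus the real part of the remainder below by
  -- `(2/π²) ξ² ν_f(1/ξ)`. Hence `Re c ≥ 2C/π²`.
  · have h1 : Tendsto (fun ξ : ℝ => (-((∫ x : ℝ, (cexp (ξ * x ^ 2 * I) - 1 - ξ * x ^ 2 * I) * f x) /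
        ((ξ ^ α : ℝ) : ℂ))).re) (𝓝[>] 0) (𝓝 c.re) := by
      have := (continuous_re.tendsto _).comp hR.neg
      rw [neg_neg] at this
      exact this
    have h2 : Tendsto (fun ξ : ℝ => 2 / Real.pi ^ 2 * (truncatedFourthMoment f ξ⁻¹ * ξ ^ (2 - α)))
        (𝓝[>] 0) (𝓝 (2 / Real.pi ^ 2 * C)) := by
      refine Tendsto.const_mul _ ?_
      obtain ⟨φ, hφ, hφ'⟩ := hν.exists_eq_mul
      have h3 : Tendsto (fun ξ : ℝ => φ ξ⁻¹ * C) (𝓝[>] 0) (𝓝 C) := by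
        simpa using (hφ.comp tendsto_inv_nhdsGT_zero).mul_const C
      refine h3.congr' ?_
      filter_upwards [self_mem_nhdsWithin, tendsto_inv_nhdsGT_zero.eventually hφ'] with ξ (hξ : 0 < ξ) h
      have hp := Real.rpow_pos_of_pos hξ (2 - α)
      rw [h, Pi.mul_apply, Real.inv_rpow hξ.le]
      field_simp
    refine lt_of_lt_of_le (by positivity) (le_of_tendsto_of_tendsto h2 h1 ?_)
    filter_upwards [self_mem_nhdsWithin] with ξ (hξ : 0 < ξ)
    have hp := Real.rpow_pos_of_pos hξ α
    have hre : (∫ x : ℝ, (cexp (ξ * x ^ 2 * I) - 1 - ξ * x ^ 2 * I) * f x).re =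
        ∫ x : ℝ, (Real.cos (ξ * x ^ 2) - 1) * f x := by
      have := reCLM.integral_comp_comm (integrable_exp_remainder hf hmoment ξ)
      simp only [reCLM_apply] at this
      rw [← this]
      refine integral_congr_ae (Eventually.of_forall fun x => ?_)
      have he : cexp (ξ * x ^ 2 * I) = cexp ((ξ * x ^ 2 : ℝ) * I) := by push_cast; rfl
      have he' : (cexp (ξ * x ^ 2 * I) - 1 - ξ * x ^ 2 * I) * f x =
          (((Real.cos (ξ * x ^ 2) - 1) * f x : ℝ) : ℂ) +
            (((Real.sin (ξ * x ^ 2) - ξ * x ^ 2) * f x : ℝ) : ℂ) * I := by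
        rw [he, exp_mul_I, ← ofReal_cos, ← ofReal_sin]
        push_cast
        ring
      simp only [he', add_re, ofReal_re, re_ofReal_mul, I_re, mul_zero, add_zero]
    have hint : Integrable fun x : ℝ => (Real.cos (ξ * x ^ 2) - 1) * f x := by
      refine (hf.integrable.const_mul 2).mono' ?_ (Eventually.of_forall fun x => ?_)
      · have := hf.measurable
        exact Measurable.aestronglyMeasurable (by fun_prop)
      · rw [norm_mul, Real.norm_of_nonneg (hf.nonneg x)]
        refine mul_le_mul_of_nonneg_right ?_ (hf.nonneg x)
        rw [Real.norm_eq_abs, abs_le]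
        constructor <;> linarith [Real.neg_one_le_cos (ξ * x ^ 2), Real.cos_le_one (ξ * x ^ 2)]
    have hlow : 2 / Real.pi ^ 2 * ξ ^ 2 * truncatedFourthMoment f ξ⁻¹ ≤
        ∫ x : ℝ, (1 - Real.cos (ξ * x ^ 2)) * f x := by
      rw [truncatedFourthMoment_eq, ← integral_const_mul]
      have hs : MeasurableSet {x : ℝ | x ^ 2 < ξ⁻¹} := measurableSet_lt (by fun_prop) measurable_const
      have hint' : Integrable fun x : ℝ => (1 - Real.cos (ξ * x ^ 2)) * f x := by
        refine hint.neg.congr (Eventually.of_forall fun x => ?_)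
        simp only [Pi.neg_apply]; ring
      refine (setIntegral_mono_on ((integrableOn_fourth_moment hf hmoment _).const_mul _)
        hint'.integrableOn hs fun x hx => ?_).trans
        (setIntegral_le_integral hint' (Eventually.of_forall fun x =>
          mul_nonneg (by linarith [Real.cos_le_one (ξ * x ^ 2)]) (hf.nonneg x)))
      have hx' : ξ * x ^ 2 < 1 := by
        have : x ^ 2 < ξ⁻¹ := hx
        calc ξ * x ^ 2 < ξ * ξ⁻¹ := by gcongr
          _ = 1 := mul_inv_cancel₀ hξ.ne'
      have hq := Real.cos_le_one_sub_mul_cos_sq (x := ξ * x ^ 2) (by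
        rw [abs_of_nonneg (by positivity)]; linarith [Real.pi_gt_three])
      calc _ = (2 / Real.pi ^ 2 * (ξ * x ^ 2) ^ 2) * f x := by ring
        _ ≤ _ := by
          refine mul_le_mul_of_nonneg_right ?_ (hf.nonneg x)
          linarith
    rw [neg_re, div_ofReal_re, hre, Real.rpow_sub hξ, ← neg_div, le_div_iff₀ hp, ← integral_neg]
    have : ∫ x : ℝ, -((Real.cos (ξ * x ^ 2) - 1) * f x) = ∫ x : ℝ, (1 - Real.cos (ξ * x ^ 2)) * f x := by
      congr 1; ext x; ring
    rw [this]
    refine le_trans (le_of_eq ?_) hlow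
    norm_num
    field_simp
  · have he : Tendsto (fun ξ : ℝ => cexp (-(ξ * I))) (𝓝[>] 0) (𝓝 1) := by
      have : Continuous fun ξ : ℝ => cexp (-(ξ * I)) := by fun_prop
      simpa using (this.tendsto 0).mono_left nhdsWithin_le_nhds
    -- Since the mean of `V²` is `1`, centring kills the linear term: `e^{-iξ}(1 + iξ) = 1 + O(ξ²)`,
    -- and `ξ² = o(ξ^α)` because `α < 2`.
    have h1 : Tendsto (fun ξ : ℝ => (cexp (-(ξ * I)) * (1 + ξ * I) - 1) / ((ξ ^ α : ℝ) : ℂ))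
        (𝓝[>] 0) (𝓝 0) := by
      have h0 : Tendsto (fun ξ : ℝ => 3 * ξ ^ (2 - α)) (𝓝[>] 0) (𝓝 0) := by
        have := (Real.continuousAt_rpow_const 0 (2 - α) (Or.inr (by linarith))).tendsto.const_mul 3
        rw [Real.zero_rpow (by linarith), mul_zero] at this
        exact this.mono_left nhdsWithin_le_nhds
      refine squeeze_zero_norm' ?_ h0
      filter_upwards [self_mem_nhdsWithin, Ioo_mem_nhdsGT one_pos] with ξ (hξ : 0 < ξ) hξ1
      have hp := Real.rpow_pos_of_pos hξ α
      have hn : ‖-((ξ : ℂ) * I)‖ = ξ := by simp [abs_of_pos hξ]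
      have hb1 := norm_exp_sub_one_sub_id_le (x := -((ξ : ℂ) * I)) (by rw [hn]; exact hξ1.2.le)
      have hb2 := norm_exp_sub_one_le (x := -((ξ : ℂ) * I)) (by rw [hn]; exact hξ1.2.le)
      rw [hn] at hb1 hb2
      have hb : ‖cexp (-(ξ * I)) * (1 + ξ * I) - 1‖ ≤ 3 * ξ ^ 2 := by
        calc _ = ‖(cexp (-(ξ * I)) - 1 - -(ξ * I)) + (cexp (-(ξ * I)) - 1) * (ξ * I)‖ := by
              congr 1; ring
          _ ≤ ξ ^ 2 + 2 * ξ * ξ := by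
              refine (norm_add_le _ _).trans (add_le_add hb1 ?_)
              rw [norm_mul, ← norm_neg ((ξ : ℂ) * I), hn]
              gcongr
          _ = _ := by ring
      rw [norm_div, norm_real, Real.norm_of_nonneg hp.le, Real.rpow_sub hξ, ← mul_div_assoc]
      norm_num
      gcongr
    have h2 := h1.add (he.mul hR)
    rw [zero_add, one_mul, ← hc] at h2
    refine h2.congr fun ξ => ?_
    rw [sqCharFun_eq hf hmoment]
    ring

end expansion

/-! ### Integrability of high powers of the characteristic function -/

/-- Interpolation with `f ∈ L¹` replaces `p`, possibly infinite, by a finite exponent. The cap `q ≤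
2` ensures `(q - 1)/4 ≤ 1/2` in the next estimate. -/
lemma exists_rpow_integrable {f : ℝ → ℝ} (hf : IsProbDensity f) {p : ℝ≥0∞} (hp : 1 < p)
    (hfp : MemLp f p volume) : ∃ q : ℝ, 1 < q ∧ q ≤ 2 ∧ Integrable (fun x => f x ^ q) := by
  have hfm := hf.measurable
  by_cases hp' : p = ∞
  · subst hp'
    refine ⟨2, one_lt_two, le_rfl, ?_⟩
    have hlt : eLpNormEssSup f volume < ∞ := by
      rw [← eLpNorm_exponent_top]; exact hfp.2
    set M : ℝ := (eLpNormEssSup f volume).toReal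
    have hM' : ∀ᵐ x, f x ≤ M := by
      filter_upwards [enorm_ae_le_eLpNormEssSup f volume] with x hx
      have := (ENNReal.toReal_le_toReal (by simp) hlt.ne).2 hx
      rw [toReal_enorm] at this
      exact (le_abs_self _).trans this
    refine (hf.integrable.const_mul M).mono' (Measurable.aestronglyMeasurable (by fun_prop)) ?_
    filter_upwards [hM'] with x hx
    have := hf.nonneg x
    rw [Real.norm_of_nonneg (Real.rpow_nonneg this _)]
    norm_num
    nlinarith
  · have hp1 : 1 < p.toReal := by
      rw [← ENNReal.toReal_one]
      exact (ENNReal.toReal_lt_toReal ENNReal.one_ne_top hp').2 hp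
    have hi : Integrable (fun x => f x ^ p.toReal) := by
      have := hfp.integrable_norm_rpow (by positivity) hp'
      refine this.congr (Eventually.of_forall fun x => ?_)
      simp only [Real.norm_of_nonneg (hf.nonneg x)]
    refine ⟨min p.toReal 2, lt_min hp1 one_lt_two, min_le_right _ _, ?_⟩
    refine (hf.integrable.add hi).mono' (Measurable.aestronglyMeasurable (by fun_prop))
      (Eventually.of_forall fun x => ?_)
    have h0 := hf.nonneg x
    rw [Real.norm_of_nonneg (Real.rpow_nonneg h0 _), Pi.add_apply]
    rcases le_or_gt (f x) 1 with h | h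
    · rcases h0.eq_or_lt with h0 | h0
      · rw [← h0, Real.zero_rpow (by positivity), Real.zero_rpow (by positivity)]; simp
      · have : f x ^ min p.toReal 2 ≤ f x ^ (1 : ℝ) :=
          Real.rpow_le_rpow_of_exponent_ge h0 h (lt_min hp1 one_lt_two).le
        rw [Real.rpow_one] at this
        linarith [Real.rpow_nonneg h0.le p.toReal]
    · have : f x ^ min p.toReal 2 ≤ f x ^ p.toReal :=
        Real.rpow_le_rpow_of_exponent_le h.le (min_le_left _ _)
      linarith

/-- The part of `f` where `V²` has a large density carries little mass. -/
lemma exists_integral_large_le {f : ℝ → ℝ} (hf : IsProbDensity f) {q : ℝ} (hq : 1 < q) (hq2 : q ≤ 2)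
    (hfq : Integrable (fun x => f x ^ q)) :
    ∃ B δ : ℝ, 1 ≤ B ∧ 0 < δ ∧ ∀ l : ℝ, 1 ≤ l →
      ∫ x in {x : ℝ | l * |x| < f x}, f x ≤ B * l ^ (-δ) := by
  have hfm := hf.measurable
  set A := ∫ x, f x ^ q with hA
  have hA0 : 0 ≤ A := integral_nonneg fun x => Real.rpow_nonneg (hf.nonneg x) _
  refine ⟨A + 2, (q - 1) / 4, by linarith, by linarith, fun l hl => ?_⟩
  have hl0 : 0 < l := by linarith
  -- Where `l|x| < f(x)`, either `f > M` and `f ≤ f^q M^{1-q}`, or `f ≤ M` and `|x| < M/l`. The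
  -- total mass is at most `A M^{1-q} + 2M²/l`, and `M = l^{1/4}` makes both terms decay.
  set M := l ^ (1 / 4 : ℝ) with hM
  have hM0 : 0 < M := Real.rpow_pos_of_pos hl0 _
  have hs : MeasurableSet {x : ℝ | l * |x| < f x} := measurableSet_lt (by fun_prop) hfm
  have hI : Integrable ((Set.Ioo (-(M / l)) (M / l)).indicator (fun _ : ℝ => M)) :=
    (integrable_indicator_iff measurableSet_Ioo).2 (by simp)
  rw [← integral_indicator hs]
  calc _ ≤ ∫ x, (f x ^ q * M ^ (1 - q) + (Set.Ioo (-(M / l)) (M / l)).indicator (fun _ => M) x) := by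
        refine integral_mono (hf.integrable.indicator hs) ((hfq.mul_const _).add hI) fun x => ?_
        have h0 := hf.nonneg x
        have hq0 := mul_nonneg (Real.rpow_nonneg h0 q) (Real.rpow_nonneg hM0.le (1 - q))
        have hi0 : 0 ≤ (Set.Ioo (-(M / l)) (M / l)).indicator (fun _ => M) x :=
          Set.indicator_nonneg (fun _ _ => hM0.le) _
        by_cases hx : l * |x| < f x
        · rw [Set.indicator_of_mem (by exact hx)]
          rcases le_or_gt (f x) M with h | h
          · have : x ∈ Set.Ioo (-(M / l)) (M / l) := by
              rw [Set.mem_Ioo, ← abs_lt, lt_div_iff₀ hl0]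
              linarith
            rw [Set.indicator_of_mem this]
            linarith
          · have : f x ≤ f x ^ q * M ^ (1 - q) := by
              have h1 : f x ^ (1 - q) ≤ M ^ (1 - q) :=
                Real.rpow_le_rpow_of_nonpos hM0 h.le (by linarith)
              calc f x = f x ^ q * f x ^ (1 - q) := by
                    rw [← Real.rpow_add (hM0.trans h)]; simp
                _ ≤ _ := by gcongr
            linarith
        · rw [Set.indicator_of_notMem (by exact hx)]
          positivity
    _ = A * M ^ (1 - q) + 2 * (M / l) * M := by
        rw [integral_add (hfq.mul_const _) hI, integral_mul_const, integral_indicator measurableSet_Ioo,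
          setIntegral_const]
        simp only [Measure.real, Real.volume_Ioo, smul_eq_mul]
        rw [ENNReal.toReal_ofReal (by have := div_pos hM0 hl0; linarith)]
        ring
    _ ≤ A * l ^ (-((q - 1) / 4)) + 2 * l ^ (-((q - 1) / 4)) := by
        have h1 : M ^ (1 - q) = l ^ (-((q - 1) / 4)) := by
          rw [hM, ← Real.rpow_mul hl0.le]; congr 1; ring
        have h2 : 2 * (M / l) * M = 2 * l ^ (-(1 / 2) : ℝ) := by
          rw [mul_assoc, div_mul_eq_mul_div, hM, ← Real.rpow_add hl0, div_eq_mul_inv,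
            ← Real.rpow_neg_one, ← Real.rpow_add hl0]
          norm_num
        rw [h1, h2]
        gcongr
        · linarith
        · norm_num
    _ = _ := by ring

/-- The substitution `u = y²` on each half-line has Jacobian `2|y| ≥ |y|`; the constant is not
sharp. -/
lemma lintegral_abs_mul_comp_sq_le (K : ℝ → ℝ≥0∞) :
    ∫⁻ y, ENNReal.ofReal |y| * K (y ^ 2) ≤ 2 * ∫⁻ u, K u := by
  have h1 := lintegral_image_eq_lintegral_abs_deriv_mul (s := Set.Ioi (0 : ℝ))
    (f := fun r => r ^ 2) (f' := fun r => 2 * r) measurableSet_Ioi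
    (fun r _ => by simpa using (hasDerivAt_pow 2 r).hasDerivWithinAt)
    (fun a ha b hb hab => (pow_left_inj₀ (le_of_lt ha) (le_of_lt hb) two_ne_zero).1 hab) K
  have h2 := lintegral_image_eq_lintegral_abs_deriv_mul (s := Set.Iic (0 : ℝ))
    (f := fun r => r ^ 2) (f' := fun r => 2 * r) measurableSet_Iic
    (fun r _ => by simpa using (hasDerivAt_pow 2 r).hasDerivWithinAt)
    (fun a ha b hb hab => by
      have ha' : a ≤ 0 := ha
      have hb' : b ≤ 0 := hb
      have := (pow_left_inj₀ (neg_nonneg.2 ha') (neg_nonneg.2 hb') two_ne_zero).1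
        (by simpa using hab)
      linarith) K
  have h3 : ∀ s : Set ℝ, ∫⁻ y in s, ENNReal.ofReal |y| * K (y ^ 2) ≤
      ∫⁻ y in s, ENNReal.ofReal |2 * y| * K (y ^ 2) := fun s => by
    refine lintegral_mono fun y => mul_le_mul_left (ENNReal.ofReal_le_ofReal ?_) _
    rw [abs_mul, abs_two]
    linarith [abs_nonneg y]
  rw [← lintegral_add_compl _ (measurableSet_Ioi (a := (0 : ℝ))), Set.compl_Ioi, two_mul]
  refine add_le_add ((h3 _).trans ?_) ((h3 _).trans ?_)
  · rw [← h1]; exact setLIntegral_le_lintegral _ _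
  · rw [← h2]; exact setLIntegral_le_lintegral _ _

section L2
open Complex

lemma measurable_sq_exp (ξ : ℝ) : Measurable fun x : ℝ => cexp (ξ * x ^ 2 * I) := by fun_prop

lemma continuous_sqCharFun {g : ℝ → ℝ} (hg : Integrable g) : Continuous (sqCharFun g) := by
  unfold sqCharFun
  refine continuous_of_dominated (bound := fun x => ‖g x‖) (fun ξ => ?_) (fun ξ => ?_) hg.norm ?_
  · exact (measurable_sq_exp ξ).aestronglyMeasurable.mul hg.ofReal.aestronglyMeasurable
  · exact Eventually.of_forall fun x => (norm_exp_sq_mul g ξ x).le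
  · exact Eventually.of_forall fun x => by fun_prop

lemma norm_sqCharFun_le (g : ℝ → ℝ) (ξ : ℝ) : ‖sqCharFun g ξ‖ ≤ ∫ x, |g x| := by
  refine (norm_integral_le_integral_norm _).trans (le_of_eq ?_)
  simp_rw [norm_exp_sq_mul]

lemma conj_sqCharFun (g : ℝ → ℝ) (ξ : ℝ) :
    (starRingEnd ℂ) (sqCharFun g ξ) = ∫ y : ℝ, cexp (-(ξ * y ^ 2 * I)) * g y := by
  rw [sqCharFun, ← integral_conj]
  congr 1
  ext y
  rw [map_mul, conj_ofReal, ← exp_conj]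
  simp

/-- A Gaussian-regularised Plancherel identity. -/
lemma integral_gaussian_mul_norm_sq_sqCharFun {g : ℝ → ℝ} (hg : Integrable g) {ε : ℝ} (hε : 0 < ε) :
    ∫ ξ : ℝ, ((Real.exp (-ε * ξ ^ 2) * ‖sqCharFun g ξ‖ ^ 2 : ℝ) : ℂ) =
      ∫ p : ℝ × ℝ, ((g p.1 * g p.2 * ((Real.pi / ε) ^ (1 / 2 : ℝ) *
        Real.exp (-(p.1 ^ 2 - p.2 ^ 2) ^ 2 / (4 * ε))) : ℝ) : ℂ) := by
  have hw : Integrable fun ξ : ℝ => Real.exp (-ε * ξ ^ 2) := integrable_exp_neg_mul_sq hε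
  have h1 : ∀ ξ : ℝ, ((Real.exp (-ε * ξ ^ 2) * ‖sqCharFun g ξ‖ ^ 2 : ℝ) : ℂ) =
      ∫ p : ℝ × ℝ, (Real.exp (-ε * ξ ^ 2) * (g p.1 * g p.2 : ℝ)) *
        cexp (ξ * (p.1 ^ 2 - p.2 ^ 2) * I) := by
    intro ξ
    have h2 : ((‖sqCharFun g ξ‖ ^ 2 : ℝ) : ℂ) = ∫ p : ℝ × ℝ, (cexp (ξ * p.1 ^ 2 * I) * g p.1) *
        (cexp (-(ξ * p.2 ^ 2 * I)) * g p.2) := by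
      rw [Measure.volume_eq_prod, integral_prod_mul (fun x : ℝ => cexp (ξ * x ^ 2 * I) * (g x : ℂ))
        (fun y : ℝ => cexp (-(ξ * y ^ 2 * I)) * (g y : ℂ)), ← conj_sqCharFun, ← sqCharFun, mul_conj,
        normSq_eq_norm_sq]
    rw [ofReal_mul, h2, ← integral_const_mul]
    congr 1
    ext p
    rw [show (ξ : ℂ) * (p.1 ^ 2 - p.2 ^ 2) * I = ξ * p.1 ^ 2 * I + -(ξ * p.2 ^ 2 * I) by ring, exp_add]
    push_cast
    ring
  simp_rw [h1]
  rw [integral_integral_swap]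
  · congr 1
    ext p
    have h3 := fourierIntegral_gaussian (b := (ε : ℂ)) (by simpa using hε) ((p.1 ^ 2 - p.2 ^ 2 : ℝ) : ℂ)
    have h4 : ∫ ξ : ℝ, (Real.exp (-ε * ξ ^ 2) * (g p.1 * g p.2 : ℝ)) *
        cexp (ξ * (p.1 ^ 2 - p.2 ^ 2) * I) = (g p.1 * g p.2 : ℝ) *
        ∫ x : ℝ, cexp (I * ((p.1 ^ 2 - p.2 ^ 2 : ℝ) : ℂ) * x) * cexp (-ε * x ^ 2) := by
      rw [← integral_const_mul]
      congr 1
      ext ξ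
      rw [show I * ((p.1 ^ 2 - p.2 ^ 2 : ℝ) : ℂ) * ξ = ξ * (p.1 ^ 2 - p.2 ^ 2) * I by push_cast; ring]
      push_cast
      ring
    rw [h4, h3]
    have h5 : ((Real.pi : ℂ) / ε) ^ (1 / 2 : ℂ) = (((Real.pi / ε) ^ (1 / 2 : ℝ) : ℝ) : ℂ) := by
      rw [ofReal_cpow (by positivity)]
      push_cast
      rfl
    rw [h5]
    push_cast
    ring_nf
  · have hi : Integrable (fun z : ℝ × (ℝ × ℝ) =>
        ((Real.exp (-ε * z.1 ^ 2) : ℝ) : ℂ) * ((g z.2.1 * g z.2.2 : ℝ) : ℂ)) :=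
      Integrable.mul_prod hw.ofReal (hg.mul_prod hg).ofReal
    refine hi.mul_bdd (c := 1) (Measurable.aestronglyMeasurable (by fun_prop))
      (Eventually.of_forall fun z => ?_)
    have := norm_exp_ofReal_mul_I (z.1 * (z.2.1 ^ 2 - z.2.2 ^ 2))
    push_cast at this
    rw [this]

lemma lintegral_gaussian_kernel {ε : ℝ} (hε : 0 < ε) (a : ℝ) :
    ∫⁻ u, ENNReal.ofReal ((Real.pi / ε) ^ (1 / 2 : ℝ) * Real.exp (-(a - u) ^ 2 / (4 * ε))) =
      ENNReal.ofReal (2 * Real.pi) := by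
  have h0 : ∀ u : ℝ, -(a - u) ^ 2 / (4 * ε) = -(1 / (4 * ε)) * (u - a) ^ 2 := fun u => by ring
  simp_rw [h0]
  rw [lintegral_sub_right_eq_self (fun u => ENNReal.ofReal ((Real.pi / ε) ^ (1 / 2 : ℝ) *
    Real.exp (-(1 / (4 * ε)) * u ^ 2))) a, ← ofReal_integral_eq_lintegral_ofReal]
  · rw [integral_const_mul, integral_gaussian]
    congr 1
    rw [← Real.sqrt_eq_rpow, ← Real.sqrt_mul (by positivity),
      show Real.pi / ε * (Real.pi / (1 / (4 * ε))) = (2 * Real.pi) ^ 2 by field_simp; norm_num,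
      Real.sqrt_sq (by positivity)]
  · exact (integrable_exp_neg_mul_sq (by positivity)).const_mul _
  · exact Eventually.of_forall fun u => by positivity

/-- In the double integral, `g(y) dy ≤ l |y| dy` and `u = y²` reduce the inner integral to the
Gaussian kernel, whose mass `2π` does not depend on `ε`. -/
lemma lintegral_gaussian_mul_norm_sq_sqCharFun_le {g : ℝ → ℝ} (hgm : Measurable g)
    (hg0 : ∀ x, 0 ≤ g x) (hg : Integrable g) (hg1 : ∫ x, g x ≤ 1) {l : ℝ} (hl : 0 ≤ l)
    (hgl : ∀ x, g x ≤ l * |x|) {ε : ℝ} (hε : 0 < ε) :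
    ∫⁻ ξ : ℝ, ENNReal.ofReal (Real.exp (-ε * ξ ^ 2) * ‖sqCharFun g ξ‖ ^ 2) ≤
      ENNReal.ofReal (4 * Real.pi * l) := by
  have hid := integral_gaussian_mul_norm_sq_sqCharFun hg hε
  have hint : Integrable fun ξ : ℝ => Real.exp (-ε * ξ ^ 2) * ‖sqCharFun g ξ‖ ^ 2 := by
    refine (integrable_exp_neg_mul_sq hε).mul_bdd (c := (∫ x, |g x|) ^ 2) ?_ ?_
    · exact ((continuous_sqCharFun hg).norm.pow 2).aestronglyMeasurable
    · refine Eventually.of_forall fun ξ => ?_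
      rw [norm_pow, norm_norm]
      gcongr
      exact norm_sqCharFun_le g ξ
  rw [integral_complex_ofReal, integral_complex_ofReal, ofReal_inj] at hid
  rw [← ofReal_integral_eq_lintegral_ofReal hint (Eventually.of_forall fun ξ => by positivity), hid]
  set k : ℝ → ℝ := fun a => (Real.pi / ε) ^ (1 / 2 : ℝ) * Real.exp (-a ^ 2 / (4 * ε)) with hk
  have hk0 : ∀ a, 0 ≤ k a := fun a => by positivity
  calc ENNReal.ofReal (∫ p : ℝ × ℝ, g p.1 * g p.2 * k (p.1 ^ 2 - p.2 ^ 2))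
      ≤ ∫⁻ p : ℝ × ℝ, ENNReal.ofReal (g p.1 * g p.2 * k (p.1 ^ 2 - p.2 ^ 2)) := by
        refine (ENNReal.ofReal_le_ofReal (le_abs_self _)).trans ?_
        rw [← Real.norm_eq_abs, ofReal_norm]
        refine (enorm_integral_le_lintegral_enorm _).trans (lintegral_mono fun p => ?_)
        rw [Real.enorm_of_nonneg (mul_nonneg (mul_nonneg (hg0 _) (hg0 _)) (hk0 _))]
    _ = ∫⁻ x, ∫⁻ y, ENNReal.ofReal (g x * g y * k (x ^ 2 - y ^ 2)) := by
        rw [Measure.volume_eq_prod, lintegral_prod]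
        have : Measurable k := by fun_prop
        exact Measurable.aemeasurable (by fun_prop)
    _ ≤ ∫⁻ x, ENNReal.ofReal (g x) * ENNReal.ofReal (4 * Real.pi * l) := by
        refine lintegral_mono fun x => ?_
        calc _ ≤ ∫⁻ y, ENNReal.ofReal (g x) * ENNReal.ofReal l *
              (ENNReal.ofReal |y| * ENNReal.ofReal (k (x ^ 2 - y ^ 2))) := by
              refine lintegral_mono fun y => ?_
              rw [← ENNReal.ofReal_mul (hg0 x), ← ENNReal.ofReal_mul (abs_nonneg y),
                ← ENNReal.ofReal_mul (mul_nonneg (hg0 x) hl)]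
              refine ENNReal.ofReal_le_ofReal ?_
              calc _ ≤ g x * (l * |y|) * k (x ^ 2 - y ^ 2) := by
                    gcongr
                    · exact hg0 x
                    · exact hgl y
                _ = _ := by ring
          _ ≤ ENNReal.ofReal (g x) * ENNReal.ofReal l * (2 * ENNReal.ofReal (2 * Real.pi)) := by
              rw [lintegral_const_mul' _ _ (by finiteness)]
              gcongr
              refine (lintegral_abs_mul_comp_sq_le (fun u => ENNReal.ofReal (k (x ^ 2 - u)))).trans ?_
              rw [← lintegral_gaussian_kernel hε (x ^ 2)]
          _ = _ := by
              rw [mul_assoc]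
              congr 1
              rw [show (2 : ℝ≥0∞) = ENNReal.ofReal 2 by simp, ← ENNReal.ofReal_mul (by norm_num),
                ← ENNReal.ofReal_mul hl]
              congr 1; ring
    _ ≤ _ := by
        rw [lintegral_mul_const _ (by fun_prop),
          ← ofReal_integral_eq_lintegral_ofReal hg (Eventually.of_forall hg0)]
        calc _ ≤ 1 * ENNReal.ofReal (4 * Real.pi * l) := by
              gcongr
              exact ENNReal.ofReal_le_one.2 hg1
          _ = _ := one_mul _

/-- The condition `g ≤ l|x|` says that the image of `g dx` under squaring has density at most `l`,
hence lies in `L²`. Fatou's lemma removes the Gaussian weight, whose bound is uniform in `ε`. -/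
lemma lintegral_norm_sq_sqCharFun_le {g : ℝ → ℝ} (hgm : Measurable g)
    (hg0 : ∀ x, 0 ≤ g x) (hg : Integrable g) (hg1 : ∫ x, g x ≤ 1) {l : ℝ} (hl : 0 ≤ l)
    (hgl : ∀ x, g x ≤ l * |x|) :
    ∫⁻ ξ : ℝ, ENNReal.ofReal (‖sqCharFun g ξ‖ ^ 2) ≤ ENNReal.ofReal (4 * Real.pi * l) := by
  have hc := continuous_sqCharFun hg
  have hlim : ∀ ξ : ℝ, Tendsto (fun n : ℕ => ENNReal.ofReal
      (Real.exp (-(1 / ((n : ℝ) + 1)) * ξ ^ 2) * ‖sqCharFun g ξ‖ ^ 2)) atTop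
      (𝓝 (ENNReal.ofReal (‖sqCharFun g ξ‖ ^ 2))) := fun ξ => by
    refine (ENNReal.continuous_ofReal.tendsto _).comp ?_
    have h1 : Tendsto (fun n : ℕ => -(1 / ((n : ℝ) + 1)) * ξ ^ 2) atTop (𝓝 0) := by
      simpa using (tendsto_one_div_add_atTop_nhds_zero_nat (𝕜 := ℝ)).neg.mul_const (ξ ^ 2)
    simpa using ((Real.continuous_exp.tendsto 0).comp h1).mul_const (‖sqCharFun g ξ‖ ^ 2)
  calc _ = ∫⁻ ξ : ℝ, liminf (fun n : ℕ => ENNReal.ofReal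
      (Real.exp (-(1 / ((n : ℝ) + 1)) * ξ ^ 2) * ‖sqCharFun g ξ‖ ^ 2)) atTop :=
        lintegral_congr fun ξ => (hlim ξ).liminf_eq.symm
    _ ≤ _ := by
        refine (lintegral_liminf_le fun n => by fun_prop).trans ?_
        refine liminf_le_of_le (by isBoundedDefault) fun b hb => ?_
        obtain ⟨n, hn⟩ := hb.exists
        exact hn.trans (lintegral_gaussian_mul_norm_sq_sqCharFun_le hgm hg0 hg hg1 hl hgl
          (by positivity))

lemma norm_sqCharFun_le_one {f : ℝ → ℝ} (hf : IsProbDensity f) (ξ : ℝ) : ‖sqCharFun f ξ‖ ≤ 1 := by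
  refine (norm_sqCharFun_le f ξ).trans (le_of_eq ?_)
  simp_rw [abs_of_nonneg (hf.nonneg _)]
  exact hf.integral_eq_one

/-- Weak-type bound for the characteristic function of `V²`. -/
lemma exists_volume_norm_sqCharFun_gt_le {f : ℝ → ℝ} (hf : IsProbDensity f) {q : ℝ} (hq : 1 < q)
    (hq2 : q ≤ 2) (hfq : Integrable (fun x => f x ^ q)) :
    ∃ D s : ℝ, ∀ t : ℝ, 0 < t → t ≤ 1 →
      volume {ξ : ℝ | t < ‖sqCharFun f ξ‖} ≤ ENNReal.ofReal (D * t ^ (-s)) := by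
  obtain ⟨B, δ, hB, hδ, hBδ⟩ := exists_integral_large_le hf hq hq2 hfq
  have hB0 : 0 < B := by linarith
  have hfm := hf.measurable
  refine ⟨16 * Real.pi * (2 * B) ^ (1 / δ), 2 + 1 / δ, fun t ht ht1 => ?_⟩
  -- Chosen so that the discarded mass `B l^{-δ}` equals `t/2`. Chebyshev for the kept part at level
  -- `t/2` then gives `4πl / (t/2)²`, the stated power of `t`.
  set l : ℝ := (2 * B / t) ^ (1 / δ) with hl
  have hbase : 1 ≤ 2 * B / t := by rw [le_div_iff₀ ht]; linarith
  have hl1 : 1 ≤ l := Real.one_le_rpow hbase (by positivity)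
  have hs : MeasurableSet {x : ℝ | l * |x| < f x} := measurableSet_lt (by fun_prop) hfm
  set g : ℝ → ℝ := {x : ℝ | l * |x| < f x}ᶜ.indicator f with hg
  have hgm : Measurable g := hfm.indicator hs.compl
  have hg0 : ∀ x, 0 ≤ g x := fun x => Set.indicator_nonneg (fun y _ => hf.nonneg y) x
  have hgi : Integrable g := hf.integrable.indicator hs.compl
  have hg1 : ∫ x, g x ≤ 1 := by
    rw [← hf.integral_eq_one]
    exact integral_mono hgi hf.integrable fun x =>
      Set.indicator_le_self' (fun y _ => hf.nonneg y) x
  have hgl : ∀ x, g x ≤ l * |x| := fun x => by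
    by_cases hx : l * |x| < f x
    · rw [hg, Set.indicator_of_notMem (by simpa using hx)]; positivity
    · rw [hg, Set.indicator_of_mem (by simpa using hx)]; exact not_lt.1 hx
  have hdiff : ∀ ξ, ‖sqCharFun f ξ - sqCharFun g ξ‖ ≤ t / 2 := fun ξ => by
    have h1 : sqCharFun f ξ - sqCharFun g ξ =
        sqCharFun ({x : ℝ | l * |x| < f x}.indicator f) ξ := by
      have hgi' : Integrable fun x : ℝ => cexp (ξ * x ^ 2 * I) * (g x : ℂ) := by
        refine hgi.ofReal.bdd_mul (c := 1) (measurable_sq_exp ξ).aestronglyMeasurable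
          (Eventually.of_forall fun x => ?_)
        have := norm_exp_ofReal_mul_I (ξ * x ^ 2)
        push_cast at this
        rw [this]
      unfold sqCharFun
      rw [← integral_sub (integrable_exp_sq_mul hf ξ) hgi']
      congr 1
      ext x
      rw [← mul_sub, ← ofReal_sub]
      congr 2
      by_cases hx : l * |x| < f x
      · rw [hg, Set.indicator_of_notMem (by simpa using hx), Set.indicator_of_mem (by exact hx),
          sub_zero]
      · rw [hg, Set.indicator_of_mem (by simpa using hx), Set.indicator_of_notMem (by exact hx),
          sub_self]
    rw [h1]
    refine (norm_sqCharFun_le _ ξ).trans ?_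
    simp_rw [abs_of_nonneg (Set.indicator_nonneg (fun y _ => hf.nonneg y) _)]
    rw [integral_indicator hs]
    refine (hBδ l hl1).trans (le_of_eq ?_)
    rw [hl, ← Real.rpow_mul (by positivity), show 1 / δ * -δ = -1 by field_simp, Real.rpow_neg_one]
    field_simp
  have hsub : {ξ : ℝ | t < ‖sqCharFun f ξ‖} ⊆
      {ξ : ℝ | ENNReal.ofReal ((t / 2) ^ 2) ≤ ENNReal.ofReal (‖sqCharFun g ξ‖ ^ 2)} := by
    intro ξ (hξ : t < ‖sqCharFun f ξ‖)
    have h1 : t / 2 ≤ ‖sqCharFun g ξ‖ := by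
      have := norm_sub_norm_le (sqCharFun f ξ) (sqCharFun g ξ)
      linarith [hdiff ξ]
    exact ENNReal.ofReal_le_ofReal (by gcongr)
  refine (measure_mono hsub).trans ?_
  have hc := continuous_sqCharFun hgi
  refine (meas_ge_le_lintegral_div (by fun_prop) (by simp; positivity) (by simp)).trans ?_
  refine (ENNReal.div_le_div_right
    (lintegral_norm_sq_sqCharFun_le hgm hg0 hgi hg1 (by linarith) hgl) _).trans ?_
  rw [← ENNReal.ofReal_div_of_pos (by positivity)]
  refine ENNReal.ofReal_le_ofReal (le_of_eq ?_)
  rw [hl, Real.div_rpow (by positivity) ht.le, neg_add, Real.rpow_add ht, Real.rpow_neg ht.le (1 / δ),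
    Real.rpow_neg ht.le 2]
  norm_num
  field_simp
  norm_num

/-- Some power of the characteristic function of `V²` is integrable. -/
theorem exists_integrable_sqCharFun_pow {f : ℝ → ℝ} (hf : IsProbDensity f) {p : ℝ≥0∞} (hp : 1 < p)
    (hfp : MemLp f p volume) : ∃ n₀ : ℕ, ∀ n ≥ n₀, Integrable fun ξ => sqCharFun f ξ ^ n := by
  obtain ⟨q, hq, hq2, hfq⟩ := exists_rpow_integrable hf hp hfp
  obtain ⟨D, s, hDs⟩ := exists_volume_norm_sqCharFun_gt_le hf hq hq2 hfq
  have hc := continuous_sqCharFun hf.integrable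
  -- In the layer-cake formula for `∫ |φ|^{m+1}` only levels `t ≤ 1` contribute, and there `t^{-s}
  -- t^m ≤ 1`.
  obtain ⟨m, hm⟩ := exists_nat_ge (s + 1)
  have hbase : Integrable fun ξ => ‖sqCharFun f ξ‖ ^ (m + 1) := by
    refine ⟨by fun_prop, ?_⟩
    rw [hasFiniteIntegral_iff_ofReal (Eventually.of_forall fun ξ => by positivity)]
    have := lintegral_rpow_eq_lintegral_meas_lt_mul volume (f := fun ξ => ‖sqCharFun f ξ‖)
      (Eventually.of_forall fun ξ => norm_nonneg _) (by fun_prop) (p := (m + 1 : ℕ))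
      (by positivity)
    simp only [Real.rpow_natCast] at this
    rw [this]
    refine ENNReal.mul_lt_top (by simp) ?_
    calc _ ≤ ∫⁻ t in Set.Ioi (0 : ℝ), (Set.Ioc (0 : ℝ) 1).indicator (fun _ => ENNReal.ofReal |D|) t := by
          refine setLIntegral_mono' measurableSet_Ioi fun t (ht : 0 < t) => ?_
          by_cases ht1 : t ≤ 1
          · rw [Set.indicator_of_mem (show t ∈ Set.Ioc (0 : ℝ) 1 from ⟨ht, ht1⟩)]
            calc _ ≤ ENNReal.ofReal (D * t ^ (-s)) * ENNReal.ofReal (t ^ (((m + 1 : ℕ) : ℝ) - 1)) := by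
                  gcongr
                  exact hDs t ht ht1
              _ = ENNReal.ofReal (D * (t ^ (-s) * t ^ (((m + 1 : ℕ) : ℝ) - 1))) := by
                  rw [← ENNReal.ofReal_mul' (by positivity), mul_assoc]
              _ ≤ _ := by
                  refine ENNReal.ofReal_le_ofReal ?_
                  have h1 : t ^ (-s) * t ^ (((m + 1 : ℕ) : ℝ) - 1) ≤ 1 := by
                    rw [← Real.rpow_add ht]
                    refine Real.rpow_le_one ht.le ht1 ?_
                    push_cast; linarith
                  have h0 : 0 ≤ t ^ (-s) * t ^ (((m + 1 : ℕ) : ℝ) - 1) := by positivity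
                  calc _ ≤ |D| * (t ^ (-s) * t ^ (((m + 1 : ℕ) : ℝ) - 1)) := by
                        gcongr; exact le_abs_self D
                    _ ≤ |D| * 1 := by gcongr
                    _ = |D| := mul_one _
          · have : {ξ : ℝ | t < ‖sqCharFun f ξ‖} = ∅ := by
              ext ξ
              simp only [Set.mem_ofPred_eq, Set.mem_empty_iff_false, iff_false, not_lt]
              linarith [norm_sqCharFun_le_one hf ξ]
            rw [this]
            simp
      _ ≤ ∫⁻ t, (Set.Ioc (0 : ℝ) 1).indicator (fun _ => ENNReal.ofReal |D|) t :=
          setLIntegral_le_lintegral _ _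
      _ < ∞ := by
          rw [lintegral_indicator measurableSet_Ioc]
          simp
  refine ⟨m + 1, fun n hn => hbase.mono' (by fun_prop) (Eventually.of_forall fun ξ => ?_)⟩
  rw [norm_pow]
  exact pow_le_pow_of_le_one (norm_nonneg _) (norm_sqCharFun_le_one hf ξ) hn

lemma countable_cos_sq_eq_one {ξ : ℝ} (hξ : ξ ≠ 0) (θ : ℝ) :
    {x : ℝ | Real.cos (ξ * x ^ 2 - θ) = 1}.Countable := by
  have h : {x : ℝ | Real.cos (ξ * x ^ 2 - θ) = 1} ⊆
      ⋃ n : ℤ, ({Real.sqrt ((θ + n * (2 * Real.pi)) / ξ),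
        -Real.sqrt ((θ + n * (2 * Real.pi)) / ξ)} : Set ℝ) := by
    intro x (hx : Real.cos (ξ * x ^ 2 - θ) = 1)
    obtain ⟨n, hn⟩ := (Real.cos_eq_one_iff _).1 hx
    have h2 : (θ + n * (2 * Real.pi)) / ξ = x ^ 2 := by
      rw [div_eq_iff hξ, hn]; ring
    rw [Set.mem_iUnion]
    refine ⟨n, ?_⟩
    rw [h2, Real.sqrt_sq_eq_abs]
    rcases abs_choice x with h | h <;> simp [h]
  exact (Set.countable_iUnion fun n => (Set.toFinite _).countable).mono h

/-- Equality would force `e^{i(ξx² - θ)} = 1` for almost every `x` with `f(x) ≠ 0`; only countably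
many `x` satisfy this, so `f` would vanish almost everywhere. -/
lemma norm_sqCharFun_lt_one {f : ℝ → ℝ} (hf : IsProbDensity f) {ξ : ℝ} (hξ : ξ ≠ 0) :
    ‖sqCharFun f ξ‖ < 1 := by
  refine lt_of_le_of_ne (norm_sqCharFun_le_one hf ξ) fun heq => ?_
  set θ := arg (sqCharFun f ξ) with hθ
  have hz : sqCharFun f ξ = cexp (θ * I) := by
    have := norm_mul_exp_arg_mul_I (sqCharFun f ξ)
    rw [heq] at this
    simpa using this.symm
  have hint : Integrable fun x : ℝ => Real.cos (ξ * x ^ 2 - θ) * f x := by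
    refine hf.integrable.bdd_mul (c := 1) (Measurable.aestronglyMeasurable (by fun_prop))
      (Eventually.of_forall fun x => ?_)
    exact Real.abs_cos_le_one _
  have h1 : ∫ x : ℝ, Real.cos (ξ * x ^ 2 - θ) * f x = 1 := by
    have h2 : (cexp (-(θ * I)) * sqCharFun f ξ).re = 1 := by
      rw [hz, ← exp_add]; simp
    rw [sqCharFun, ← integral_const_mul] at h2
    have h3 := reCLM.integral_comp_comm ((integrable_exp_sq_mul hf ξ).const_mul (cexp (-(θ * I))))
    simp only [reCLM_apply] at h3
    rw [← h2, ← h3]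
    refine integral_congr_ae (Eventually.of_forall fun x => ?_)
    have he : cexp (-(θ * I)) * (cexp (ξ * x ^ 2 * I) * f x) =
        cexp ((ξ * x ^ 2 - θ : ℝ) * I) * f x := by
      rw [← mul_assoc, ← exp_add]
      congr 2
      push_cast; ring
    change _ = (cexp (-(θ * I)) * (cexp (ξ * x ^ 2 * I) * f x)).re
    rw [he, re_mul_ofReal, exp_ofReal_mul_I_re]
  have h4 : ∫ x : ℝ, (1 - Real.cos (ξ * x ^ 2 - θ)) * f x = 0 := by
    have := integral_sub hf.integrable hint
    rw [h1, hf.integral_eq_one, sub_self] at this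
    rw [← this]
    congr 1; ext x; ring
  have hi4 : Integrable fun x : ℝ => (1 - Real.cos (ξ * x ^ 2 - θ)) * f x := by
    refine (hf.integrable.sub hint).congr (Eventually.of_forall fun x => ?_)
    simp only [Pi.sub_apply]; ring
  have h5 := (integral_eq_zero_iff_of_nonneg (fun x => mul_nonneg
    (sub_nonneg.2 (Real.cos_le_one _)) (hf.nonneg x)) hi4).1 h4
  have h6 : f =ᵐ[volume] 0 := by
    filter_upwards [h5, (countable_cos_sq_eq_one hξ θ).ae_notMem volume] with x hx hx'
    rcases mul_eq_zero.1 hx with h | h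
    · exact absurd (by linarith : Real.cos (ξ * x ^ 2 - θ) = 1) hx'
    · exact h
  have := integral_congr_ae h6
  rw [hf.integral_eq_one] at this
  simp at this

end L2

/-! ### Fourier inversion almost everywhere -/

section inversion
open Complex
open scoped FourierTransform SchwartzMap

lemma integral_fourier_smul_eq_of_integrable {φ g : ℝ → ℂ} (hφ : Integrable φ) (hg : Integrable g) :
    ∫ ξ, 𝓕 φ ξ • g ξ = ∫ x, φ x • 𝓕 g x := by
  simpa using! VectorFourier.integral_bilin_fourierIntegral_eq_flip (.lsmul ℂ ℂ) (L := innerₗ ℝ)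
    Real.continuous_fourierChar continuous_inner hφ hg

/-- Fourier inversion almost everywhere, without any continuity assumption. -/
theorem fourierInv_fourier_ae_eq {g : ℝ → ℂ} (hg : Integrable g) (hg' : Integrable (𝓕 g)) :
    g =ᵐ[volume] 𝓕⁻ (𝓕 g) := by
  have hcont : Continuous (𝓕⁻ (𝓕 g)) := by
    rw [Real.fourierInv_eq_fourier_comp_neg]
    exact VectorFourier.fourierIntegral_continuous Real.continuous_fourierChar continuous_inner
      hg'.comp_neg
  -- Both sides are tested against smooth compactly supported `χ`. Writing `χ` as the transform of a
  -- Schwartz function allows the Fourier transform to be moved across the pairing twice.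
  refine ae_eq_of_integral_contDiff_smul_eq hg.locallyIntegrable hcont.locallyIntegrable ?_
  intro χ hχ hχs
  have hχ' : ContDiff ℝ (⊤ : ℕ∞) fun x => (χ x : ℂ) := ofRealCLM.contDiff.comp hχ
  have hχs' : HasCompactSupport fun x => (χ x : ℂ) := hχs.comp_left ofReal_zero
  set X : 𝓢(ℝ, ℂ) := hχs'.toSchwartzMap hχ'
  have hX : ∀ x, X x = (χ x : ℂ) := fun x => rfl
  have hX1 : ∀ x, 𝓕 ((𝓕⁻ X : 𝓢(ℝ, ℂ)) : ℝ → ℂ) x = X x := fun x => by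
    rw [← SchwartzMap.fourier_coe, FourierTransform.fourier_fourierInv_eq]
  have h1 := integral_fourier_smul_eq_of_integrable (𝓕⁻ X).integrable hg
  have h2 : ∫ x, 𝓕⁻ X x • 𝓕 g x = ∫ x, X x • 𝓕⁻ (𝓕 g) x := by
    have h3 := integral_fourier_smul_eq_of_integrable X.integrable hg'.comp_neg
    rw [← Real.fourierInv_eq_fourier_comp_neg] at h3
    rw [← h3, ← integral_neg_eq_self]
    congr 1
    ext x
    rw [SchwartzMap.fourierInv_coe, Real.fourierInv_eq_fourier_neg, neg_neg]
  calc ∫ x, χ x • g x = ∫ x, 𝓕 ((𝓕⁻ X : 𝓢(ℝ, ℂ)) : ℝ → ℂ) x • g x := by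
        congr 1; ext x; rw [hX1, hX, real_smul, smul_eq_mul]
    _ = ∫ x, χ x • 𝓕⁻ (𝓕 g) x := by
        rw [h1, h2]; congr 1

end inversion

/-! ### The Fourier formula for the density -/

section density
open Complex

lemma integral_tensorPower_mul {f : ℝ → ℝ} (N : ℕ) (ξ : ℝ) :
    ∫ v : Fin N → ℝ, (tensorPower f N v : ℂ) * cexp (ξ * (∑ i, v i ^ 2 : ℝ) * I) =
      sqCharFun f ξ ^ N := by
  have h : ∀ v : Fin N → ℝ, (tensorPower f N v : ℂ) * cexp (ξ * (∑ i, v i ^ 2 : ℝ) * I) =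
      ∏ i, (cexp (ξ * (v i) ^ 2 * I) * f (v i)) := fun v => by
    rw [Finset.prod_mul_distrib, ← exp_sum, tensorPower]
    push_cast
    rw [Finset.mul_sum, Finset.sum_mul, mul_comm]
  simp_rw [h]
  rw [integral_fintype_prod_volume_eq_pow (fun x : ℝ => cexp (ξ * x ^ 2 * I) * (f x : ℂ)),
    Fintype.card_fin, sqCharFun]

lemma integrable_tensorPower {f : ℝ → ℝ} (hf : IsProbDensity f) (N : ℕ) :
    Integrable (tensorPower f N) :=
  Integrable.fintype_prod (f := fun _ => f) fun _ => hf.integrable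

lemma integral_tensorPower {f : ℝ → ℝ} (hf : IsProbDensity f) (N : ℕ) :
    ∫ v, tensorPower f N v = 1 := by
  unfold tensorPower
  rw [integral_fintype_prod_volume_eq_pow f, hf.integral_eq_one, one_pow]

lemma lintegral_sumSqDensity {f : ℝ → ℝ} (hf : IsProbDensity f) {N : ℕ} (hN : N ≠ 0) :
    ∫⁻ u, sumSqDensity f N u = 1 := by
  have h := congrArg (fun μ : Measure ℝ => μ Set.univ) (map_sum_sq_tensorMeasure hf hN)
  simp only [withDensity_apply _ MeasurableSet.univ, Measure.restrict_univ] at h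
  rw [← h, Measure.map_apply (by fun_prop) MeasurableSet.univ, Set.preimage_univ, tensorMeasure,
    withDensity_apply _ MeasurableSet.univ, Measure.restrict_univ,
    ← ofReal_integral_eq_lintegral_ofReal (integrable_tensorPower hf N)
      (Eventually.of_forall (tensorPower_nonneg hf N)), integral_tensorPower hf, ENNReal.ofReal_one]

lemma ae_sumSqDensity_lt_top {f : ℝ → ℝ} (hf : IsProbDensity f) {N : ℕ} (hN : N ≠ 0) :
    ∀ᵐ u, sumSqDensity f N u < ∞ :=
  ae_lt_top (measurable_sumSqDensity hf N) (by rw [lintegral_sumSqDensity hf hN]; simp)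

lemma integrable_toReal_sumSqDensity {f : ℝ → ℝ} (hf : IsProbDensity f) {N : ℕ} (hN : N ≠ 0) :
    Integrable fun u => (sumSqDensity f N u).toReal :=
  integrable_toReal_of_lintegral_ne_top (measurable_sumSqDensity hf N).aemeasurable
    (by rw [lintegral_sumSqDensity hf hN]; simp)

lemma integral_sumSqDensity_mul_exp {f : ℝ → ℝ} (hf : IsProbDensity f) {N : ℕ} (hN : N ≠ 0) (ξ : ℝ) :
    ∫ u : ℝ, ((sumSqDensity f N u).toReal : ℂ) * cexp (ξ * u * I) = sqCharFun f ξ ^ N := by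
  have h1 := integral_withDensity_eq_integral_toReal_smul (measurable_sumSqDensity hf N)
    (ae_sumSqDensity_lt_top hf hN) (fun u : ℝ => cexp (ξ * u * I))
  simp only [real_smul] at h1
  have hm : Measurable fun u : ℝ => cexp (ξ * u * I) := by fun_prop
  rw [← h1, ← map_sum_sq_tensorMeasure hf hN,
    integral_map (Measurable.aemeasurable (by fun_prop))
    hm.aestronglyMeasurable, tensorMeasure,
    integral_withDensity_eq_integral_toReal_smul
      (measurable_tensorPower hf N).ennreal_ofReal (by simp), ← integral_tensorPower_mul]
  congr 1
  ext v
  rw [ENNReal.toReal_ofReal (tensorPower_nonneg hf N v), real_smul]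

/-- The density of `V₁² + ⋯ + V_N²` as given by Fourier inversion. -/
def fourierDensity (f : ℝ → ℝ) (N : ℕ) (u : ℝ) : ℝ :=
  Real.pi⁻¹ * ∫ ξ in Set.Ioi (0 : ℝ), (sqCharFun f ξ ^ N * cexp (-(ξ * u * I))).re

lemma sqCharFun_neg (f : ℝ → ℝ) (ξ : ℝ) : sqCharFun f (-ξ) = (starRingEnd ℂ) (sqCharFun f ξ) := by
  rw [conj_sqCharFun, sqCharFun]
  congr 1
  ext x
  push_cast
  ring_nf

/-- The real part is even in `ξ`, so inversion folds onto `(0, ∞)`, the side on which the expansion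
at `0+` is stated. -/
lemma re_sqCharFun_abs (f : ℝ → ℝ) (N : ℕ) (u ξ : ℝ) :
    (sqCharFun f |ξ| ^ N * cexp (-((|ξ| : ℝ) * u * I))).re =
      (sqCharFun f ξ ^ N * cexp (-(ξ * u * I))).re := by
  rcases abs_choice ξ with h | h
  · rw [h]
  · rw [h, sqCharFun_neg, ← conj_re]
    congr 1
    simp only [map_mul, map_pow, conj_conj, ← exp_conj, map_neg, conj_ofReal, conj_I, ofReal_neg]
    ring_nf

lemma norm_exp_neg_mul_I (a b : ℝ) : ‖cexp (-(a * b * I))‖ = 1 := by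
  have := norm_exp_ofReal_mul_I (-(a * b))
  rw [← this]
  push_cast
  ring_nf

lemma integrable_sqCharFun_pow_mul {f : ℝ → ℝ} {N : ℕ}
    (hN : Integrable fun ξ => sqCharFun f ξ ^ N) (u : ℝ) :
    Integrable fun ξ : ℝ => sqCharFun f ξ ^ N * cexp (-(ξ * u * I)) := by
  refine hN.mul_bdd (c := 1) (Measurable.aestronglyMeasurable (by fun_prop))
    (Eventually.of_forall fun ξ => ?_)
  rw [norm_exp_neg_mul_I]

-- The transform with kernel `e^{-2πivw}` takes the density to `φ(-2πw)^N`. Rescaling costs `(2π)⁻¹`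
-- and folding by evenness gains `2`, whence the prefactor `π⁻¹`.
open scoped FourierTransform in
lemma toReal_sumSqDensity_ae_eq {f : ℝ → ℝ} (hf : IsProbDensity f) {N : ℕ} (hN0 : N ≠ 0)
    (hN : Integrable fun ξ => sqCharFun f ξ ^ N) :
    ∀ᵐ u, (sumSqDensity f N u).toReal = fourierDensity f N u := by
  set g : ℝ → ℂ := fun u => ((sumSqDensity f N u).toReal : ℂ) with hg
  have hgi : Integrable g := (integrable_toReal_sumSqDensity hf hN0).ofReal
  have hF : 𝓕 g = fun w => sqCharFun f (-2 * Real.pi * w) ^ N := by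
    ext w
    rw [Real.fourier_real_eq_integral_exp_smul, ← integral_sumSqDensity_mul_exp hf hN0]
    congr 1
    ext v
    rw [smul_eq_mul, mul_comm]
    congr 2
    push_cast
    ring
  have hFi : Integrable (𝓕 g) := by
    rw [hF]
    exact hN.comp_mul_left' (by simp [Real.pi_ne_zero])
  filter_upwards [fourierInv_fourier_ae_eq hgi hFi] with u hu
  have h1 : (sumSqDensity f N u).toReal = (𝓕⁻ (𝓕 g) u).re := by rw [← hu, hg, ofReal_re]
  have h2 : 𝓕⁻ (𝓕 g) u = ∫ v : ℝ, sqCharFun f (-2 * Real.pi * v) ^ N *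
      cexp (-(((-2 * Real.pi * v : ℝ) : ℂ) * u * I)) := by
    rw [Real.fourierInv_eq', hF]
    congr 1
    ext v
    rw [smul_eq_mul, mul_comm]
    congr 2
    simp only [RCLike.inner_apply, conj_trivial]
    push_cast
    ring
  have h3 := Measure.integral_comp_mul_left (fun ξ : ℝ => sqCharFun f ξ ^ N * cexp (-(ξ * u * I)))
    (-2 * Real.pi)
  rw [h1, h2, h3, smul_re, smul_eq_mul, fourierDensity]
  have h4 := reCLM.integral_comp_comm (integrable_sqCharFun_pow_mul hN u)
  simp only [reCLM_apply] at h4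
  rw [← h4]
  have h5 : ∫ ξ : ℝ, (sqCharFun f ξ ^ N * cexp (-(ξ * u * I))).re =
      2 * ∫ ξ in Set.Ioi (0 : ℝ), (sqCharFun f ξ ^ N * cexp (-(ξ * u * I))).re := by
    rw [← integral_comp_abs (f := fun ξ => (sqCharFun f ξ ^ N * cexp (-(ξ * u * I))).re)]
    exact integral_congr_ae (Eventually.of_forall fun ξ => (re_sqCharFun_abs f N u ξ).symm)
  rw [h5, show |(-2 * Real.pi)⁻¹| = (2 * Real.pi)⁻¹ by
    rw [abs_inv, abs_mul, abs_neg, abs_two, abs_of_pos Real.pi_pos], mul_inv]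
  ring

lemma abs_re_le_norm_pow (f : ℝ → ℝ) (N : ℕ) (u ξ : ℝ) :
    |(sqCharFun f ξ ^ N * cexp (-(ξ * u * I))).re| ≤ ‖sqCharFun f ξ‖ ^ N := by
  refine (abs_re_le_norm _).trans (le_of_eq ?_)
  rw [norm_mul, norm_exp_neg_mul_I, norm_pow, mul_one]

lemma abs_fourierDensity_le {f : ℝ → ℝ} {N : ℕ} (hN : Integrable fun ξ => sqCharFun f ξ ^ N) (u : ℝ) :
    |fourierDensity f N u| ≤ Real.pi⁻¹ * ∫ ξ in Set.Ioi (0 : ℝ), ‖sqCharFun f ξ‖ ^ N := by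
  rw [fourierDensity, abs_mul, abs_of_pos (inv_pos.2 Real.pi_pos)]
  gcongr
  refine (abs_integral_le_integral_abs).trans ?_
  refine integral_mono (integrable_sqCharFun_pow_mul hN u).re.norm.integrableOn ?_
    fun ξ => abs_re_le_norm_pow f N u ξ
  refine hN.norm.integrableOn.congr (Eventually.of_forall fun ξ => ?_)
  simp only [norm_pow]

lemma measurable_fourierDensity {f : ℝ → ℝ} (hf : IsProbDensity f) (N : ℕ) :
    Measurable (fourierDensity f N) := by
  have hc := continuous_sqCharFun hf.integrable
  refine Measurable.const_mul ?_ _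
  have : Measurable fun p : ℝ × ℝ => (sqCharFun f p.2 ^ N * cexp (-(p.2 * p.1 * I))).re := by
    fun_prop
  exact (this.stronglyMeasurable.integral_prod_right' (ν := volume.restrict (Set.Ioi 0))).measurable

/-- The counterpart of `sumSqDensity_succ`: one factor `φ` is written as an integral over `x` and
Fubini applies. Sharing this recursion is what lets the two densities be compared pointwise. -/
lemma fourierDensity_succ {f : ℝ → ℝ} (hf : IsProbDensity f) {N : ℕ}
    (hN : Integrable fun ξ => sqCharFun f ξ ^ N) (u : ℝ) :
    fourierDensity f (N + 1) u = ∫ x, f x * fourierDensity f N (u - x ^ 2) := by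
  have hc := continuous_sqCharFun hf.integrable
  have hfm := hf.measurable
  have h1 : ∀ ξ : ℝ, (sqCharFun f ξ ^ (N + 1) * cexp (-(ξ * u * I))).re =
      ∫ x, f x * (sqCharFun f ξ ^ N * cexp (-(ξ * (u - x ^ 2 : ℝ) * I))).re := by
    intro ξ
    have h2 : sqCharFun f ξ ^ (N + 1) * cexp (-(ξ * u * I)) =
        ∫ x : ℝ, (sqCharFun f ξ ^ N * cexp (-(ξ * u * I))) * (cexp (ξ * x ^ 2 * I) * f x) := by
      rw [integral_const_mul, ← sqCharFun]; ring
    have h3 := reCLM.integral_comp_comm ((integrable_exp_sq_mul hf ξ).const_mul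
      (sqCharFun f ξ ^ N * cexp (-(ξ * u * I))))
    simp only [reCLM_apply] at h3
    rw [h2, ← h3]
    congr 1
    ext x
    rw [← re_ofReal_mul]
    congr 1
    rw [show -((ξ : ℂ) * (u - x ^ 2 : ℝ) * I) = -(ξ * u * I) + ξ * x ^ 2 * I by push_cast; ring,
      exp_add]
    ring
  unfold fourierDensity
  simp_rw [h1]
  rw [integral_integral_swap]
  · rw [← integral_const_mul]
    congr 1
    ext x
    rw [integral_const_mul]
    ring
  · have hi : Integrable (fun z : ℝ × ℝ => ‖sqCharFun f z.1 ^ N‖ * f z.2)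
        ((volume.restrict (Set.Ioi 0)).prod volume) :=
      Integrable.mul_prod hN.norm.restrict hf.integrable
    refine hi.mono' (Measurable.aestronglyMeasurable (by fun_prop)) (Eventually.of_forall fun z => ?_)
    simp only [Function.uncurry_def]
    rw [norm_mul, Real.norm_of_nonneg (hf.nonneg _), mul_comm, norm_pow, Real.norm_eq_abs]
    have := hf.nonneg z.2
    gcongr
    exact abs_re_le_norm_pow f N _ z.1

/-- The weight `|x|` produced by the change of variables vanishes only at `0`, so null sets pull
back to null sets. -/
lemma volume_preimage_sub_sq {s : Set ℝ} (hs : volume s = 0) (u : ℝ) :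
    ∀ᵐ x : ℝ, u - x ^ 2 ∉ s := by
  obtain ⟨t, hst, htm, ht⟩ := exists_measurable_superset_of_null hs
  have hm : MeasurableSet {x : ℝ | u - x ^ 2 ∈ t} := (by fun_prop : Measurable fun x : ℝ => u - x ^ 2) htm
  have h1 := lintegral_abs_mul_comp_sq_le (t.indicator (1 : ℝ → ℝ≥0∞) <| u - ·)
  have h2 : ∫⁻ v, t.indicator (1 : ℝ → ℝ≥0∞) (u - v) = 0 := by
    rw [lintegral_sub_left_eq_self (fun v => t.indicator (1 : ℝ → ℝ≥0∞) v) u,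
      lintegral_indicator_one htm, ht]
  rw [h2, mul_zero, nonpos_iff_eq_zero, lintegral_eq_zero_iff (by
    have : Measurable (t.indicator (1 : ℝ → ℝ≥0∞)) := measurable_one.indicator htm
    fun_prop)] at h1
  have h0 : ∀ᵐ x : ℝ, x ≠ 0 := by simp [ae_iff]
  filter_upwards [h1, h0] with x hx hx0 hxs
  rcases mul_eq_zero.1 hx with h | h
  · simp [hx0] at h
  · rw [Set.indicator_of_mem (hst hxs)] at h
    simp at h

/-- The Fourier formula for the density holds at every point. -/
theorem exists_sumSqDensity_eq {f : ℝ → ℝ} (hf : IsProbDensity f) {p : ℝ≥0∞} (hp : 1 < p)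
    (hfp : MemLp f p volume) : ∃ n₀ : ℕ, ∀ N ≥ n₀, N ≠ 0 ∧ (Integrable fun ξ => sqCharFun f ξ ^ N) ∧
      ∀ u, 0 ≤ fourierDensity f N u ∧ sumSqDensity f N u = ENNReal.ofReal (fourierDensity f N u) := by
  obtain ⟨n₀, hn₀⟩ := exists_integrable_sqCharFun_pow hf hp hfp
  -- One unit is spent on the recursion from `M = N - 1`, the other ensures `M ≠ 0`. The almost
  -- everywhere identity at `M`, pulled back along `x ↦ u - x²` and integrated, holds at every `u`
  -- for `N`.
  refine ⟨n₀ + 2, fun N hN => ⟨by omega, hn₀ N (by omega), fun u => ?_⟩⟩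
  obtain ⟨M, rfl⟩ : ∃ M, N = M + 1 := ⟨N - 1, by omega⟩
  have hM0 : M ≠ 0 := by omega
  have hM := hn₀ M (by omega)
  have hae : ∀ᵐ u, sumSqDensity f M u = ENNReal.ofReal (fourierDensity f M u) ∧
      0 ≤ fourierDensity f M u := by
    filter_upwards [toReal_sumSqDensity_ae_eq hf hM0 hM, ae_sumSqDensity_lt_top hf hM0] with u h1 h2
    rw [← h1, ENNReal.ofReal_toReal h2.ne]
    exact ⟨rfl, ENNReal.toReal_nonneg⟩
  have hae' : ∀ᵐ x : ℝ, sumSqDensity f M (u - x ^ 2) = ENNReal.ofReal (fourierDensity f M (u - x ^ 2)) ∧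
      0 ≤ fourierDensity f M (u - x ^ 2) := by
    filter_upwards [volume_preimage_sub_sq (ae_iff.1 hae) u] with x hx
    simpa using hx
  have hnn : 0 ≤ᵐ[volume] fun x => f x * fourierDensity f M (u - x ^ 2) := by
    filter_upwards [hae'] with x hx
    exact mul_nonneg (hf.nonneg x) hx.2
  have hint : Integrable fun x => f x * fourierDensity f M (u - x ^ 2) := by
    refine hf.integrable.mul_bdd (Measurable.aestronglyMeasurable ?_)
      (Eventually.of_forall fun x => abs_fourierDensity_le hM (u - x ^ 2))
    have := measurable_fourierDensity hf M
    fun_prop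
  rw [fourierDensity_succ hf hM]
  refine ⟨integral_nonneg_of_ae hnn, ?_⟩
  rw [sumSqDensity_succ hf hM0, ofReal_integral_eq_lintegral_ofReal hint hnn]
  refine lintegral_congr_ae ?_
  filter_upwards [hae'] with x hx
  rw [hx.1, ENNReal.ofReal_mul (hf.nonneg x)]

open scoped FourierTransform in
/-- Away from `0` the characteristic function of `V²` is bounded away from `1`. -/
theorem exists_norm_sqCharFun_le {f : ℝ → ℝ} (hf : IsProbDensity f) {δ : ℝ} (hδ : 0 < δ) :
    ∃ ρ : ℝ, 0 < ρ ∧ ρ < 1 ∧ ∀ ξ, δ ≤ ξ → ‖sqCharFun f ξ‖ ≤ ρ := by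
  have hc := continuous_sqCharFun hf.integrable
  -- Riemann–Lebesgue for the integrable density of `V²` handles large `ξ`. On the remaining compact
  -- interval the strict bound `|φ| < 1` is attained at a maximum.
  have htend : Tendsto (sqCharFun f) atTop (𝓝 0) := by
    set g : ℝ → ℂ := fun u => ((sumSqDensity f 1 u).toReal : ℂ) with hg
    have hF : ∀ w, 𝓕 g (-(2 * Real.pi)⁻¹ * w) = sqCharFun f w := by
      intro w
      rw [Real.fourier_real_eq_integral_exp_smul, ← pow_one (sqCharFun f w),
        ← integral_sumSqDensity_mul_exp hf one_ne_zero]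
      congr 1
      ext v
      rw [smul_eq_mul, mul_comm]
      congr 2
      have : (Real.pi : ℂ) ≠ 0 := by exact_mod_cast Real.pi_ne_zero
      push_cast
      field_simp
    have h1 := Real.zero_at_infty_fourier g
    have h2 : Tendsto (fun w : ℝ => -(2 * Real.pi)⁻¹ * w) atTop (cocompact ℝ) :=
      (tendsto_id.const_mul_atTop_of_neg (by simp [Real.pi_pos])).mono_right atBot_le_cocompact
    exact (h1.comp h2).congr hF
  obtain ⟨R, hR⟩ := eventually_atTop.1
    ((tendsto_zero_iff_norm_tendsto_zero.1 htend).eventually (gt_mem_nhds (show (0 : ℝ) < 1 / 2 by norm_num)))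
  obtain ⟨ξ₀, hξ₀, hmax⟩ := (isCompact_Icc (a := δ) (b := max R δ)).exists_isMaxOn
    ⟨δ, le_rfl, le_max_right _ _⟩ hc.norm.continuousOn
  refine ⟨max ‖sqCharFun f ξ₀‖ (1 / 2), by positivity,
    max_lt (norm_sqCharFun_lt_one hf (by linarith [hξ₀.1])) (by norm_num), fun ξ hξ => ?_⟩
  rcases le_or_gt ξ (max R δ) with h | h
  · exact (hmax ⟨hξ, h⟩).trans (le_max_left _ _)
  · exact (hR ξ ((le_max_left _ _).trans h.le)).le.trans (le_max_right _ _)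

end density

/-! ### The limiting stable integral -/

section stable
open Complex

lemma norm_exp_neg_mul_rpow (c : ℂ) (α s : ℝ) :
    ‖cexp (-(c * (s ^ α : ℝ)))‖ = Real.exp (-c.re * s ^ α) := by
  rw [norm_exp, neg_re, re_mul_ofReal, neg_mul]

lemma integrableOn_exp_neg_mul_rpow {b α : ℝ} (hb : 0 < b) (hα : 0 < α) :
    IntegrableOn (fun s : ℝ => Real.exp (-b * s ^ α)) (Set.Ioi 0) := by
  simpa using integrableOn_rpow_mul_exp_neg_mul_rpow (s := 0) (by norm_num) hα hb

lemma differentiableAt_integral_exp_neg_mul_rpow {α : ℝ} (hα : 0 < α) {c : ℂ} (hc : 0 < c.re) :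
    DifferentiableAt ℂ (fun c : ℂ => ∫ s in Set.Ioi (0 : ℝ), cexp (-(c * (s ^ α : ℝ)))) c := by
  have hball : ∀ z ∈ Metric.ball c (c.re / 2), c.re / 2 ≤ z.re := by
    intro z hz
    have h1 : |(z - c).re| ≤ ‖z - c‖ := abs_re_le_norm _
    rw [Metric.mem_ball, dist_eq_norm] at hz
    rw [sub_re] at h1
    linarith [(abs_le.1 (h1.trans hz.le)).1]
  refine (hasDerivAt_integral_of_dominated_loc_of_deriv_le
    (F' := fun z s => cexp (-(z * (s ^ α : ℝ))) * -((s ^ α : ℝ) : ℂ))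
    (bound := fun s => s ^ α * Real.exp (-(c.re / 2) * s ^ α))
    (Metric.ball_mem_nhds c (half_pos hc)) ?_ ?_ ?_ ?_ ?_ ?_).2.differentiableAt
  · exact Eventually.of_forall fun z => Measurable.aestronglyMeasurable (by fun_prop)
  · refine (integrableOn_exp_neg_mul_rpow hc hα).mono' (Measurable.aestronglyMeasurable (by fun_prop))
      (Eventually.of_forall fun s => (norm_exp_neg_mul_rpow c α s).le)
  · exact Measurable.aestronglyMeasurable (by fun_prop)
  · filter_upwards [ae_restrict_mem measurableSet_Ioi] with s (hs : 0 < s) z hz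
    have := Real.rpow_nonneg hs.le α
    rw [norm_mul, norm_exp_neg_mul_rpow, norm_neg, norm_real, Real.norm_of_nonneg this, mul_comm]
    gcongr
    exact hball z hz
  · exact integrableOn_rpow_mul_exp_neg_mul_rpow (by linarith) hα (half_pos hc)
  · refine Eventually.of_forall fun s z _ => ?_
    have := ((hasDerivAt_id z).mul_const ((s ^ α : ℝ) : ℂ)).neg.cexp
    simpa using this

/-- Evaluation of `∫₀^∞ exp(-c s^α) ds` for complex `c`. -/
lemma integral_exp_neg_mul_rpow_complex {α : ℝ} (hα : 0 < α) {c : ℂ} (hc : 0 < c.re) :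
    ∫ s in Set.Ioi (0 : ℝ), cexp (-(c * (s ^ α : ℝ))) =
      c ^ (((-(1 / α) : ℝ)) : ℂ) * (∫ s in Set.Ioi (0 : ℝ), Real.exp (-s ^ α) : ℝ) := by
  set U : Set ℂ := {z | 0 < z.re}
  have hU : IsOpen U := isOpen_lt continuous_const continuous_re
  have hf : AnalyticOnNhd ℂ (fun c : ℂ => ∫ s in Set.Ioi (0 : ℝ), cexp (-(c * (s ^ α : ℝ)))) U :=
    DifferentiableOn.analyticOnNhd (fun z hz =>
      (differentiableAt_integral_exp_neg_mul_rpow hα hz).differentiableWithinAt) hU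
  have hg : AnalyticOnNhd ℂ (fun c : ℂ => c ^ (((-(1 / α) : ℝ)) : ℂ) *
      (∫ s in Set.Ioi (0 : ℝ), Real.exp (-s ^ α) : ℝ)) U := by
    refine DifferentiableOn.analyticOnNhd (fun z hz => DifferentiableAt.differentiableWithinAt ?_) hU
    refine DifferentiableAt.mul_const ?_ _
    exact differentiableAt_id.cpow_const (Or.inl hz)
  have hpre : IsPreconnected U := (convex_halfSpace_re_gt 0).isPreconnected
  -- Identity theorem on the right half-plane: both sides are holomorphic there, and for positive
  -- real `c` they agree by the scaling `s ↦ c^{1/α} s`.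
  refine hf.eqOn_of_preconnected_of_frequently_eq hg hpre (z₀ := 1) (by simp [U]) ?_ hc
  have htend : Tendsto (fun t : ℝ => (t : ℂ)) (𝓝[≠] 1) (𝓝[≠] 1) := by
    refine tendsto_nhdsWithin_iff.2 ⟨?_, ?_⟩
    · exact ((continuous_ofReal.tendsto' 1 1 ofReal_one)).mono_left nhdsWithin_le_nhds
    · filter_upwards [self_mem_nhdsWithin] with t ht
      simpa using ht
  refine htend.frequently (Eventually.frequently ?_)
  filter_upwards [nhdsWithin_le_nhds (lt_mem_nhds (zero_lt_one (α := ℝ)))] with x hx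
  have hx' : 0 < x ^ (1 / α) := Real.rpow_pos_of_pos hx _
  have h1 := integral_comp_mul_left_Ioi (fun s : ℝ => Real.exp (-s ^ α)) 0 hx'
  have h2 : ∫ s in Set.Ioi (0 : ℝ), cexp (-((x : ℂ) * (s ^ α : ℝ))) =
      ((∫ s in Set.Ioi (0 : ℝ), Real.exp (-(x ^ (1 / α) * s) ^ α) : ℝ) : ℂ) := by
    rw [← integral_complex_ofReal]
    refine setIntegral_congr_fun measurableSet_Ioi fun s (hs : 0 < s) => ?_
    rw [Real.mul_rpow hx'.le hs.le, ← Real.rpow_mul hx.le, one_div_mul_cancel hα.ne', Real.rpow_one]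
    push_cast
    rfl
  rw [h2, h1, mul_zero, smul_eq_mul, ofReal_mul, ← ofReal_cpow hx.le, Real.rpow_neg hx.le]

/-- The sign is that of `Re c^{-1/α}`, that is, of `cos(arg c / α)`; here `|arg c| < π/2` and `1/α ≤
1`. -/
lemma re_integral_exp_neg_mul_rpow_pos {α : ℝ} (hα : 1 < α) {c : ℂ} (hc : 0 < c.re) :
    0 < (∫ s in Set.Ioi (0 : ℝ), cexp (-(c * (s ^ α : ℝ)))).re := by
  have hα0 : 0 < α := by linarith
  rw [integral_exp_neg_mul_rpow_complex hα0 hc, re_mul_ofReal]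
  refine mul_pos ?_ ?_
  · have hc0 : c ≠ 0 := fun h => by simp [h] at hc
    rw [cpow_def_of_ne_zero hc0, exp_re]
    refine mul_pos (Real.exp_pos _) (Real.cos_pos_of_mem_Ioo ?_)
    rw [im_mul_ofReal, log_im, Set.mem_Ioo, ← abs_lt, abs_mul, abs_neg, abs_of_pos (one_div_pos.2 hα0)]
    have h1 : |arg c| < Real.pi / 2 := abs_arg_lt_pi_div_two_iff.2 (Or.inl hc)
    have h2 : 1 / α ≤ 1 := by rw [div_le_one hα0]; exact hα.le
    calc _ ≤ |arg c| * 1 := by gcongr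
      _ < _ := by linarith
  · have hi : IntegrableOn (fun s : ℝ => Real.exp (-s ^ α)) (Set.Ioi 0) := by
      simpa using integrableOn_exp_neg_mul_rpow (b := 1) one_pos hα0
    rw [setIntegral_pos_iff_support_of_nonneg_ae (Eventually.of_forall fun s => (Real.exp_pos _).le) hi]
    have : Function.support (fun s : ℝ => Real.exp (-s ^ α)) = Set.univ := by
      ext s; simp [(Real.exp_pos _).ne']
    rw [this, Set.univ_inter]
    simp

end stable

/-! ### The local limit theorem -/

section local_limit
open Complex

/-- Writing `φ e^{-iξ} = 1 + w ξ^α`, the squared modulus is `1 + ξ^α (2 Re w + |w|² ξ^α)`. The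
bracket tends to `-2 Re c`, so it is eventually below `-Re c`, and `1 + y ≤ e^y` yields `b = Re c /
2`. -/
lemma exists_norm_sqCharFun_le_exp {f : ℝ → ℝ} {c : ℂ} {α : ℝ} (hα : 0 < α) (hc : 0 < c.re)
    (h : Tendsto (fun ξ : ℝ => (sqCharFun f ξ * cexp (-(ξ * I)) - 1) / ((ξ ^ α : ℝ) : ℂ))
      (𝓝[>] 0) (𝓝 (-c))) :
    ∃ b δ : ℝ, 0 < b ∧ 0 < δ ∧ ∀ ξ, 0 < ξ → ξ ≤ δ → ‖sqCharFun f ξ‖ ≤ Real.exp (-b * ξ ^ α) := by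
  set w : ℝ → ℂ := fun ξ => (sqCharFun f ξ * cexp (-(ξ * I)) - 1) / ((ξ ^ α : ℝ) : ℂ) with hw
  have hpow : Tendsto (fun ξ : ℝ => ξ ^ α) (𝓝[>] 0) (𝓝 0) := by
    have := (Real.continuousAt_rpow_const 0 α (Or.inr hα.le)).tendsto
    rw [Real.zero_rpow hα.ne'] at this
    exact this.mono_left nhdsWithin_le_nhds
  have h1 : Tendsto (fun ξ => 2 * (w ξ).re + ‖w ξ‖ ^ 2 * ξ ^ α) (𝓝[>] 0) (𝓝 (2 * (-c).re + ‖-c‖ ^ 2 * 0)) :=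
    (((continuous_re.tendsto _).comp h).const_mul 2).add ((h.norm.pow 2).mul hpow)
  have h2 := h1.eventually (gt_mem_nhds (show 2 * (-c).re + ‖-c‖ ^ 2 * 0 < -c.re by
    rw [neg_re]; linarith))
  obtain ⟨δ, hδ, hδ'⟩ := mem_nhdsGT_iff_exists_Ioc_subset.1 h2
  refine ⟨c.re / 2, δ, half_pos hc, hδ, fun ξ hξ hξδ => ?_⟩
  have h3 : 2 * (w ξ).re + ‖w ξ‖ ^ 2 * ξ ^ α < -c.re := hδ' ⟨hξ, hξδ⟩
  have hp := Real.rpow_pos_of_pos hξ α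
  have hp' : ((ξ ^ α : ℝ) : ℂ) ≠ 0 := by exact_mod_cast hp.ne'
  have h4 : sqCharFun f ξ * cexp (-(ξ * I)) = 1 + w ξ * (ξ ^ α : ℝ) := by
    rw [hw]; field_simp; ring
  have h5 : ‖sqCharFun f ξ‖ ^ 2 = 1 + ξ ^ α * (2 * (w ξ).re + ‖w ξ‖ ^ 2 * ξ ^ α) := by
    have h6 : ‖sqCharFun f ξ‖ = ‖sqCharFun f ξ * cexp (-(ξ * I))‖ := by
      have := norm_exp_neg_mul_I ξ 1
      rw [ofReal_one, mul_one] at this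
      rw [norm_mul, this, mul_one]
    rw [h6, h4, ← normSq_eq_norm_sq, ← normSq_eq_norm_sq, normSq_apply, normSq_apply]
    simp only [add_re, one_re, re_mul_ofReal, add_im, one_im, im_mul_ofReal]
    ring
  have h7 : ‖sqCharFun f ξ‖ ^ 2 ≤ Real.exp (-(c.re / 2) * ξ ^ α) ^ 2 := by
    rw [h5, ← Real.exp_nat_mul]
    have := Real.add_one_le_exp (((2 : ℕ) : ℝ) * (-(c.re / 2) * ξ ^ α))
    push_cast at this ⊢
    nlinarith
  exact (pow_le_pow_iff_left₀ (norm_nonneg _) (Real.exp_pos _).le two_ne_zero).1 h7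

/-- The contribution of frequencies above `δ` is negligible. -/
lemma tendsto_tail {f : ℝ → ℝ} (hf : IsProbDensity f) {n₀ : ℕ}
    (hn₀ : Integrable fun ξ => sqCharFun f ξ ^ n₀) {α δ : ℝ} (hα : 1 < α) (hδ : 0 < δ) :
    Tendsto (fun M : ℕ => (M : ℝ) ^ (1 / α) * ∫ ξ in Set.Ioi δ, ‖sqCharFun f ξ‖ ^ M) atTop (𝓝 0) := by
  obtain ⟨ρ, hρ0, hρ1, hρ⟩ := exists_norm_sqCharFun_le hf hδ
  have hn : Integrable fun ξ => ‖sqCharFun f ξ‖ ^ n₀ := by simpa using hn₀.norm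
  set J := ∫ ξ in Set.Ioi δ, ‖sqCharFun f ξ‖ ^ n₀
  have hJ : 0 ≤ J := integral_nonneg fun ξ => by positivity
  -- Beyond `δ`, `|φ|^M ≤ ρ^{M-n₀} |φ|^{n₀}`; the geometric decay beats `M^{1/α} ≤ M`.
  have h1 : Tendsto (fun M : ℕ => (M : ℝ) ^ 1 * ρ ^ M * (ρ ^ n₀)⁻¹ * J) atTop (𝓝 0) := by
    have := tendsto_pow_const_mul_const_pow_of_abs_lt_one 1 (r := ρ) (by rwa [abs_of_pos hρ0])
    simpa using (this.mul_const (ρ ^ n₀)⁻¹).mul_const J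
  refine squeeze_zero' (Eventually.of_forall fun M => by positivity) ?_ h1
  filter_upwards [eventually_ge_atTop n₀, eventually_ge_atTop 1] with M hM hM1
  have hM1' : (1 : ℝ) ≤ M := by exact_mod_cast hM1
  have h2 : (M : ℝ) ^ (1 / α) ≤ (M : ℝ) ^ 1 := by
    rw [pow_one]
    conv_rhs => rw [← Real.rpow_one (M : ℝ)]
    refine Real.rpow_le_rpow_of_exponent_le hM1' ?_
    rw [div_le_one (by linarith)]; exact hα.le
  have h3 : ∫ ξ in Set.Ioi δ, ‖sqCharFun f ξ‖ ^ M ≤ ρ ^ M * (ρ ^ n₀)⁻¹ * J := by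
    rw [← integral_const_mul]
    refine setIntegral_mono_on ?_ (hn.integrableOn.const_mul _) measurableSet_Ioi fun ξ hξ => ?_
    · have hc := continuous_sqCharFun hf.integrable
      refine (hn.mono' (by fun_prop) (Eventually.of_forall fun ξ => ?_)).integrableOn
      rw [norm_pow, norm_norm]
      exact pow_le_pow_of_le_one (norm_nonneg _) (norm_sqCharFun_le_one hf ξ) hM
    · rw [show M = (M - n₀) + n₀ by omega, pow_add, pow_add, mul_inv_cancel_right₀ (by positivity)]
      gcongr
      exact hρ ξ (le_of_lt hξ)
  calc _ ≤ (M : ℝ) ^ 1 * (ρ ^ M * (ρ ^ n₀)⁻¹ * J) := by gcongr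
    _ = _ := by ring

lemma integrable_norm_sqCharFun_pow {f : ℝ → ℝ} {M : ℕ} (hM : Integrable fun ξ => sqCharFun f ξ ^ M) :
    Integrable fun ξ => ‖sqCharFun f ξ‖ ^ M := by simpa using hM.norm

lemma mul_integral_comp_div {a : ℝ} (ha : 0 < a) (g : ℝ → ℝ) :
    a * ∫ ξ in Set.Ioi (0 : ℝ), g ξ = ∫ η in Set.Ioi (0 : ℝ), g (η / a) := by
  have := integral_comp_mul_left_Ioi g 0 (inv_pos.2 ha)
  simp only [mul_zero, inv_inv, smul_eq_mul] at this
  rw [← this]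
  simp_rw [div_eq_inv_mul]

lemma natCast_mul_div_rpow {α : ℝ} (hα : 0 < α) {M : ℕ} {η : ℝ} (hM : M ≠ 0) (hη : 0 ≤ η) :
    (M : ℝ) * (η / (M : ℝ) ^ (1 / α)) ^ α = η ^ α := by
  have hM0 : (0 : ℝ) < M := by exact_mod_cast Nat.pos_of_ne_zero hM
  rw [Real.div_rpow hη (by positivity), ← Real.rpow_mul hM0.le, one_div_mul_cancel hα.ne', Real.rpow_one]
  field_simp

/-- For `ξ = η M^{-1/α}` one has `M ξ^α = η^α`, so the low-frequency part has a dominating function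
independent of `M`. -/
lemma indicator_norm_pow_le {f : ℝ → ℝ} {b δ α : ℝ} (hα : 0 < α)
    (hb : ∀ ξ, 0 < ξ → ξ ≤ δ → ‖sqCharFun f ξ‖ ≤ Real.exp (-b * ξ ^ α)) {M : ℕ} (hM : M ≠ 0)
    {η : ℝ} (hη : 0 < η) :
    (Set.Ioc 0 δ).indicator (fun ξ => ‖sqCharFun f ξ‖ ^ M) (η / (M : ℝ) ^ (1 / α)) ≤
      Real.exp (-b * η ^ α) := by
  have hM0 : (0 : ℝ) < M := by exact_mod_cast Nat.pos_of_ne_zero hM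
  by_cases h : η / (M : ℝ) ^ (1 / α) ∈ Set.Ioc 0 δ
  · rw [Set.indicator_of_mem h]
    calc _ ≤ Real.exp (-b * (η / (M : ℝ) ^ (1 / α)) ^ α) ^ M := by
          gcongr
          exact hb _ h.1 h.2
      _ = _ := by
          rw [← Real.exp_nat_mul, ← natCast_mul_div_rpow hα hM hη.le]
          ring_nf
  · rw [Set.indicator_of_notMem h]
    positivity

lemma setIntegral_Ioi_split {δ : ℝ} (hδ : 0 < δ) {g : ℝ → ℝ} (hg : Integrable g) :
    ∫ ξ in Set.Ioi (0 : ℝ), g ξ =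
      (∫ ξ in Set.Ioi (0 : ℝ), (Set.Ioc 0 δ).indicator g ξ) + ∫ ξ in Set.Ioi δ, g ξ := by
  rw [setIntegral_indicator measurableSet_Ioc, Set.inter_eq_right.2 Set.Ioc_subset_Ioi_self,
    ← setIntegral_union (Set.Ioc_disjoint_Ioi le_rfl) measurableSet_Ioi hg.integrableOn
      hg.integrableOn, Set.Ioc_union_Ioi_eq_Ioi hδ.le]

/-- Uniform bound in the local limit theorem. -/
theorem exists_fourierDensity_le {f : ℝ → ℝ} (hf : IsProbDensity f) {n₀ : ℕ}
    (hn₀ : ∀ N ≥ n₀, Integrable fun ξ => sqCharFun f ξ ^ N) {c : ℂ} {α : ℝ} (hα : 1 < α)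
    (hc : 0 < c.re)
    (h : Tendsto (fun ξ : ℝ => (sqCharFun f ξ * cexp (-(ξ * I)) - 1) / ((ξ ^ α : ℝ) : ℂ))
      (𝓝[>] 0) (𝓝 (-c))) :
    ∃ D : ℝ, ∀ᶠ M : ℕ in atTop, ∀ u, (M : ℝ) ^ (1 / α) * |fourierDensity f M u| ≤ D := by
  have hα0 : 0 < α := by linarith
  obtain ⟨b, δ, hb, hδ, hbδ⟩ := exists_norm_sqCharFun_le_exp hα0 hc h
  set J := ∫ η in Set.Ioi (0 : ℝ), Real.exp (-b * η ^ α)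
  refine ⟨Real.pi⁻¹ * (J + 1), ?_⟩
  filter_upwards [(tendsto_tail hf (hn₀ n₀ le_rfl) hα hδ).eventually (gt_mem_nhds one_pos),
    eventually_ge_atTop n₀, eventually_ge_atTop 1] with M htail hM hM1 u
  have hM0 : (0 : ℝ) < M := by exact_mod_cast hM1
  have ha : 0 < (M : ℝ) ^ (1 / α) := Real.rpow_pos_of_pos hM0 _
  have hi := integrable_norm_sqCharFun_pow (hn₀ M hM)
  calc _ ≤ (M : ℝ) ^ (1 / α) * (Real.pi⁻¹ * ∫ ξ in Set.Ioi (0 : ℝ), ‖sqCharFun f ξ‖ ^ M) := by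
        gcongr
        exact abs_fourierDensity_le (hn₀ M hM) u
    _ = Real.pi⁻¹ * ((∫ η in Set.Ioi (0 : ℝ), (Set.Ioc 0 δ).indicator
          (fun ξ => ‖sqCharFun f ξ‖ ^ M) (η / (M : ℝ) ^ (1 / α))) +
          (M : ℝ) ^ (1 / α) * ∫ ξ in Set.Ioi δ, ‖sqCharFun f ξ‖ ^ M) := by
        rw [setIntegral_Ioi_split hδ hi, ← mul_integral_comp_div ha]
        ring
    _ ≤ _ := by
        gcongr
        refine setIntegral_mono_on ?_ (integrableOn_exp_neg_mul_rpow hb hα0) measurableSet_Ioi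
          fun η hη => indicator_norm_pow_le hα0 hbδ (by omega) hη
        exact ((hi.indicator measurableSet_Ioc).comp_div ha.ne').integrableOn

/-- The local limit theorem, at a bounded distance from the mean. -/
theorem tendsto_fourierDensity {f : ℝ → ℝ} (hf : IsProbDensity f) {n₀ : ℕ}
    (hn₀ : ∀ N ≥ n₀, Integrable fun ξ => sqCharFun f ξ ^ N) {c : ℂ} {α : ℝ} (hα : 1 < α)
    (hc : 0 < c.re)
    (h : Tendsto (fun ξ : ℝ => (sqCharFun f ξ * cexp (-(ξ * I)) - 1) / ((ξ ^ α : ℝ) : ℂ))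
      (𝓝[>] 0) (𝓝 (-c))) (t : ℝ) :
    Tendsto (fun M : ℕ => (M : ℝ) ^ (1 / α) * fourierDensity f M (M + t)) atTop
      (𝓝 (Real.pi⁻¹ * (∫ s in Set.Ioi (0 : ℝ), cexp (-(c * (s ^ α : ℝ)))).re)) := by
  have hα0 : 0 < α := by linarith
  have hcont := continuous_sqCharFun hf.integrable
  obtain ⟨b, δ, hb, hδ, hbδ⟩ := exists_norm_sqCharFun_le_exp hα0 hc h
  set H : ℕ → ℝ → ℝ := fun M ξ => (sqCharFun f ξ ^ M * cexp (-(ξ * ((M + t : ℝ) : ℂ) * I))).re with hH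
  have hHm : ∀ M, Measurable (H M) := fun M => by simp only [hH]; fun_prop
  have hHle : ∀ M ξ, |H M ξ| ≤ ‖sqCharFun f ξ‖ ^ M := fun M ξ => abs_re_le_norm_pow f M _ ξ
  have hHi : ∀ M ≥ n₀, Integrable (H M) := fun M hM => (integrable_sqCharFun_pow_mul (hn₀ M hM) _).re
  have hlim_re : (∫ s in Set.Ioi (0 : ℝ), cexp (-(c * (s ^ α : ℝ)))).re =
      ∫ s in Set.Ioi (0 : ℝ), (cexp (-(c * (s ^ α : ℝ)))).re := by
    have hi : IntegrableOn (fun s : ℝ => cexp (-(c * (s ^ α : ℝ)))) (Set.Ioi 0) :=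
      (integrableOn_exp_neg_mul_rpow hc hα0).mono' (Measurable.aestronglyMeasurable (by fun_prop))
        (Eventually.of_forall fun s => (norm_exp_neg_mul_rpow c α s).le)
    exact (reCLM.integral_comp_comm hi).symm
  -- After rescaling, the integrand is the real part of `(φ e^{-iξ})^M e^{-iξt}` with `ξ = η
  -- M^{-1/α} → 0`. The first factor tends to `exp(-c η^α)` by the expansion, and the second to `1`,
  -- so `t` disappears from the limit.
  have hmain : Tendsto (fun M : ℕ => ∫ η in Set.Ioi (0 : ℝ),
      (Set.Ioc 0 δ).indicator (H M) (η / (M : ℝ) ^ (1 / α))) atTop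
      (𝓝 (∫ s in Set.Ioi (0 : ℝ), (cexp (-(c * (s ^ α : ℝ)))).re)) := by
    refine tendsto_integral_filter_of_dominated_convergence (fun η => Real.exp (-b * η ^ α)) ?_ ?_
      (integrableOn_exp_neg_mul_rpow hb hα0) ?_
    · refine Eventually.of_forall fun M => Measurable.aestronglyMeasurable ?_
      exact ((hHm M).indicator measurableSet_Ioc).comp (by fun_prop)
    · filter_upwards [eventually_ge_atTop 1] with M hM
      filter_upwards [ae_restrict_mem measurableSet_Ioi] with η (hη : 0 < η)
      refine le_trans ?_ (indicator_norm_pow_le hα0 hbδ (by omega : M ≠ 0) hη)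
      rw [norm_indicator_eq_indicator_norm]
      exact Set.indicator_le_indicator (hHle M _)
    · filter_upwards [ae_restrict_mem measurableSet_Ioi] with η (hη : 0 < η)
      have hap : Tendsto (fun M : ℕ => (M : ℝ) ^ (1 / α)) atTop atTop :=
        (tendsto_rpow_atTop (one_div_pos.2 hα0)).comp tendsto_natCast_atTop_atTop
      have hx0 : Tendsto (fun M : ℕ => η / (M : ℝ) ^ (1 / α)) atTop (𝓝 0) := hap.const_div_atTop η
      have hxpos : ∀ᶠ M : ℕ in atTop, 0 < η / (M : ℝ) ^ (1 / α) := by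
        filter_upwards [hap.eventually_gt_atTop 0] with M hM
        positivity
      have hx : Tendsto (fun M : ℕ => η / (M : ℝ) ^ (1 / α)) atTop (𝓝[>] 0) :=
        tendsto_nhdsWithin_iff.2 ⟨hx0, hxpos⟩
      have hg : Tendsto (fun M : ℕ => (M : ℂ) *
          (sqCharFun f (η / (M : ℝ) ^ (1 / α)) * cexp (-(((η / (M : ℝ) ^ (1 / α) : ℝ) : ℂ) * I)) - 1))
          atTop (𝓝 (-c * (η ^ α : ℝ))) := by
        refine ((h.comp hx).mul_const ((η ^ α : ℝ) : ℂ)).congr' ?_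
        filter_upwards [eventually_ge_atTop 1, hxpos] with M hM hpos
        have hp := Real.rpow_pos_of_pos hpos α
        have hp' : (((η / (M : ℝ) ^ (1 / α)) ^ α : ℝ) : ℂ) ≠ 0 := by exact_mod_cast hp.ne'
        rw [← natCast_mul_div_rpow hα0 (by omega : M ≠ 0) hη.le, Function.comp_apply, ofReal_mul,
          ofReal_natCast]
        field_simp
      have hpow := tendsto_one_add_pow_exp_of_tendsto hg
      have hexp : Tendsto (fun M : ℕ => cexp (-(((η / (M : ℝ) ^ (1 / α) : ℝ) : ℂ) * t * I))) atTop (𝓝 1) := by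
        have : Continuous fun x : ℝ => cexp (-((x : ℂ) * t * I)) := by fun_prop
        have h0 := this.tendsto 0
        simp only [ofReal_zero, zero_mul, neg_zero, Complex.exp_zero] at h0
        exact h0.comp hx0
      have hprod := (continuous_re.tendsto _).comp (hpow.mul hexp)
      rw [mul_one, neg_mul] at hprod
      refine hprod.congr' ?_
      filter_upwards [hx (Ioc_mem_nhdsGT hδ)] with M (hM : η / (M : ℝ) ^ (1 / α) ∈ Set.Ioc 0 δ)
      rw [Set.indicator_of_mem hM, Function.comp_apply, hH]
      simp only
      congr 1
      rw [add_sub_cancel, mul_pow, mul_assoc, ← exp_nat_mul, ← exp_add]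
      congr 2
      push_cast
      ring
  have htail : Tendsto (fun M : ℕ => (M : ℝ) ^ (1 / α) * ∫ ξ in Set.Ioi δ, H M ξ) atTop (𝓝 0) := by
    refine squeeze_zero_norm' ?_ (tendsto_tail hf (hn₀ n₀ le_rfl) hα hδ)
    filter_upwards [eventually_ge_atTop n₀] with M hM
    rw [norm_mul, Real.norm_of_nonneg (by positivity)]
    gcongr
    refine (norm_integral_le_integral_norm _).trans ?_
    exact integral_mono (hHi M hM).norm.integrableOn
      (integrable_norm_sqCharFun_pow (hn₀ M hM)).integrableOn fun ξ => hHle M ξ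
  have hsum := (hmain.add htail).const_mul Real.pi⁻¹
  rw [add_zero, ← hlim_re] at hsum
  refine hsum.congr' ?_
  filter_upwards [eventually_ge_atTop n₀, eventually_ge_atTop 1] with M hM hM1
  have hM0 : (0 : ℝ) < M := by exact_mod_cast hM1
  have ha : 0 < (M : ℝ) ^ (1 / α) := Real.rpow_pos_of_pos hM0 _
  rw [← mul_integral_comp_div ha, ← mul_add, ← setIntegral_Ioi_split hδ (hHi M hM), fourierDensity]
  ring

end local_limit

/-! ### Integrability of the entropy and Stirling bounds -/

section entropy_estimates

/-- Three regions: for `f ≥ 1`, `log f ≤ f^{q-1}/(q-1)`; for `e^{-x²} ≤ f < 1`, `|log f| ≤ x²`; for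
`0 < f < e^{-x²}`, `f |log f| ≤ 2 √f ≤ 2 e^{-x²/2}`. Each bound is integrable. -/
lemma integrable_mul_log {f : ℝ → ℝ} (hf : IsProbDensity f) {p : ℝ≥0∞} (hp : 1 < p)
    (hfp : MemLp f p volume) (hmoment : ∫ x : ℝ, x ^ 2 * f x = 1) :
    Integrable fun x => f x * Real.log (f x) := by
  obtain ⟨q, hq, -, hfq⟩ := exists_rpow_integrable hf hp hfp
  have hfm := hf.measurable
  have hgauss : Integrable fun x : ℝ => 2 * Real.exp (-(1 / 2) * x ^ 2) :=
    (integrable_exp_neg_mul_sq (by norm_num)).const_mul 2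
  refine (((hfq.div_const (q - 1)).add (integrable_sq_mul hmoment)).add hgauss).mono'
    (Measurable.aestronglyMeasurable (by fun_prop)) (Eventually.of_forall fun x => ?_)
  simp only [Pi.add_apply]
  have h0 := hf.nonneg x
  have hq1 : 0 < q - 1 := by linarith
  have t1 : 0 ≤ f x ^ q / (q - 1) := div_nonneg (Real.rpow_nonneg h0 _) hq1.le
  have t2 : 0 ≤ x ^ 2 * f x := by positivity
  have t3 : 0 ≤ 2 * Real.exp (-(1 / 2) * x ^ 2) := by positivity
  rw [norm_mul, Real.norm_of_nonneg h0, Real.norm_eq_abs]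
  rcases h0.eq_or_lt with h | hpos
  · rw [← h, zero_mul]
    rw [← h] at t1 t2
    linarith
  rcases le_or_gt 1 (f x) with h1 | h1
  · rw [abs_of_nonneg (Real.log_nonneg h1)]
    have := Real.log_le_rpow_div h0 hq1
    have h2 : f x * Real.log (f x) ≤ f x ^ q / (q - 1) := by
      calc _ ≤ f x * (f x ^ (q - 1) / (q - 1)) := by gcongr
        _ = _ := by
          rw [← mul_div_assoc]
          congr 1
          nth_rewrite 1 [← Real.rpow_one (f x)]
          rw [← Real.rpow_add hpos]; congr 1; ring
    linarith
  · rw [abs_of_neg (Real.log_neg hpos h1), ← Real.log_inv]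
    rcases le_or_gt (Real.exp (-x ^ 2)) (f x) with h2 | h2
    · have h3 : Real.log (f x)⁻¹ ≤ x ^ 2 := by
        rw [Real.log_inv, neg_le, ← Real.log_exp (-x ^ 2)]
        exact Real.log_le_log (Real.exp_pos _) h2
      nlinarith
    · have h3 := Real.log_le_rpow_div (inv_nonneg.2 h0) (show (0 : ℝ) < 1 / 2 by norm_num)
      have h4 : f x * Real.log (f x)⁻¹ ≤ 2 * f x ^ (1 / 2 : ℝ) := by
        calc _ ≤ f x * ((f x)⁻¹ ^ (1 / 2 : ℝ) / (1 / 2)) := by gcongr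
          _ = 2 * (f x ^ (1 : ℝ) * f x ^ (-(1 / 2) : ℝ)) := by
            rw [Real.inv_rpow h0, ← Real.rpow_neg h0, Real.rpow_one]; ring
          _ = _ := by rw [← Real.rpow_add hpos]; norm_num
      have h5 : f x ^ (1 / 2 : ℝ) ≤ Real.exp (-(1 / 2) * x ^ 2) := by
        calc _ ≤ Real.exp (-x ^ 2) ^ (1 / 2 : ℝ) := by gcongr
          _ = _ := by rw [← Real.exp_mul]; congr 1; ring
      linarith

lemma mul_log_div_gaussian (y x : ℝ) :
    y * Real.log (y / ProbabilityTheory.gaussianPDFReal 0 1 x) =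
      y * Real.log y + Real.log (2 * Real.pi) / 2 * y + 1 / 2 * (x ^ 2 * y) := by
  rcases eq_or_ne y 0 with rfl | hy
  · simp
  · have hpos : 0 < ProbabilityTheory.gaussianPDFReal 0 1 x :=
      ProbabilityTheory.gaussianPDFReal_pos 0 1 x one_ne_zero
    rw [Real.log_div hy hpos.ne', ProbabilityTheory.gaussianPDFReal,
      Real.log_mul (by positivity) (Real.exp_pos _).ne', Real.log_exp, Real.log_inv,
      Real.log_sqrt (by positivity)]
    simp
    ring

lemma integrable_mul_log_div_gaussian {f : ℝ → ℝ} (hf : IsProbDensity f) {p : ℝ≥0∞} (hp : 1 < p)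
    (hfp : MemLp f p volume) (hmoment : ∫ x : ℝ, x ^ 2 * f x = 1) :
    Integrable fun x => f x * Real.log (f x / ProbabilityTheory.gaussianPDFReal 0 1 x) := by
  simp_rw [mul_log_div_gaussian]
  exact ((integrable_mul_log hf hp hfp hmoment).add (hf.integrable.const_mul _)).add
    ((integrable_sq_mul hmoment).const_mul _)

lemma gaussianRelEntropy_eq {f : ℝ → ℝ} (hf : IsProbDensity f) {p : ℝ≥0∞} (hp : 1 < p)
    (hfp : MemLp f p volume) (hmoment : ∫ x : ℝ, x ^ 2 * f x = 1) :
    gaussianRelEntropy f = (∫ x, f x * Real.log (f x)) + (Real.log (2 * Real.pi) / 2 + 1 / 2) := by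
  have h1 := integrable_mul_log hf hp hfp hmoment
  have h2 := hf.integrable.const_mul (Real.log (2 * Real.pi) / 2)
  have h3 := (integrable_sq_mul hmoment).const_mul (1 / 2 : ℝ)
  unfold gaussianRelEntropy
  simp_rw [mul_log_div_gaussian]
  have h4 := integral_add (h1.add h2) h3
  simp only [Pi.add_apply] at h4
  rw [h4, integral_add h1 h2, integral_const_mul, integral_const_mul, hf.integral_eq_one, hmoment]
  ring

/-- Only the part of the Gamma integral over `(x, x + 1]` is kept, where the integrand is at least
`e^{-(x+1)} x^x`. -/
lemma log_Gamma_add_one_ge {x : ℝ} (hx : 0 < x) :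
    x * Real.log x - x - 1 ≤ Real.log (Real.Gamma (x + 1)) := by
  have hG : 0 < Real.Gamma (x + 1) := Real.Gamma_pos_of_pos (by linarith)
  rw [Real.le_log_iff_exp_le hG, Real.Gamma_eq_integral (by linarith)]
  have hconv := Real.GammaIntegral_convergent (s := x + 1) (by linarith)
  have hsub : Set.Ioc x (x + 1) ⊆ Set.Ioi (0 : ℝ) := fun t ht => hx.trans ht.1
  calc Real.exp (x * Real.log x - x - 1) = ∫ t in Set.Ioc x (x + 1), Real.exp (x * Real.log x - x - 1) := by
        simp
    _ ≤ ∫ t in Set.Ioc x (x + 1), Real.exp (-t) * t ^ (x + 1 - 1) := by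
        refine setIntegral_mono_on (by simp) (hconv.mono_set hsub) measurableSet_Ioc fun t ht => ?_
        have ht0 : 0 < t := hx.trans ht.1
        rw [add_sub_cancel_right, Real.rpow_def_of_pos ht0, ← Real.exp_add]
        refine Real.exp_le_exp.2 ?_
        have := Real.log_le_log hx ht.1.le
        nlinarith [ht.2]
    _ ≤ _ := by
        refine setIntegral_mono_set hconv ?_ hsub.eventuallyLE
        filter_upwards [ae_restrict_mem measurableSet_Ioi] with t (ht : 0 < t)
        simp only [Pi.zero_apply]
        positivity

/-- The inequality `log y ≤ y - 1` at `y = t(1 - 1/x)/x` bounds `t^x e^{-t}` by `e^{x log x - x + 2}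
e^{-t/x}`. The remaining integral equals `x` and costs `log x`, harmless after division by `x`. -/
lemma log_Gamma_add_one_le {x : ℝ} (hx : 2 ≤ x) :
    Real.log (Real.Gamma (x + 1)) ≤ x * Real.log x - x + 2 + Real.log x := by
  have hx0 : 0 < x := by linarith
  have hG : 0 < Real.Gamma (x + 1) := Real.Gamma_pos_of_pos (by linarith)
  rw [Real.log_le_iff_le_exp hG, Real.Gamma_eq_integral (by linarith)]
  have hconv := Real.GammaIntegral_convergent (s := x + 1) (by linarith)
  have hi : IntegrableOn (fun t : ℝ => Real.exp (x * Real.log x - x + 2) * Real.exp (-x⁻¹ * t))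
      (Set.Ioi 0) := (integrableOn_exp_mul_Ioi (by simpa using hx0) 0).const_mul _
  calc _ ≤ ∫ t in Set.Ioi (0 : ℝ), Real.exp (x * Real.log x - x + 2) * Real.exp (-x⁻¹ * t) := by
        refine setIntegral_mono_on hconv hi measurableSet_Ioi fun t (ht : 0 < t) => ?_
        rw [add_sub_cancel_right, Real.rpow_def_of_pos ht, ← Real.exp_add, ← Real.exp_add]
        refine Real.exp_le_exp.2 ?_
        have hθ : 0 < 1 - x⁻¹ := by
          have : x⁻¹ < 1 := inv_lt_one_of_one_lt₀ (by linarith)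
          linarith
        have h1 := Real.log_le_sub_one_of_pos (show 0 < t * (1 - x⁻¹) / x by positivity)
        rw [Real.log_div (by positivity) hx0.ne', Real.log_mul ht.ne' hθ.ne'] at h1
        have h2 : -Real.log (1 - x⁻¹) ≤ 2 / x := by
          rw [← Real.log_inv]
          refine (Real.log_le_sub_one_of_pos (by positivity)).trans ?_
          have hx1 : 0 < x - 1 := by linarith
          rw [show (1 - x⁻¹)⁻¹ - 1 = 1 / (x - 1) by field_simp; ring, div_le_div_iff₀ hx1 hx0]
          linarith
        have h3 : x * Real.log t ≤ x * (t * (1 - x⁻¹) / x - 1 - Real.log (1 - x⁻¹) + Real.log x) := by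
          gcongr; linarith
        have h4 : x * (-Real.log (1 - x⁻¹)) ≤ x * (2 / x) := by gcongr
        have h5 : x * (2 / x) = 2 := by field_simp
        have h6 : x * (t * (1 - x⁻¹) / x - 1 - Real.log (1 - x⁻¹) + Real.log x) =
            t - x⁻¹ * t - x + x * (-Real.log (1 - x⁻¹)) + x * Real.log x := by
          field_simp
          ring
        nlinarith
    _ = Real.exp (x * Real.log x - x + 2) * x := by
        rw [integral_const_mul, integral_exp_mul_Ioi (by simpa using hx0)]
        simp
    _ = _ := by rw [Real.exp_add _ (Real.log x), Real.exp_log hx0]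

lemma tendsto_log_Gamma_div :
    Tendsto (fun x : ℝ => (Real.log (Real.Gamma (x + 1)) - x * Real.log x) / x) atTop (𝓝 (-1)) := by
  have hlog : Tendsto (fun x : ℝ => Real.log x / x) atTop (𝓝 0) :=
    Real.isLittleO_log_id_atTop.tendsto_div_nhds_zero
  have h1 : Tendsto (fun x : ℝ => -1 - x⁻¹) atTop (𝓝 (-1)) := by
    simpa using tendsto_inv_atTop_zero.const_sub (-1 : ℝ)
  have h2 : Tendsto (fun x : ℝ => -1 + 2 * x⁻¹ + Real.log x / x) atTop (𝓝 (-1)) := by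
    simpa using ((tendsto_inv_atTop_zero.const_mul (2 : ℝ)).const_add (-1 : ℝ)).add hlog
  refine tendsto_of_tendsto_of_tendsto_of_le_of_le' h1 h2 ?_ ?_
  · filter_upwards [eventually_gt_atTop 0] with x hx
    rw [le_div_iff₀ hx]
    have := log_Gamma_add_one_ge hx
    have h : (-1 - x⁻¹) * x = -x - 1 := by field_simp
    linarith
  · filter_upwards [eventually_ge_atTop 2] with x hx
    have hx0 : 0 < x := by linarith
    rw [div_le_iff₀ hx0]
    have := log_Gamma_add_one_le hx
    have h : (-1 + 2 * x⁻¹ + Real.log x / x) * x = -x + 2 + Real.log x := by field_simp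
    linarith

end entropy_estimates

/-! ### The geometric constant and ratios of densities -/

/-- The factor relating `sphereSlice` on Kac's sphere to the uniform measure. -/
def kacFactor (N : ℕ) : ℝ≥0∞ :=
  ENNReal.ofReal ((N : ℝ) ^ (((N : ℝ) - 2) / 2) / 2) * unitSphereMeasure N Set.univ

lemma unitSphereMeasure_univ {N : ℕ} (hN : N ≠ 0) :
    unitSphereMeasure N Set.univ =
      ENNReal.ofReal (N * (Real.sqrt Real.pi ^ N / Real.Gamma (N / 2 + 1))) := by
  have : Nonempty (Fin N) := Fin.pos_iff_nonempty.1 (Nat.pos_of_ne_zero hN)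
  rw [unitSphereMeasure, Measure.toSphere_apply_univ, EuclideanSpace.volume_ball]
  simp [ENNReal.ofReal_mul]

lemma kacFactor_eq {N : ℕ} (hN : N ≠ 0) :
    kacFactor N = ENNReal.ofReal ((N : ℝ) ^ (((N : ℝ) - 2) / 2) / 2 *
      (N * (Real.sqrt Real.pi ^ N / Real.Gamma (N / 2 + 1)))) := by
  rw [kacFactor, unitSphereMeasure_univ hN, ← ENNReal.ofReal_mul (by positivity)]

lemma kacFactor_pos {N : ℕ} (hN : N ≠ 0) :
    0 < (N : ℝ) ^ (((N : ℝ) - 2) / 2) / 2 * (N * (Real.sqrt Real.pi ^ N / Real.Gamma (N / 2 + 1))) := by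
  have hN0 : (0 : ℝ) < N := by exact_mod_cast Nat.pos_of_ne_zero hN
  have := Real.Gamma_pos_of_pos (show (0 : ℝ) < N / 2 + 1 by positivity)
  positivity

lemma kacFactor_toReal_pos {N : ℕ} (hN : N ≠ 0) : 0 < (kacFactor N).toReal := by
  rw [kacFactor_eq hN, ENNReal.toReal_ofReal (kacFactor_pos hN).le]
  exact kacFactor_pos hN

lemma kacFactor_eq_ofReal_toReal {N : ℕ} (hN : N ≠ 0) :
    kacFactor N = ENNReal.ofReal (kacFactor N).toReal := by
  rw [ENNReal.ofReal_toReal]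
  rw [kacFactor_eq hN]
  exact ENNReal.ofReal_ne_top

lemma sphereSlice_eq_kacFactor_mul {N : ℕ} (hN : N ≠ 0) {F : (Fin N → ℝ) → ℝ≥0∞} (hF : Measurable F) :
    sphereSlice N F N = kacFactor N * ∫⁻ v, F v ∂(kacMeasure N) := by
  have hN0 : (0 : ℝ) < N := by exact_mod_cast Nat.pos_of_ne_zero hN
  rw [sphereSlice_eq_lintegral_sphereUniform hN hF hN0, kacFactor, kacMeasure]

/-- Here `log κ_N = (N/2) log(πN) - log 2 - log Γ(N/2 + 1)`. Stirling at `N/2` cancels `(N/2) log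
N`, leaving the same constant as in `gaussianRelEntropy_eq`. -/
lemma tendsto_log_kacFactor_div :
    Tendsto (fun N : ℕ => Real.log (kacFactor N).toReal / N) atTop
      (𝓝 (Real.log (2 * Real.pi) / 2 + 1 / 2)) := by
  have hx : Tendsto (fun N : ℕ => (N : ℝ) / 2) atTop atTop :=
    tendsto_natCast_atTop_atTop.atTop_div_const two_pos
  have h1 := (tendsto_log_Gamma_div.comp hx).const_mul (-(1 / 2) : ℝ)
  have h2 : Tendsto (fun N : ℕ => Real.log 2 * ((N : ℝ))⁻¹) atTop (𝓝 0) := by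
    simpa using tendsto_inv_atTop_nhds_zero_nat.const_mul (Real.log 2)
  have h3 := (h1.sub h2).add_const (Real.log (2 * Real.pi) / 2)
  have h4 : (-(1 / 2) : ℝ) * -1 - 0 + Real.log (2 * Real.pi) / 2 =
      Real.log (2 * Real.pi) / 2 + 1 / 2 := by ring
  rw [h4] at h3
  refine h3.congr' ?_
  filter_upwards [eventually_ge_atTop 1] with N hN
  have hN0 : (0 : ℝ) < N := by exact_mod_cast hN
  have hG := Real.Gamma_pos_of_pos (show (0 : ℝ) < N / 2 + 1 by positivity)
  have h5 : Real.log ((N : ℝ) ^ (((N : ℝ) - 2) / 2) / 2 *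
      (N * (Real.sqrt Real.pi ^ N / Real.Gamma (N / 2 + 1)))) =
      (N - 2) / 2 * Real.log N - Real.log 2 + (Real.log N + (N * (Real.log Real.pi / 2) -
        Real.log (Real.Gamma (N / 2 + 1)))) := by
    rw [Real.log_mul (by positivity) (by positivity), Real.log_div (by positivity) (by norm_num),
      Real.log_rpow hN0, Real.log_mul hN0.ne' (by positivity), Real.log_div (by positivity) hG.ne',
      Real.log_pow, Real.log_sqrt Real.pi_pos.le]
  rw [kacFactor_eq (by omega), ENNReal.toReal_ofReal (kacFactor_pos (by omega)).le, h5,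
    Function.comp_apply, Real.log_div hN0.ne' (by norm_num),
    Real.log_mul (by norm_num) Real.pi_ne_zero]
  field_simp
  ring

/-- With `N = M + k` the numerator is evaluated at `M + (k - s)`, a fixed shift, so both densities
have the same limit `g` after scaling, and `((M + k)/M)^β → 1`. -/
lemma tendsto_ratio {d : ℕ → ℝ → ℝ} {β g : ℝ} (hβ : 0 < β) (hg : 0 < g)
    (h : ∀ t, Tendsto (fun M : ℕ => (M : ℝ) ^ β * d M (M + t)) atTop (𝓝 g)) (k : ℕ) (s : ℝ) :
    Tendsto (fun N : ℕ => d (N - k) (N - s) / d N N) atTop (𝓝 1) := by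
  refine (tendsto_add_atTop_iff_nat k).1 ?_
  have h1 := h (k - s)
  have h2 := (tendsto_add_atTop_iff_nat k).2 (h 0)
  simp only [add_zero] at h2
  have h3 : Tendsto (fun M : ℕ => (((M + k : ℕ) : ℝ) / M) ^ β) atTop (𝓝 1) := by
    have h4 : Tendsto (fun M : ℕ => ((M + k : ℕ) : ℝ) / M) atTop (𝓝 1) := by
      have h5 : Tendsto (fun M : ℕ => 1 + (k : ℝ) * ((M : ℝ))⁻¹) atTop (𝓝 1) := by
        simpa using (tendsto_inv_atTop_nhds_zero_nat.const_mul (k : ℝ)).const_add (1 : ℝ)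
      refine h5.congr' ?_
      filter_upwards [eventually_ge_atTop 1] with M hM
      have : (0 : ℝ) < M := by exact_mod_cast hM
      push_cast
      field_simp
    simpa using h4.rpow_const (p := β) (Or.inr hβ.le)
  have h6 := (h1.div h2 hg.ne').mul h3
  rw [div_self hg.ne', one_mul] at h6
  refine h6.congr' ?_
  filter_upwards [eventually_ge_atTop 1] with M hM
  have hM0 : (0 : ℝ) < M := by exact_mod_cast hM
  have hMk : (0 : ℝ) < ((M + k : ℕ) : ℝ) := by exact_mod_cast (by omega : 0 < M + k)
  have hp1 := Real.rpow_pos_of_pos hM0 β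
  have hp2 := Real.rpow_pos_of_pos hMk β
  simp only [Pi.div_apply]
  rw [Real.div_rpow hMk.le hM0.le, Nat.add_sub_cancel,
    show (M : ℝ) + (k - s) = ((M + k : ℕ) : ℝ) - s by push_cast; ring]
  field_simp

/-- For `N > 2k`, `N ≤ 2(N - k)` costs the factor `2^β`, and eventually `N^β d_N(N) > g/2`.
Uniformity in `u` supplies the domination for both limits of the theorem. -/
lemma exists_ratio_le {d : ℕ → ℝ → ℝ} {β g D : ℝ} (hβ : 0 < β) (hg : 0 < g)
    (h : Tendsto (fun M : ℕ => (M : ℝ) ^ β * d M M) atTop (𝓝 g))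
    (hD : ∀ᶠ M : ℕ in atTop, ∀ u, (M : ℝ) ^ β * |d M u| ≤ D) (k : ℕ) :
    ∀ᶠ N : ℕ in atTop, ∀ u, |d (N - k) u / d N N| ≤ 2 ^ β * D / (g / 2) := by
  filter_upwards [(tendsto_sub_atTop_nat k).eventually hD, h.eventually (lt_mem_nhds (half_lt_self hg)),
    eventually_ge_atTop (2 * k + 1)] with N h1 h2 h3 u
  have hN0 : (0 : ℝ) < N := by exact_mod_cast (by omega : 0 < N)
  have hp := Real.rpow_pos_of_pos hN0 β
  have hd : 0 < d N N := by
    by_contra h'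
    have := mul_nonpos_of_nonneg_of_nonpos hp.le (not_lt.1 h')
    linarith
  have h4 : (N : ℝ) ^ β ≤ 2 ^ β * ((N - k : ℕ) : ℝ) ^ β := by
    rw [← Real.mul_rpow (by norm_num) (by positivity)]
    refine Real.rpow_le_rpow hN0.le ?_ hβ.le
    exact_mod_cast (by omega : N ≤ 2 * (N - k))
  have h5 : (N : ℝ) ^ β * |d (N - k) u| ≤ 2 ^ β * D := by
    calc _ ≤ 2 ^ β * ((N - k : ℕ) : ℝ) ^ β * |d (N - k) u| := by gcongr
      _ = 2 ^ β * (((N - k : ℕ) : ℝ) ^ β * |d (N - k) u|) := by ring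
      _ ≤ _ := by gcongr; exact h1 u
  have h50 : 0 ≤ 2 ^ β * D := le_trans (by positivity) h5
  rw [abs_div, abs_of_pos hd]
  calc |d (N - k) u| / d N N = ((N : ℝ) ^ β * |d (N - k) u|) / ((N : ℝ) ^ β * d N N) := by
        field_simp
    _ ≤ _ := by
        gcongr

/-- The local limit theorem for `V₁² + ⋯ + V_N²`. -/
theorem exists_local_limit {f : ℝ → ℝ} (hf : IsProbDensity f) {p : ℝ≥0∞} (hp : 1 < p)
    (hfp : MemLp f p volume) (hmoment : ∫ x : ℝ, x ^ 2 * f x = 1) {C α : ℝ} (hC : 0 < C)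
    (hα₁ : 1 < α) (hα₂ : α < 2)
    (hν : Asymptotics.IsEquivalent atTop (truncatedFourthMoment f) (fun x : ℝ => C * x ^ (2 - α))) :
    ∃ (n₀ : ℕ) (g D : ℝ), 0 < g ∧
      (∀ N ≥ n₀, N ≠ 0 ∧ ∀ u, 0 ≤ fourierDensity f N u ∧
        sumSqDensity f N u = ENNReal.ofReal (fourierDensity f N u)) ∧
      (∀ t, Tendsto (fun M : ℕ => (M : ℝ) ^ (1 / α) * fourierDensity f M (M + t)) atTop (𝓝 g)) ∧
      ∀ᶠ M : ℕ in atTop, ∀ u, (M : ℝ) ^ (1 / α) * |fourierDensity f M u| ≤ D := by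
  obtain ⟨c, hc, hct⟩ := exists_tendsto_sqCharFun hf hmoment hC hα₁ hα₂ hν
  obtain ⟨n₀, hn₀⟩ := exists_sumSqDensity_eq hf hp hfp
  have hint : ∀ N ≥ n₀, Integrable fun ξ => sqCharFun f ξ ^ N := fun N hN => (hn₀ N hN).2.1
  obtain ⟨D, hD⟩ := exists_fourierDensity_le hf hint hα₁ hc hct
  exact ⟨n₀, _, D, mul_pos (inv_pos.2 Real.pi_pos) (re_integral_exp_neg_mul_rpow_pos hα₁ hc),
    fun N hN => ⟨(hn₀ N hN).1, (hn₀ N hN).2.2⟩, tendsto_fourierDensity hf hint hα₁ hc hct, hD⟩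

/-! ### The conditioned tensor power in a fixed dimension -/

section fixed_dimension

variable {f : ℝ → ℝ} {N : ℕ}

lemma lintegral_tensorPower_kac (hf : IsProbDensity f) (hN : N ≠ 0) {d : ℝ}
    (hK : sumSqDensity f N N = ENNReal.ofReal d) :
    ∫⁻ v, ENNReal.ofReal (tensorPower f N v) ∂(kacMeasure N) =
      ENNReal.ofReal (d / (kacFactor N).toReal) := by
  have hκ := kacFactor_toReal_pos hN
  have h := sphereSlice_eq_kacFactor_mul hN (measurable_tensorPower hf N).ennreal_ofReal
  rw [← sumSqDensity, hK] at h
  rw [ENNReal.ofReal_div_of_pos hκ, h, ← kacFactor_eq_ofReal_toReal hN]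
  have h0 : kacFactor N ≠ 0 := fun h0 => by simp [h0] at hκ
  have h1 : kacFactor N ≠ ∞ := fun h0 => by simp [h0] at hκ
  rw [mul_comm, ENNReal.mul_div_cancel_right h0 h1]

lemma integrable_tensorPower_kac (hf : IsProbDensity f) (hN : N ≠ 0) {d : ℝ}
    (hK : sumSqDensity f N N = ENNReal.ofReal d) :
    Integrable (tensorPower f N) (kacMeasure N) := by
  refine ⟨(measurable_tensorPower hf N).aestronglyMeasurable, ?_⟩
  rw [hasFiniteIntegral_iff_ofReal (Eventually.of_forall (tensorPower_nonneg hf N)),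
    lintegral_tensorPower_kac hf hN hK]
  exact ENNReal.ofReal_lt_top

lemma normalisation_eq (hf : IsProbDensity f) (hN : N ≠ 0) {d : ℝ} (hd : 0 < d)
    (hK : sumSqDensity f N N = ENNReal.ofReal d) :
    normalisation N f (Real.sqrt N) = d / (kacFactor N).toReal := by
  have hκ := kacFactor_toReal_pos hN
  rw [normalisation, ← kacMeasure, integral_eq_lintegral_of_nonneg_ae
    (Eventually.of_forall (tensorPower_nonneg hf N)) (measurable_tensorPower hf N).aestronglyMeasurable,
    lintegral_tensorPower_kac hf hN hK, ENNReal.toReal_ofReal (by positivity)]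

lemma measurable_conditionedTensor (hf : IsProbDensity f) (N : ℕ) :
    Measurable (conditionedTensor f N) :=
  (measurable_tensorPower hf N).div_const _

/-- A push-forward of `F_N dσ^N`, in terms of `sphereSlice`. -/
lemma lintegral_comp_conditionedTensor (hf : IsProbDensity f) (hN : N ≠ 0) {d : ℝ} (hd : 0 < d)
    (hK : sumSqDensity f N N = ENNReal.ofReal d) {g : (Fin N → ℝ) → ℝ≥0∞} (hg : Measurable g) :
    ∫⁻ v, g v ∂((kacMeasure N).withDensity fun v => ENNReal.ofReal (conditionedTensor f N v)) =
      sphereSlice N (fun v => g v * ENNReal.ofReal (tensorPower f N v)) N * ENNReal.ofReal d⁻¹ := by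
  have hκ := kacFactor_toReal_pos hN
  have hT := measurable_tensorPower hf N
  rw [lintegral_withDensity_eq_lintegral_mul _ (measurable_conditionedTensor hf N).ennreal_ofReal hg,
    sphereSlice_eq_kacFactor_mul hN (by fun_prop), kacFactor_eq_ofReal_toReal hN, mul_comm _ (∫⁻ v, _ ∂_),
    mul_assoc, ← ENNReal.ofReal_mul hκ.le, ← lintegral_mul_const' _ _ ENNReal.ofReal_ne_top]
  refine lintegral_congr fun v => ?_
  rw [Pi.mul_apply, conditionedTensor, normalisation_eq hf hN hd hK, div_eq_mul_inv,
    ENNReal.ofReal_mul (tensorPower_nonneg hf N v), inv_div, ← div_eq_mul_inv]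
  ring

lemma isSymmetricDensity_conditionedTensor (hf : IsProbDensity f) (hN : N ≠ 0) {d : ℝ} (hd : 0 < d)
    (hK : sumSqDensity f N N = ENNReal.ofReal d) :
    IsSymmetricDensity N (conditionedTensor f N) := by
  have hκ := kacFactor_toReal_pos hN
  have hZ : 0 < normalisation N f (Real.sqrt N) := by
    rw [normalisation_eq hf hN hd hK]; positivity
  refine ⟨Eventually.of_forall fun v => div_nonneg (tensorPower_nonneg hf N v) hZ.le, ?_, ?_⟩
  · unfold conditionedTensor
    rw [integral_div]
    exact div_self hZ.ne'
  · refine fun τ => Eventually.of_forall fun v => ?_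
    unfold conditionedTensor tensorPower
    congr 1
    exact Equiv.prod_comp τ (fun i => f (v i))

end fixed_dimension

lemma ofReal_indicator_one {β : Type*} (s : Set β) (b : β) :
    ENNReal.ofReal (s.indicator (1 : β → ℝ) b) = s.indicator (1 : β → ℝ≥0∞) b := by
  by_cases h : b ∈ s <;> simp [h]

/-- The marginals of `F_N`. -/
lemma marginal_conditionedTensor {f : ℝ → ℝ} (hf : IsProbDensity f) {m k : ℕ} (hm : m ≠ 0) {d : ℝ}
    (hd : 0 < d) (hK : sumSqDensity f (m + k) (m + k : ℕ) = ENNReal.ofReal d) {e : ℝ → ℝ}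
    (he : ∀ u, 0 ≤ e u) (hKm : ∀ u, sumSqDensity f m u = ENNReal.ofReal (e u)) :
    marginal k (m + k) (conditionedTensor f (m + k)) = volume.withDensity
      (fun w => ENNReal.ofReal (tensorPower f k w * (e ((m + k : ℕ) - ∑ i, w i ^ 2) / d))) := by
  have hfc := measurable_firstCoords k (m + k)
  ext s hs
  have hind : Measurable (s.indicator (1 : (Fin k → ℝ) → ℝ)) := measurable_one.indicator hs
  rw [marginal, ← lintegral_indicator_one hs,
    lintegral_map (measurable_one.indicator hs) hfc,
    lintegral_comp_conditionedTensor (g := fun v => s.indicator 1 (firstCoords k (m + k) v)) hf (by omega)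
      hd hK ((measurable_one.indicator hs).comp hfc),
    withDensity_apply _ hs, ← lintegral_indicator hs]
  have h := sphereSlice_firstCoords hf hm k hind ((m + k : ℕ) : ℝ)
  simp_rw [ofReal_indicator_one] at h
  rw [h, ← lintegral_mul_const' _ _ ENNReal.ofReal_ne_top]
  refine lintegral_congr fun w => ?_
  by_cases hw : w ∈ s
  · rw [Set.indicator_of_mem hw, Set.indicator_of_mem hw, hKm, Pi.one_apply, one_mul, div_eq_mul_inv,
      ENNReal.ofReal_mul (tensorPower_nonneg hf k w), ENNReal.ofReal_mul (he _), mul_assoc]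
  · rw [Set.indicator_of_notMem hw, Set.indicator_of_notMem hw]
    simp

/-- The one-coordinate marginals of `F_N`. -/
lemma map_coord_conditionedTensor {f : ℝ → ℝ} (hf : IsProbDensity f) {n : ℕ} (hn : n ≠ 0)
    (i : Fin (n + 1)) {d : ℝ} (hd : 0 < d)
    (hK : sumSqDensity f (n + 1) (n + 1 : ℕ) = ENNReal.ofReal d) {e : ℝ → ℝ}
    (he : ∀ u, 0 ≤ e u) (hKm : ∀ u, sumSqDensity f n u = ENNReal.ofReal (e u)) :
    ((kacMeasure (n + 1)).withDensity fun v => ENNReal.ofReal (conditionedTensor f (n + 1) v)).map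
      (fun v => v i) = volume.withDensity
      (fun x => ENNReal.ofReal (f x * (e ((n + 1 : ℕ) - x ^ 2) / d))) := by
  have hfc : Measurable fun v : Fin (n + 1) → ℝ => v i := measurable_pi_apply i
  ext s hs
  have hind : Measurable (s.indicator (1 : ℝ → ℝ)) := measurable_one.indicator hs
  rw [← lintegral_indicator_one hs,
    lintegral_map (measurable_one.indicator hs) hfc,
    lintegral_comp_conditionedTensor (g := fun v => s.indicator 1 (v i)) hf (by omega) hd hK
      ((measurable_one.indicator hs).comp hfc),
    withDensity_apply _ hs, ← lintegral_indicator hs]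
  have h := sphereSlice_coord hf hn i hind ((n + 1 : ℕ) : ℝ)
  simp_rw [ofReal_indicator_one] at h
  rw [h, ← lintegral_mul_const' _ _ ENNReal.ofReal_ne_top]
  refine lintegral_congr fun w => ?_
  by_cases hw : w ∈ s
  · rw [Set.indicator_of_mem hw, Set.indicator_of_mem hw, hKm, Pi.one_apply, one_mul, div_eq_mul_inv,
      ENNReal.ofReal_mul (hf.nonneg w), ENNReal.ofReal_mul (he _), mul_assoc]
  · rw [Set.indicator_of_notMem hw, Set.indicator_of_notMem hw]
    simp

/-! ### The entropy through one-coordinate marginals -/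

section entropy_identity

variable {f : ℝ → ℝ}

/-- Where some `f(vᵢ) = 0` the logarithm does not split, but the prefactor vanishes and both sides
are `0`. -/
lemma conditionedTensor_mul_log {N : ℕ}
    (hZ : 0 < normalisation N f (Real.sqrt N)) (v : Fin N → ℝ) :
    conditionedTensor f N v * Real.log (conditionedTensor f N v) =
      conditionedTensor f N v *
        ((∑ i, Real.log (f (v i))) - Real.log (normalisation N f (Real.sqrt N))) := by
  by_cases h : ∃ i, f (v i) = 0
  · obtain ⟨i, hi⟩ := h
    have : conditionedTensor f N v = 0 := by
      rw [conditionedTensor, tensorPower, Finset.prod_eq_zero (Finset.mem_univ i) hi, zero_div]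
    rw [this, zero_mul, zero_mul]
  · push Not at h
    congr 1
    rw [conditionedTensor, Real.log_div _ hZ.ne', tensorPower, Real.log_prod (fun i _ => h i)]
    exact Finset.prod_ne_zero_iff.2 fun i _ => h i

/-- The entropy of `F_N` in terms of the one-coordinate marginal. -/
lemma kacEntropy_conditionedTensor (hf : IsProbDensity f) {n : ℕ} (hn : n ≠ 0)
    (hflog : Integrable fun x => f x * Real.log (f x)) {d : ℝ} (hd : 0 < d)
    (hK : sumSqDensity f (n + 1) (n + 1 : ℕ) = ENNReal.ofReal d) {e : ℝ → ℝ} (hem : Measurable e)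
    (he : ∀ u, 0 ≤ e u) {B : ℝ} (heB : ∀ u, |e u / d| ≤ B)
    (hKm : ∀ u, sumSqDensity f n u = ENNReal.ofReal (e u)) :
    Integrable (fun v => conditionedTensor f (n + 1) v * Real.log (conditionedTensor f (n + 1) v))
      (kacMeasure (n + 1)) ∧
    kacEntropy (n + 1) (conditionedTensor f (n + 1)) =
      (n + 1 : ℕ) * (∫ x, f x * Real.log (f x) * (e ((n + 1 : ℕ) - x ^ 2) / d)) -
        Real.log (d / (kacFactor (n + 1)).toReal) := by
  have hN : n + 1 ≠ 0 := Nat.succ_ne_zero n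
  have hfm := hf.measurable
  have hκ := kacFactor_toReal_pos hN
  have hZeq := normalisation_eq hf hN hd hK
  have hZ : 0 < normalisation (n + 1) f (Real.sqrt (n + 1 : ℕ)) := by rw [hZeq]; positivity
  set F := conditionedTensor f (n + 1) with hF
  have hFm : Measurable F := measurable_conditionedTensor hf (n + 1)
  have hF0 : ∀ v, 0 ≤ F v := fun v => div_nonneg (tensorPower_nonneg hf _ v) hZ.le
  set μ := (kacMeasure (n + 1)).withDensity fun v => ENNReal.ofReal (F v) with hμ
  set L := Real.log (normalisation (n + 1) f (Real.sqrt (n + 1 : ℕ))) with hL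
  have hμ1 : μ Set.univ = 1 := by
    have hsym := isSymmetricDensity_conditionedTensor hf hN hd hK
    have hint : Integrable F (kacMeasure (n + 1)) := (integrable_tensorPower_kac hf hN hK).div_const _
    rw [hμ, withDensity_apply _ MeasurableSet.univ, Measure.restrict_univ,
      ← ofReal_integral_eq_lintegral_ofReal hint (Eventually.of_forall hF0), hsym.integral_eq_one,
      ENNReal.ofReal_one]
  have hprob : IsProbabilityMeasure μ := ⟨hμ1⟩
  have hwm : Measurable fun x : ℝ => f x * (e ((n + 1 : ℕ) - x ^ 2) / d) := by fun_prop
  have hw0 : ∀ x : ℝ, 0 ≤ f x * (e ((n + 1 : ℕ) - x ^ 2) / d) := fun x =>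
    mul_nonneg (hf.nonneg x) (div_nonneg (he _) hd.le)
  have hlogm : Measurable fun x => Real.log (f x) := by fun_prop
  have hi1 : Integrable fun x => f x * Real.log (f x) * (e ((n + 1 : ℕ) - x ^ 2) / d) :=
    hflog.mul_bdd (Measurable.aestronglyMeasurable (by fun_prop))
      (Eventually.of_forall fun x => heB ((n + 1 : ℕ) - x ^ 2))
  -- Under `F_N dσ^N` all coordinates have the same law, with density `f` times a bounded ratio.
  -- Hence each `log f(vᵢ)` is integrable because `f log f` is, and the `n + 1` expectations
  -- coincide.
  have hcoord : ∀ i : Fin (n + 1), Integrable (fun v : Fin (n + 1) → ℝ => Real.log (f (v i))) μ ∧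
      ∫ v, Real.log (f (v i)) ∂μ = ∫ x, f x * Real.log (f x) * (e ((n + 1 : ℕ) - x ^ 2) / d) := by
    intro i
    have hmap := map_coord_conditionedTensor hf hn i hd hK he hKm
    have hmi : Measurable fun v : Fin (n + 1) → ℝ => v i := measurable_pi_apply i
    constructor
    · have h1 : Integrable (fun x => Real.log (f x)) (μ.map fun v => v i) := by
        rw [hμ, hmap, integrable_withDensity_iff_integrable_smul' hwm.ennreal_ofReal (by simp)]
        refine hi1.congr (Eventually.of_forall fun x => ?_)
        simp only [ENNReal.toReal_ofReal (hw0 x), smul_eq_mul]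
        ring
      exact (integrable_map_measure hlogm.aestronglyMeasurable hmi.aemeasurable).1 h1
    · rw [← integral_map hmi.aemeasurable (f := fun x => Real.log (f x)) hlogm.aestronglyMeasurable,
        hμ, hmap, integral_withDensity_eq_integral_toReal_smul hwm.ennreal_ofReal (by simp)]
      congr 1
      ext x
      rw [ENNReal.toReal_ofReal (hw0 x), smul_eq_mul]
      ring
  have hsumi : Integrable (fun v : Fin (n + 1) → ℝ => ∑ i, Real.log (f (v i))) μ :=
    integrable_finsetSum _ fun i _ => (hcoord i).1
  have hglob : Integrable (fun v : Fin (n + 1) → ℝ => (∑ i, Real.log (f (v i))) - L) μ :=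
    hsumi.sub (integrable_const L)
  have hlog := conditionedTensor_mul_log hZ
  constructor
  · rw [hμ, integrable_withDensity_iff_integrable_smul' hFm.ennreal_ofReal (by simp)] at hglob
    refine hglob.congr (Eventually.of_forall fun v => ?_)
    simp only [ENNReal.toReal_ofReal (hF0 v), smul_eq_mul]
    exact (hlog v).symm
  · have h2 : kacEntropy (n + 1) F = ∫ v, ((∑ i, Real.log (f (v i))) - L) ∂μ := by
      rw [hμ, integral_withDensity_eq_integral_toReal_smul hFm.ennreal_ofReal (by simp), kacEntropy]
      congr 1
      ext v
      rw [ENNReal.toReal_ofReal (hF0 v), smul_eq_mul]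
      exact hlog v
    rw [h2, integral_sub hsumi (integrable_const L), integral_finsetSum _ fun i _ => (hcoord i).1,
      integral_const, measureReal_def, hμ1, ENNReal.toReal_one, one_smul, hL, hZeq]
    simp_rw [fun i => (hcoord i).2]
    simp

end entropy_identity

/-- `log a_N = log(N^β a_N) - β log N`, a convergent sequence plus `O(log N)`. -/
lemma tendsto_log_div_of_tendsto_rpow_mul {a : ℕ → ℝ} {β g : ℝ} (hg : 0 < g)
    (h : Tendsto (fun N : ℕ => (N : ℝ) ^ β * a N) atTop (𝓝 g)) :
    Tendsto (fun N : ℕ => Real.log (a N) / N) atTop (𝓝 0) := by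
  have h1 : Tendsto (fun N : ℕ => Real.log ((N : ℝ) ^ β * a N) * ((N : ℝ))⁻¹) atTop (𝓝 0) := by
    simpa using (h.log hg.ne').mul tendsto_inv_atTop_nhds_zero_nat
  have h2 : Tendsto (fun N : ℕ => Real.log (N : ℝ) / N) atTop (𝓝 0) :=
    (Real.isLittleO_log_id_atTop.tendsto_div_nhds_zero).comp tendsto_natCast_atTop_atTop
  have h3 := h1.sub (h2.const_mul β)
  rw [mul_zero, sub_zero] at h3
  refine h3.congr' ?_
  filter_upwards [eventually_ge_atTop 1, h.eventually (lt_mem_nhds hg)] with N hN hpos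
  have hN0 : (0 : ℝ) < N := by exact_mod_cast hN
  have hp := Real.rpow_pos_of_pos hN0 β
  have ha : 0 < a N := pos_of_mul_pos_right hpos hp.le
  rw [Real.log_mul hp.ne' ha.ne', Real.log_rpow hN0]
  field_simp
  ring

end

end KacChaos

/-! ### Chaos and entropic chaos -/

open KacChaos in
theorem mainTheorem1 (f : ℝ → ℝ) (hf : KacChaos.IsProbDensity f)
    (p : ENNReal) (hp : 1 < p) (hfp : MeasureTheory.MemLp f p MeasureTheory.volume)
    (hmoment : ∫ x : ℝ, x ^ 2 * f x = 1)
    (C α : ℝ) (hC : 0 < C) (hα₁ : 1 < α) (hα₂ : α < 2)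
    (hν : Asymptotics.IsEquivalent Filter.atTop (KacChaos.truncatedFourthMoment f)
      (fun x : ℝ => C * x ^ (2 - α))) :
    (∀ᶠ N : ℕ in Filter.atTop,
      MeasureTheory.Integrable (KacChaos.tensorPower f N)
        (KacChaos.sphereUniform N (Real.sqrt N)) ∧
      0 < KacChaos.normalisation N f (Real.sqrt N)) ∧
    KacChaos.IsChaotic (KacChaos.conditionedTensor f) f ∧
    KacChaos.IsEntropicallyChaotic (KacChaos.conditionedTensor f) f := by
  obtain ⟨n₀, g, D, hg, hK, hlim, hD⟩ := exists_local_limit hf hp hfp hmoment hC hα₁ hα₂ hν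
  have hβ : 0 < 1 / α := one_div_pos.2 (by linarith)
  have hlim0 : Tendsto (fun M : ℕ => (M : ℝ) ^ (1 / α) * fourierDensity f M M) atTop (𝓝 g) := by
    simpa only [add_zero] using hlim 0
  have hbound := exists_ratio_le hβ hg hlim0 hD
  have hratio := tendsto_ratio hβ hg hlim
  have hpos : ∀ᶠ N : ℕ in atTop, 0 < fourierDensity f N N := by
    filter_upwards [hlim0.eventually (lt_mem_nhds hg)] with N hN
    exact pos_of_mul_pos_right hN (by positivity)
  have hfirst : ∀ᶠ N : ℕ in atTop, Integrable (tensorPower f N) (sphereUniform N (Real.sqrt N)) ∧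
      0 < normalisation N f (Real.sqrt N) := by
    filter_upwards [hpos, eventually_ge_atTop n₀] with N hd hN
    have hκ := kacFactor_toReal_pos (hK N hN).1
    refine ⟨integrable_tensorPower_kac hf (hK N hN).1 ((hK N hN).2 N).2, ?_⟩
    rw [normalisation_eq hf (hK N hN).1 hd ((hK N hN).2 N).2]
    positivity
  have hchaos : IsChaotic (conditionedTensor f) f := by
    refine ⟨?_, fun k φ => ?_⟩
    · filter_upwards [hpos, eventually_ge_atTop n₀] with N hd hN
      exact isSymmetricDensity_conditionedTensor hf (hK N hN).1 hd ((hK N hN).2 N).2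
    · have hT := measurable_tensorPower hf k
      have hlimval : ∫ w, φ w ∂(tensorMeasure f k) = ∫ w, tensorPower f k w * 1 * φ w := by
        rw [tensorMeasure, integral_withDensity_eq_integral_toReal_smul hT.ennreal_ofReal (by simp)]
        congr 1
        ext w
        rw [ENNReal.toReal_ofReal (tensorPower_nonneg hf k w), smul_eq_mul, mul_one]
      rw [hlimval]
      -- The marginal density is `f^{⊗k}` times a ratio tending to `1` pointwise and bounded
      -- uniformly in `w`, so `f^{⊗k}` times a constant dominates.
      have hdct : Tendsto (fun N : ℕ => ∫ w : Fin k → ℝ, tensorPower f k w *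
          (fourierDensity f (N - k) (N - ∑ i, w i ^ 2) / fourierDensity f N N) * φ w) atTop
          (𝓝 (∫ w, tensorPower f k w * 1 * φ w)) := by
        refine tendsto_integral_filter_of_dominated_convergence
          (fun w => tensorPower f k w * (2 ^ (1 / α) * D / (g / 2)) * ‖φ‖) ?_ ?_ ?_ ?_
        · refine Eventually.of_forall fun N => Measurable.aestronglyMeasurable ?_
          have h1 := measurable_fourierDensity hf (N - k)
          have h2 := φ.continuous.measurable
          fun_prop
        · filter_upwards [hbound k] with N hN
          refine Eventually.of_forall fun w => ?_
          have h0 := tensorPower_nonneg hf k w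
          rw [norm_mul, norm_mul, Real.norm_of_nonneg h0]
          have h1 := hN (N - ∑ i, w i ^ 2)
          have h2 := φ.norm_coe_le_norm w
          have h3 : 0 ≤ 2 ^ (1 / α) * D / (g / 2) := (abs_nonneg _).trans h1
          rw [← Real.norm_eq_abs] at h1
          gcongr
        · exact ((integrable_tensorPower hf k).mul_const _).mul_const _
        · refine Eventually.of_forall fun w => ?_
          exact ((hratio k (∑ i, w i ^ 2)).const_mul _).mul_const _
      refine hdct.congr' ?_
      filter_upwards [hpos, eventually_ge_atTop (n₀ + k)] with N hd hN
      obtain ⟨m, rfl⟩ : ∃ m, N = m + k := ⟨N - k, by omega⟩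
      have hm := hK m (by omega)
      have hmk := hK (m + k) (by omega)
      rw [marginal_conditionedTensor hf hm.1 hd (hmk.2 _).2 (fun u => (hm.2 u).1)
        (fun u => (hm.2 u).2), integral_withDensity_eq_integral_toReal_smul ?_ (by simp)]
      · congr 1
        ext w
        rw [ENNReal.toReal_ofReal (mul_nonneg (tensorPower_nonneg hf k w)
          (div_nonneg (hm.2 _).1 hd.le)), smul_eq_mul, Nat.add_sub_cancel]
      · have h1 := measurable_fourierDensity hf m
        fun_prop
  have hflog := integrable_mul_log hf hp hfp hmoment
  have hent : ∀ᶠ N : ℕ in atTop,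
      Integrable (fun v => conditionedTensor f N v * Real.log (conditionedTensor f N v)) (kacMeasure N) ∧
      kacEntropy N (conditionedTensor f N) =
        N * (∫ x, f x * Real.log (f x) *
          (fourierDensity f (N - 1) (N - x ^ 2) / fourierDensity f N N)) -
        Real.log (fourierDensity f N N / (kacFactor N).toReal) := by
    filter_upwards [hpos, eventually_ge_atTop (n₀ + 1), hbound 1] with N hd hN hB
    obtain ⟨n, rfl⟩ : ∃ n, N = n + 1 := ⟨N - 1, by omega⟩
    have hn := hK n (by omega)
    have hn1 := hK (n + 1) (by omega)
    exact kacEntropy_conditionedTensor hf hn.1 hflog hd (hn1.2 _).2 (measurable_fourierDensity hf n)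
      (fun u => (hn.2 u).1) hB (fun u => (hn.2 u).2)
  refine ⟨hfirst, hchaos, hchaos, hent.mono fun N h => h.1,
    integrable_mul_log_div_gaussian hf hp hfp hmoment, ?_⟩
  have hdct : Tendsto (fun N : ℕ => ∫ x, f x * Real.log (f x) *
      (fourierDensity f (N - 1) (N - x ^ 2) / fourierDensity f N N)) atTop
      (𝓝 (∫ x, f x * Real.log (f x) * 1)) := by
    refine tendsto_integral_filter_of_dominated_convergence
      (fun x => ‖f x * Real.log (f x)‖ * (2 ^ (1 / α) * D / (g / 2))) ?_ ?_ ?_ ?_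
    · refine Eventually.of_forall fun N => Measurable.aestronglyMeasurable ?_
      have h1 := measurable_fourierDensity hf (N - 1)
      have h2 := hf.measurable
      fun_prop
    · filter_upwards [hbound 1] with N hN
      refine Eventually.of_forall fun x => ?_
      rw [norm_mul]
      gcongr
      exact hN (N - x ^ 2)
    · exact hflog.norm.mul_const _
    · exact Eventually.of_forall fun x => (hratio 1 (x ^ 2)).const_mul _
  simp only [mul_one] at hdct
  have hlogd := tendsto_log_div_of_tendsto_rpow_mul hg hlim0
  -- The three terms of `H_N/N`: the marginal average of `log f`, then `-log h_N(N)/N → 0`, then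
  -- `log κ_N / N`.
  have hall := (hdct.sub hlogd).add tendsto_log_kacFactor_div
  rw [sub_zero, ← gaussianRelEntropy_eq hf hp hfp hmoment] at hall
  refine hall.congr' ?_
  filter_upwards [hent, hpos, eventually_ge_atTop 1] with N hN hd hN1
  have hN0 : (0 : ℝ) < N := by exact_mod_cast hN1
  rw [hN.2, Real.log_div hd.ne' (kacFactor_toReal_pos (by omega)).ne']
  field_simp
  ring
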